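/- **Setting.** Let $\mathbb K$ be a field of characteristic not two, $F=\mathbb K((t))$, $A=\mathbb K[[t]]$, let $p,q\ge 0$ be integers with $n=p+q\ge 1$, and let $V=F^n=V_+\oplus V_-$, where $V_+$ is spanned by the first $p$ and $V_-$ by the last $q$ coordinate vectors; $\pi_\pm$ is the projection onto $V_\pm$ along $V_\mp$. Let $K=\mathrm{GL}_p(F)\times \mathrm{GL}_q(F)$ be the group of block diagonal matrices in $\mathrm{GL}_n(F)$. An $A$-lattice is the $A$-span of an $F$-basis of $V$. An *affine flag* is a chain of $A$-lattices $\Lambda_\bullet=(\Lambda_1\supset\Lambda_2\supset\dots\supset\Lambda_n)$ with $\Lambda_n\supset t\Lambda_1$ and $\dim_{\mathbb K}(\Lambda_j/\Lambda_{j+1})=1$ for $1\le j<n$; it is extended to all $i\in\mathbb Z$ by $\Lambda_{i+n}=t\Lambda_i$. The affine flag variety $\widetilde{Fl}_n$ is the set of affine flags, on which $\mathrm{GL}_n(F)$, and hence $K$, acts by $(g\Lambda)_i=g\Lambda_i$. For $i\in\mathbb Z$ put $$(i;\pm)=\dim_{\mathbb K}\frac{\Lambda_i\cap V_\pm}{\Lambda_{i+1}\cap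 V_\pm},\qquad (i;\mathbb N)=\dim_{\mathbb K}\frac{\Lambda_i}{(\Lambda_i\cap V_+)\oplus(\Lambda_i\cap V_-)},$$ and, for integers $i<j$ with $i\le n+1$, $(i;j)=\dim_{\mathbb K}\big((\pi_+(\Lambda_j)+\Lambda_i)/t\Lambda_1\big)$. **Affine clans.** An *affine $(p,q)$-clan* is a sequence $c=(c_i)_{i\in\mathbb Z}$ with entries in $\{+,-\}\sqcup\mathbb Z$ such that, for all $i,k\in\mathbb Z$, $c_{i+kn}=c_i+kn$ if $c_i\in\mathbb Z$ and $c_{i+kn}=c_i$ if $c_i$ is a sign; the number of $+$ minus the number of $-$ among $c_1,\dots,c_n$ is $p-q$; and every integer that appears in $c$ appears exactly twice. Two such sequences $c,d$ are identified if they have the same signs in the same positions and, for all $i\ne j$, $c_i=c_j\in\mathbb Z$ if and only if $d_i=d_j\in\mathbb Z$. **The clan $c(\Lambda_\bullet)$.** For $i=1,\dots,n$ in this order, if $c_i$ is not yet determined, do the following. If $(i;+)=1$ and $(i;-)=0$, set $c_{i+rn}=+$ for all $r\in\mathbb Z$; if $(i;+)=0$ and $(i;-)=1$, set $c_{i+rn}=-$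 for all $r$. Otherwise let $m=1$ if $\{c_1,\dots,c_{i-1}\}\cap[1,n]$ is empty, and let $m$ be one more than its maximum if not. If $(i;+)=(i;-)=0$, set $c_{i+rn}=m+rn$ for all $r$. If $(i;+)=(i;-)=1$, choose $v_+\in\pi_+(\Lambda_{i+1})\setminus\Lambda_{i+1}$ with $\Lambda_i=\Lambda_{i+1}+\mathbb Kv_+$, and let $j>i$ be the unique index with $v_+\in\pi_+(\Lambda_j)+\Lambda_{i+1}$ and $v_+\notin\pi_+(\Lambda_{j+1})+\Lambda_{i+1}$; if $c_j$ is already determined, set $c_{i+rn}=c_j+rn$ for all $r$; if not, set $c_{j+rn}=c_{i+rn}=m+rn$ for all $r$. **Theorem 1.3.** 1. The quantities $(i;+)$, $(i;-)$, $(i;\mathbb N)$ and $(i;j)$ are the same for $\Lambda_\bullet$ and $k\Lambda_\bullet$, for every $k\in K$. 2. For every affine flag $\Lambda_\bullet$ the procedure determines all entries of a sequence $c(\Lambda_\bullet)$. This sequence is an affine $(p,q)$-clan, and, up to the above identification, it is the unique affine $(p,q)$-clan $c$ such that for all $1\le i\le n$ and all $j>i$: - $(i;\mathbb N)=\#\{a\in\mathbb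 Z: c_x=c_y=a\text{ for some }x<i\le y\}$; - if $c_i=+$ then $(i;+)=1$ and $(i;-)=0$, and if $c_i=-$ then $(i;+)=0$ and $(i;-)=1$; - $(i;j)=n+1-i+\#\{a\in\mathbb Z: c_x=c_y=a\text{ for some }x<i<j\le y\}$. 3. The map $\Lambda_\bullet\mapsto c(\Lambda_\bullet)$ induces a bijection from the set of $K$-orbits on $\widetilde{Fl}_n$ onto the set of affine $(p,q)$-clans. -/

import Mathlib

open scoped Pointwise

namespace AffineClans

noncomputable section

/-! ### Lattices and affine flags

`𝕜` is the base field, `F = 𝕜((t))` is `LaurentSeries 𝕜`, `A = 𝕜[[t]]` is `PowerSeries 𝕜`, with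
`t = PowerSeries.X`, and `n = p + q`.  The coordinates `1, …, p` and `p + 1, …, n` are indexed by
the two summands of `Fin p ⊕ Fin q`. -/

instance (𝕜 : Type*) [Field 𝕜] : IsScalarTower 𝕜 (PowerSeries 𝕜) (LaurentSeries 𝕜) :=
  ⟨fun a f x => by
    change HahnSeries.ofPowerSeries ℤ 𝕜 (a • f) * x = a • (HahnSeries.ofPowerSeries ℤ 𝕜 f * x)
    rw [PowerSeries.smul_eq_C_mul, map_mul, mul_assoc, HahnSeries.ofPowerSeries_C,
      HahnSeries.C_mul_eq_smul]⟩

/-- The vector space `V = F ^ n`. -/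
abbrev Vec (𝕜 : Type*) [Field 𝕜] (p q : ℕ) : Type _ := Fin p ⊕ Fin q → LaurentSeries 𝕜

variable {𝕜 : Type*} [Field 𝕜] {p q : ℕ}

/-- `A`-submodules of `V`. -/
abbrev Sub (𝕜 : Type*) [Field 𝕜] (p q : ℕ) : Type _ := Submodule (PowerSeries 𝕜) (Vec 𝕜 p q)

/-- The dimension over `𝕜` of `M / N`, for `A`-submodules `N ≤ M` of `V`
(it is `⊤` if the quotient is infinite dimensional). -/
def relDim (M N : Sub 𝕜 p q) : ℕ∞ :=
  Cardinal.toENat (Module.rank 𝕜 (M ⧸ N.submoduleOf M))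

/-- An `A`-lattice is the `A`-span of an `F`-basis of `V`. -/
def IsLattice (M : Sub 𝕜 p q) : Prop :=
  ∃ b : Module.Basis (Fin p ⊕ Fin q) (LaurentSeries 𝕜) (Vec 𝕜 p q),
    M = Submodule.span (PowerSeries 𝕜) (Set.range b)

/-- An affine flag `Λ₁ ⊃ Λ₂ ⊃ ⋯ ⊃ Λₙ ⊃ t Λ₁`, recorded together with its extension to all integer
indices by `Λ_{i + n} = t Λ_i`.  Consecutive quotients are one-dimensional (for the step from `Λₙ`
to `t Λ₁` this follows from the other steps, as `Λ₁ / t Λ₁` has dimension `n`). -/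
@[ext]
structure AffineFlag (𝕜 : Type*) [Field 𝕜] (p q : ℕ) where
  /-- the lattice `Λ_i` -/
  lat : ℤ → Sub 𝕜 p q
  isLattice : ∀ i, IsLattice (lat i)
  succ_le : ∀ i, lat (i + 1) ≤ lat i
  periodic : ∀ i, lat (i + (p + q : ℕ)) = (PowerSeries.X : PowerSeries 𝕜) • lat i
  relDim_succ : ∀ i, relDim (lat i) (lat (i + 1)) = 1

/-! ### The group actions -/

/-- `GL_n(F)`. -/
abbrev LoopGL (𝕜 : Type*) [Field 𝕜] (p q : ℕ) : Type _ :=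
  Matrix.GeneralLinearGroup (Fin p ⊕ Fin q) (LaurentSeries 𝕜)

/-- Left multiplication of column vectors by `g`. -/
def glEquiv (g : LoopGL 𝕜 p q) : Vec 𝕜 p q ≃ₗ[LaurentSeries 𝕜] Vec 𝕜 p q :=
  Matrix.toLin'OfInv (M := ((g⁻¹ : LoopGL 𝕜 p q) : Matrix _ _ (LaurentSeries 𝕜)))
    (M' := (g : Matrix _ _ (LaurentSeries 𝕜)))
    (by rw [← Units.val_mul, inv_mul_cancel, Units.val_one])
    (by rw [← Units.val_mul, mul_inv_cancel, Units.val_one])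

theorem glEquiv_apply (g : LoopGL 𝕜 p q) (v : Vec 𝕜 p q) :
    glEquiv g v = Matrix.mulVec (g : Matrix _ _ (LaurentSeries 𝕜)) v := rfl

/-- The image `g M` of an `A`-submodule. -/
def smulSub (g : LoopGL 𝕜 p q) (M : Sub 𝕜 p q) : Sub 𝕜 p q :=
  M.map ((glEquiv g).restrictScalars (PowerSeries 𝕜)).toLinearMap

theorem mem_smulSub {g : LoopGL 𝕜 p q} {M : Sub 𝕜 p q} {w : Vec 𝕜 p q} :
    w ∈ smulSub g M ↔ ∃ v ∈ M, Matrix.mulVec (g : Matrix _ _ (LaurentSeries 𝕜)) v = w :=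
  Iff.rfl

theorem relDim_smulSub (g : LoopGL 𝕜 p q) (M N : Sub 𝕜 p q) :
    relDim (smulSub g M) (smulSub g N) = relDim M N := by
  let e := (glEquiv g).restrictScalars (PowerSeries 𝕜)
  have h : (N.submoduleOf M).map (e.submoduleMap M).toLinearMap =
      (smulSub g N).submoduleOf (smulSub g M) := by
    ext ⟨w, hw⟩
    simp only [Submodule.mem_map, Submodule.submoduleOf, Submodule.mem_comap]
    constructor
    · rintro ⟨v, hv, hvw⟩
      exact ⟨v, hv, congrArg Subtype.val hvw⟩
    · rintro ⟨v, hv, hvw⟩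
      obtain ⟨v', hv', hvw'⟩ := hw
      have hvv : v' = v := e.injective (hvw'.trans hvw.symm)
      subst hvv
      exact ⟨⟨v', hv'⟩, hv, Subtype.ext hvw'⟩
  have e2 : (M ⧸ N.submoduleOf M) ≃ₗ[𝕜] (smulSub g M ⧸ (smulSub g N).submoduleOf (smulSub g M)) :=
    (Submodule.Quotient.equiv (N.submoduleOf M) ((smulSub g N).submoduleOf (smulSub g M))
      (e.submoduleMap M) h).restrictScalars 𝕜
  unfold relDim
  rw [e2.rank_eq]

/-- `GL_n(F)` acts on affine flags by `(g Λ)_i = g Λ_i`. -/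
instance : MulAction (LoopGL 𝕜 p q) (AffineFlag 𝕜 p q) where
  smul g Λ :=
    { lat := fun i => smulSub g (Λ.lat i)
      isLattice := fun i => by
        obtain ⟨b, hb⟩ := Λ.isLattice i
        refine ⟨b.map (glEquiv g), ?_⟩
        rw [hb, smulSub, Submodule.map_span, ← Set.range_comp]
        rfl
      succ_le := fun i => Submodule.map_mono (Λ.succ_le i)
      periodic := fun i => by
        rw [Λ.periodic, smulSub, smulSub, Submodule.map_pointwise_smul]
      relDim_succ := fun i => by rw [relDim_smulSub, Λ.relDim_succ] }
  one_smul Λ := by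
    ext i w
    change w ∈ smulSub 1 (Λ.lat i) ↔ _
    simp [mem_smulSub]
  mul_smul g h Λ := by
    ext i w
    change w ∈ smulSub (g * h) (Λ.lat i) ↔ w ∈ smulSub g (smulSub h (Λ.lat i))
    simp [mem_smulSub, Matrix.mulVec_mulVec]

theorem smul_lat (g : LoopGL 𝕜 p q) (Λ : AffineFlag 𝕜 p q) (i : ℤ) :
    (g • Λ).lat i = smulSub g (Λ.lat i) := rfl

/-- The subgroup `K = GL_p(F) × GL_q(F)` of block diagonal matrices in `GL_n(F)`. -/
def blockGL (𝕜 : Type*) [Field 𝕜] (p q : ℕ) : Subgroup (LoopGL 𝕜 p q) where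
  carrier := {g | ∃ (a : Matrix.GeneralLinearGroup (Fin p) (LaurentSeries 𝕜))
    (d : Matrix.GeneralLinearGroup (Fin q) (LaurentSeries 𝕜)),
    (g : Matrix _ _ (LaurentSeries 𝕜)) = Matrix.fromBlocks a.1 0 0 d.1}
  one_mem' := ⟨1, 1, by simp [Matrix.fromBlocks_one]⟩
  mul_mem' := by
    rintro g h ⟨a, d, hg⟩ ⟨a', d', hh⟩
    exact ⟨a * a', d * d', by simp [hg, hh, Matrix.fromBlocks_multiply]⟩
  inv_mem' := by
    rintro g ⟨a, d, hg⟩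
    refine ⟨a⁻¹, d⁻¹, ?_⟩
    have h1 : (g : Matrix _ _ (LaurentSeries 𝕜)) *
        Matrix.fromBlocks (a⁻¹).1 0 0 (d⁻¹).1 = 1 := by
      rw [hg, Matrix.fromBlocks_multiply, ← Units.val_mul, ← Units.val_mul]
      simp [Matrix.fromBlocks_one]
    exact (Units.inv_eq_of_mul_eq_one_right h1)

/-! ### The dimension invariants -/

/-- `V₊`, the span of the first `p` coordinate vectors. -/
def Vplus (𝕜 : Type*) [Field 𝕜] (p q : ℕ) : Sub 𝕜 p q where
  carrier := {v | ∀ s : Fin q, v (Sum.inr s) = 0}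
  add_mem' := fun ha hb s => by simp [ha s, hb s]
  zero_mem' := fun _ => rfl
  smul_mem' := fun c v hv s => by simp [hv s]

/-- `V₋`, the span of the last `q` coordinate vectors. -/
def Vminus (𝕜 : Type*) [Field 𝕜] (p q : ℕ) : Sub 𝕜 p q where
  carrier := {v | ∀ r : Fin p, v (Sum.inl r) = 0}
  add_mem' := fun ha hb s => by simp [ha s, hb s]
  zero_mem' := fun _ => rfl
  smul_mem' := fun c v hv s => by simp [hv s]

/-- The projection `π₊` of `V = V₊ ⊕ V₋` onto `V₊`. -/
def projPlus (𝕜 : Type*) [Field 𝕜] (p q : ℕ) : Vec 𝕜 p q →ₗ[PowerSeries 𝕜] Vec 𝕜 p q where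
  toFun v := Sum.elim (fun r => v (Sum.inl r)) (fun _ => 0)
  map_add' v w := by ext (r | s) <;> simp
  map_smul' c v := by ext (r | s) <;> simp

/-- `(i; +) = dim (Λ_i ∩ V₊) / (Λ_{i+1} ∩ V₊)`. -/
def dimPlus (Λ : AffineFlag 𝕜 p q) (i : ℤ) : ℕ∞ :=
  relDim (Λ.lat i ⊓ Vplus 𝕜 p q) (Λ.lat (i + 1) ⊓ Vplus 𝕜 p q)

/-- `(i; -) = dim (Λ_i ∩ V₋) / (Λ_{i+1} ∩ V₋)`. -/
def dimMinus (Λ : AffineFlag 𝕜 p q) (i : ℤ) : ℕ∞ :=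
  relDim (Λ.lat i ⊓ Vminus 𝕜 p q) (Λ.lat (i + 1) ⊓ Vminus 𝕜 p q)

/-- `(i; ℕ) = dim Λ_i / ((Λ_i ∩ V₊) ⊕ (Λ_i ∩ V₋))`. -/
def dimNat (Λ : AffineFlag 𝕜 p q) (i : ℤ) : ℕ∞ :=
  relDim (Λ.lat i) ((Λ.lat i ⊓ Vplus 𝕜 p q) ⊔ (Λ.lat i ⊓ Vminus 𝕜 p q))

/-- `(i; j) = dim (π₊(Λ_j) + Λ_i) / t Λ₁`, used for `i < j` and `i ≤ n + 1`. -/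
def dimPair (Λ : AffineFlag 𝕜 p q) (i j : ℤ) : ℕ∞ :=
  relDim ((Λ.lat j).map (projPlus 𝕜 p q) ⊔ Λ.lat i)
    ((PowerSeries.X : PowerSeries 𝕜) • Λ.lat 1)

/-! ### Affine clans -/

/-- The possible entries of a clan: `+`, `-` or an integer. -/
inductive ClanSymbol
  | plus
  | minus
  | num (a : ℤ)

/-- Integers are shifted by `m`, signs are unchanged. -/
def ClanSymbol.shift (m : ℤ) : ClanSymbol → ClanSymbol
  | .plus => .plus
  | .minus => .minus
  | .num a => .num (a + m)

/-- The `ℤ`-indexed sequences that represent affine `(p, q)`-clans, with `n = p + q`. -/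
structure IsAffineClan (p q : ℕ) (c : ℤ → ClanSymbol) : Prop where
  periodic : ∀ i k : ℤ, c (i + k * (p + q : ℕ)) = (c i).shift (k * (p + q : ℕ))
  signs : ({i : ℤ | 1 ≤ i ∧ i ≤ (p + q : ℕ) ∧ c i = .plus}.ncard : ℤ) -
    ({i : ℤ | 1 ≤ i ∧ i ≤ (p + q : ℕ) ∧ c i = .minus}.ncard : ℤ) = (p : ℤ) - (q : ℤ)
  twice : ∀ a : ℤ, (∃ i, c i = .num a) → {i : ℤ | c i = .num a}.ncard = 2

/-- Positions `i` and `j` carry the same integer. -/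
def Matched (c : ℤ → ClanSymbol) (i j : ℤ) : Prop :=
  ∃ a : ℤ, c i = .num a ∧ c j = .num a

/-- Two sequences are equivalent if they have the same signs and the same matched positions. -/
def ClanEquiv (c d : ℤ → ClanSymbol) : Prop :=
  (∀ i, (c i = .plus ↔ d i = .plus) ∧ (c i = .minus ↔ d i = .minus)) ∧
    ∀ i j, i ≠ j → (Matched c i j ↔ Matched d i j)

/-- Equivalence of sequences, as a setoid on the sequences that represent affine clans. -/
def clanSetoid (p q : ℕ) : Setoid {c : ℤ → ClanSymbol // IsAffineClan p q c} where
  r c d := ClanEquiv c.1 d.1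
  iseqv :=
    { refl := fun _ => ⟨fun _ => ⟨Iff.rfl, Iff.rfl⟩, fun _ _ _ => Iff.rfl⟩
      symm := fun h => ⟨fun i => ⟨(h.1 i).1.symm, (h.1 i).2.symm⟩,
        fun i j hij => (h.2 i j hij).symm⟩
      trans := fun h h' => ⟨fun i => ⟨(h.1 i).1.trans (h'.1 i).1, (h.1 i).2.trans (h'.1 i).2⟩,
        fun i j hij => (h.2 i j hij).trans (h'.2 i j hij)⟩ }

/-- Affine `(p, q)`-clans: equivalence classes of sequences. -/
def AffineClan (p q : ℕ) : Type := Quotient (clanSetoid p q)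

/-- The class of a sequence. -/
def AffineClan.mk (c : ℤ → ClanSymbol) (hc : IsAffineClan p q c) : AffineClan p q :=
  Quotient.mk (clanSetoid p q) ⟨c, hc⟩

/-! ### The clan of an affine flag

The clan is computed in `n` steps.  A state is a partially determined sequence. -/

/-- A partially determined sequence; `none` means that the entry is not yet determined. -/
abbrev ClanState : Type := ℤ → Option ClanSymbol

/-- Set `c_i = x`, and `c_{i + r n} = x` or `x + r n` for all `r`, according to whether `x` is a sign
or an integer. -/
def assign (n : ℕ) (s : ClanState) (i : ℤ) (x : ClanSymbol) : ClanState :=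
  open scoped Classical in
  fun k => if (n : ℤ) ∣ k - i then some (x.shift (k - i)) else s k

/-- The set `{c₁, …, c_{i-1}} ∩ [1, n]`. -/
def usedLabels (n : ℕ) (s : ClanState) (i : ℤ) : Set ℤ :=
  {a | 1 ≤ a ∧ a ≤ n ∧ ∃ k : ℤ, 1 ≤ k ∧ k ≤ i - 1 ∧ s k = some (.num a)}

/-- `1` if no label is used, and otherwise one more than the largest used label. -/
def freshLabel (n : ℕ) (s : ClanState) (i : ℤ) : ℤ :=
  open scoped Classical in
  if usedLabels n s i = ∅ then 1 else 1 + sSup (usedLabels n s i)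

/-- For `i` with `(i; +) = (i; -) = 1`, the index `j > i` to which `i` is matched: for some
`v ∈ π₊(Λ_{i+1})` outside `Λ_{i+1}` with `Λ_i = Λ_{i+1} + 𝕜 v`, the vector `v` lies in
`π₊(Λ_j) + Λ_{i+1}` but not in `π₊(Λ_{j+1}) + Λ_{i+1}`. -/
def IsPartner (Λ : AffineFlag 𝕜 p q) (i j : ℤ) : Prop :=
  i < j ∧ ∃ v : Vec 𝕜 p q,
    v ∈ (Λ.lat (i + 1)).map (projPlus 𝕜 p q) ∧ v ∉ Λ.lat (i + 1) ∧
    (∀ w, w ∈ Λ.lat i ↔ ∃ u ∈ Λ.lat (i + 1), ∃ a : 𝕜, w = u + a • v) ∧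
    v ∈ (Λ.lat j).map (projPlus 𝕜 p q) ⊔ Λ.lat (i + 1) ∧
    v ∉ (Λ.lat (j + 1)).map (projPlus 𝕜 p q) ⊔ Λ.lat (i + 1)

/-- The index `j` of `IsPartner` (it exists and is unique if `(i; +) = (i; -) = 1`). -/
def partner (Λ : AffineFlag 𝕜 p q) (i : ℤ) : ℤ := Classical.epsilon (IsPartner Λ i)

/-- Step `i` of the procedure. -/
def clanStep (Λ : AffineFlag 𝕜 p q) (s : ClanState) (i : ℤ) : ClanState :=
  open scoped Classical in
  match s i with
  | some _ => s
  | none =>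
    if dimPlus Λ i = 1 ∧ dimMinus Λ i = 0 then assign (p + q) s i .plus
    else if dimPlus Λ i = 0 ∧ dimMinus Λ i = 1 then assign (p + q) s i .minus
    else if dimPlus Λ i = 0 ∧ dimMinus Λ i = 0 then
      assign (p + q) s i (.num (freshLabel (p + q) s i))
    else if dimPlus Λ i = 1 ∧ dimMinus Λ i = 1 then
      match s (partner Λ i) with
      | some x => assign (p + q) s i x
      | none =>
        let x := ClanSymbol.num (freshLabel (p + q) s i)
        assign (p + q) (assign (p + q) s (partner Λ i) x) i x
    else s

/-- The state after the steps `1, …, m`. -/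
def clanState (Λ : AffineFlag 𝕜 p q) : ℕ → ClanState
  | 0 => fun _ => none
  | m + 1 => clanStep Λ (clanState Λ m) ((m : ℤ) + 1)

/-- After the steps `1, …, n`, every entry is determined, and the resulting sequence is `c`. -/
def IsClanSequenceOf (Λ : AffineFlag 𝕜 p q) (c : ℤ → ClanSymbol) : Prop :=
  ∀ i : ℤ, clanState Λ (p + q) i = some (c i)

/-- The relation between the invariants of a flag and a sequence `c`, for `1 ≤ i ≤ n` and `i < j`:
`(i; ℕ)` counts the pairs that straddle `i`, signs are read off from `(i; +)` and `(i; -)`, and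
`(i; j) - (n + 1 - i)` counts the pairs that straddle both `i` and `j`. -/
structure MatchesInvariants (Λ : AffineFlag 𝕜 p q) (c : ℤ → ClanSymbol) : Prop where
  nat : ∀ i : ℤ, 1 ≤ i → i ≤ (p + q : ℕ) →
    dimNat Λ i = {a : ℤ | ∃ x y : ℤ, x < i ∧ i ≤ y ∧ c x = .num a ∧ c y = .num a}.encard
  plus : ∀ i : ℤ, 1 ≤ i → i ≤ (p + q : ℕ) → c i = .plus → dimPlus Λ i = 1 ∧ dimMinus Λ i = 0
  minus : ∀ i : ℤ, 1 ≤ i → i ≤ (p + q : ℕ) → c i = .minus → dimPlus Λ i = 0 ∧ dimMinus Λ i = 1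
  pair : ∀ i j : ℤ, 1 ≤ i → i ≤ (p + q : ℕ) → i < j →
    dimPair Λ i j = ((((p + q : ℕ) : ℤ) + 1 - i).toNat : ℕ∞) +
      {a : ℤ | ∃ x y : ℤ, x < i ∧ j ≤ y ∧ c x = .num a ∧ c y = .num a}.encard

end

end AffineClans

/-!
# Affine clans classify the `K`-orbits on the affine flag variety

Everything rests on a normal form.  A flag `Λ` is the same thing as a sequence `e : ℤ → V` of
vectors with `e (i + n) = t • e i` that lead its steps (`e i` lies in `Λ_i` but not in `Λ_{i+1}`),
up to the choice of the leading vectors; by Nakayama's lemma such a sequence is an `F`-basis of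
`V`, repeated periodically (`PBasis`, `vec`, `AffineFlag.exists_basis_of_leading`), and a vector
lies in `Λ_i` if and only if its coefficients (`coef`) below `i` vanish.  The basis is in normal
form for a clan `c` (`IsNormal`) if `e i` lies in `V₊` or `V₋` at the signs of `c`, and if `e i`
lies in `V₊` and `π₊ (e j) = e i` for every pair `i < j` of `c`.

Every flag has such a basis (`AffineFlag.exists_isNormal`).  Call `i` an opener if the filtrations
of both `V₊` and `V₋` by the lattices jump at `i`, and a closer if neither does.  At an opener
choose leading vectors `v` in `V₊` and `w` in `V₋` whose difference lies in `Λ_j` with `j` as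
large as possible.  By maximality, `j` is a closer, and different openers have different `j`.
There are at least `p` jumps of `V₊` and at least `q` jumps of `V₋` in a period, since the leading
vectors span; so there are at least as many openers as closers, and the map from openers to
closers is a bijection.  Put `v` at the opener and `v - w` at the closer.

In normal form the projection `π₊` acts on coefficients by an explicit rule
(`IsNormal.coef_projPlus`), so that all the quotients in the definition of the invariants are cut
out by the vanishing of coefficients at an explicit finite set of positions (`relDim_eq_encard`).
Hence the invariants count pairs of `c` (`IsNormal.matchesInvariants`), and the procedure numbers
the pairs of `c` in the order in which it meets them (`clanState_eq`).  Conversely the counts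
determine `c` up to equivalence: the pair opened at `i` reaches `j` if and only if the counts of
the pairs that straddle `i` and `j`, and `i + 1` and `j`, differ (`IsAffineClan.le_mate_iff`).

For the bijection, the clan is constant on orbits because the invariants are, flags with bases in
normal form for the same clan are conjugate because the change of basis commutes with `π₊`
(`IsNormal.exists_smul_eq`), and a clan is realized by distributing the coordinate vectors over
its signs and pairs (`IsAffineClan.exists_isNormal`).
-/

namespace AffineClans

noncomputable section

variable {𝕜 : Type*} [Field 𝕜] {p q : ℕ}

/-! ### Scalars -/

/-- The power `t ^ k` in `F`, for an integer `k`. -/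
def tpow (𝕜 : Type*) [Field 𝕜] (k : ℤ) : LaurentSeries 𝕜 := HahnSeries.single k 1

theorem tpow_zero : tpow 𝕜 0 = 1 := rfl

theorem tpow_add (j k : ℤ) : tpow 𝕜 (j + k) = tpow 𝕜 j * tpow 𝕜 k := by
  simp [tpow]

theorem coeff_mul_tpow (f : LaurentSeries 𝕜) (j k : ℤ) :
    (f * tpow 𝕜 j).coeff k = f.coeff (k - j) := by
  simp [tpow, HahnSeries.coeff_mul_single]

theorem tpow_ne_zero (k : ℤ) : tpow 𝕜 k ≠ 0 := by
  simp [tpow]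

theorem smul_vec_eq (a : PowerSeries 𝕜) (v : Vec 𝕜 p q) :
    a • v = HahnSeries.ofPowerSeries ℤ 𝕜 a • v := rfl

theorem X_smul_vec_eq (v : Vec 𝕜 p q) :
    (PowerSeries.X : PowerSeries 𝕜) • v = tpow 𝕜 1 • v := by
  rw [smul_vec_eq, HahnSeries.ofPowerSeries_X, tpow]

theorem const_smul_vec_eq (r : 𝕜) (v : Vec 𝕜 p q) :
    r • v = (HahnSeries.C r : LaurentSeries 𝕜) • v := by
  ext x : 1
  simp only [Pi.smul_apply, smul_eq_mul, HahnSeries.C_mul_eq_smul]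

theorem const_smul_mem {M : Sub 𝕜 p q} (a : 𝕜) {v : Vec 𝕜 p q} (hv : v ∈ M) : a • v ∈ M := by
  rw [const_smul_vec_eq, ← HahnSeries.ofPowerSeries_C, ← smul_vec_eq]
  exact M.smul_mem _ hv

theorem coeff_ofPowerSeries_of_neg (a : PowerSeries 𝕜) {k : ℤ} (hk : k < 0) :
    (HahnSeries.ofPowerSeries ℤ 𝕜 a).coeff k = 0 := by
  rw [PowerSeries.coeff_coe, if_pos hk]

theorem exists_ofPowerSeries (f : LaurentSeries 𝕜) (hf : ∀ k < 0, f.coeff k = 0) :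
    ∃ a : PowerSeries 𝕜, HahnSeries.ofPowerSeries ℤ 𝕜 a = f := by
  refine ⟨PowerSeries.mk fun k => f.coeff k, ?_⟩
  ext k
  rw [PowerSeries.coeff_coe]
  split_ifs with h
  · exact (hf k h).symm
  · rw [PowerSeries.coeff_mk, Int.natAbs_of_nonneg (not_lt.mp h)]

theorem coeff_smul_eq_zero (a : PowerSeries 𝕜) {f : LaurentSeries 𝕜} {m : ℤ}
    (hf : ∀ k < m, f.coeff k = 0) : ∀ k < m, (a • f).coeff k = 0 := by
  intro k hk
  change (HahnSeries.ofPowerSeries ℤ 𝕜 a * f).coeff k = 0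
  rw [HahnSeries.coeff_mul]
  refine Finset.sum_eq_zero fun x hx => ?_
  have hx' := (Finset.mem_antidiagonal.mp hx).2.2
  by_cases h : x.1 < 0
  · rw [coeff_ofPowerSeries_of_neg a h, zero_mul]
  · rw [hf x.2 (by omega), mul_zero]

/-! ### Periodic bases and coefficients -/

/-- An `F`-basis of `V`, indexed by the residues `0, …, n - 1`.  It stands for the `n`-periodic
sequence `vec` of vectors of `V`. -/
abbrev PBasis (𝕜 : Type*) [Field 𝕜] (p q : ℕ) : Type _ :=
  Module.Basis (Fin (p + q)) (LaurentSeries 𝕜) (Vec 𝕜 p q)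

theorem finrank_vec : Module.finrank (LaurentSeries 𝕜) (Vec 𝕜 p q) = p + q := by
  simp

section

variable [NeZero (p + q)]

theorem size_pos (p q : ℕ) [NeZero (p + q)] : (0 : ℤ) < (p + q : ℕ) := by
  exact_mod_cast Nat.pos_of_ne_zero (NeZero.ne (p + q))

/-- The residue of an integer modulo `n`. -/
def resid (p q : ℕ) [NeZero (p + q)] (i : ℤ) : Fin (p + q) :=
  ⟨(i % (p + q : ℕ)).toNat, by
    have h0 := Int.emod_nonneg i (size_pos p q).ne'
    have h1 := Int.emod_lt_of_pos i (size_pos p q)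
    omega⟩

theorem resid_coe (i : ℤ) : ((resid p q i : ℕ) : ℤ) = i % (p + q : ℕ) :=
  Int.toNat_of_nonneg (Int.emod_nonneg i (size_pos p q).ne')

theorem resid_eq_iff {i j : ℤ} : resid p q i = resid p q j ↔ ((p + q : ℕ) : ℤ) ∣ i - j := by
  rw [← Int.emod_eq_emod_iff_emod_sub_eq_zero.trans Int.dvd_iff_emod_eq_zero.symm,
    ← resid_coe, ← resid_coe, Fin.ext_iff]
  omega

theorem resid_natCast (r : Fin (p + q)) : resid p q (r : ℕ) = r := by
  apply Fin.ext
  have := resid_coe (p := p) (q := q) (r : ℕ)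
  rw [Int.emod_eq_of_lt (by omega) (by have := r.2; omega)] at this
  exact_mod_cast this

theorem div_sub_div {i j : ℤ} (h : ((p + q : ℕ) : ℤ) ∣ i - j) :
    i / (p + q : ℕ) - j / (p + q : ℕ) = (i - j) / (p + q : ℕ) := by
  obtain ⟨k, hk⟩ := h
  have hi : i = j + (p + q : ℕ) * k := by omega
  rw [hk, hi, Int.add_mul_ediv_left _ _ (size_pos p q).ne', Int.mul_ediv_cancel_left _
    (size_pos p q).ne']
  ring

/-- The periodic sequence of a basis: `vec B (i + n) = t • vec B i`, and `vec B i` is the `i`-th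
basis vector for `0 ≤ i < n`. -/
def vec (B : PBasis 𝕜 p q) (i : ℤ) : Vec 𝕜 p q := tpow 𝕜 (i / (p + q : ℕ)) • B (resid p q i)

/-- The coefficient of `v` at `vec B i`. -/
def coef (B : PBasis 𝕜 p q) (i : ℤ) : Vec 𝕜 p q →ₗ[𝕜] 𝕜 where
  toFun v := (B.repr v (resid p q i)).coeff (i / (p + q : ℕ))
  map_add' v w := by simp
  map_smul' r v := by
    rw [const_smul_vec_eq, map_smul, Finsupp.smul_apply, smul_eq_mul, HahnSeries.C_mul_eq_smul]
    simp

theorem vec_natCast (B : PBasis 𝕜 p q) (r : Fin (p + q)) : vec B (r : ℕ) = B r := by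
  rw [vec, resid_natCast, Int.ediv_eq_zero_of_lt (by omega) (by have := r.2; omega), tpow_zero,
    one_smul]

theorem tpow_smul_vec (B : PBasis 𝕜 p q) (i k : ℤ) :
    tpow 𝕜 k • vec B i = vec B (i + k * (p + q : ℕ)) := by
  rw [vec, vec, smul_smul, ← tpow_add, Int.add_mul_ediv_right _ _ (size_pos p q).ne', add_comm k,
    resid_eq_iff.mpr]
  simp

theorem vec_add_size (B : PBasis 𝕜 p q) (i : ℤ) :
    vec B (i + (p + q : ℕ)) = (PowerSeries.X : PowerSeries 𝕜) • vec B i := by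
  rw [X_smul_vec_eq, tpow_smul_vec, one_mul]

theorem vec_eq_smul_vec (B : PBasis 𝕜 p q) {i j : ℤ} (h : ((p + q : ℕ) : ℤ) ∣ i - j) :
    vec B i = tpow 𝕜 ((i - j) / (p + q : ℕ)) • vec B j := by
  rw [tpow_smul_vec, Int.ediv_mul_cancel h]
  congr 1
  ring

theorem coef_smul_vec (B : PBasis 𝕜 p q) (f : LaurentSeries 𝕜) (m k : ℤ) :
    coef B k (f • vec B m) =
      if ((p + q : ℕ) : ℤ) ∣ k - m then f.coeff ((k - m) / (p + q : ℕ)) else 0 := by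
  simp only [coef, LinearMap.coe_mk, AddHom.coe_mk, vec, smul_smul, map_smul,
    Finsupp.smul_apply, Module.Basis.repr_self, smul_eq_mul]
  split_ifs with h
  · rw [resid_eq_iff.mpr h, Finsupp.single_eq_same, mul_one, coeff_mul_tpow, div_sub_div h]
  · rw [Finsupp.single_eq_of_ne, mul_zero, HahnSeries.coeff_zero]
    rwa [Ne, resid_eq_iff]

theorem coef_vec (B : PBasis 𝕜 p q) (m k : ℤ) : coef B k (vec B m) = if k = m then 1 else 0 := by
  have h := coef_smul_vec B 1 m k
  rw [one_smul] at h
  rw [h, HahnSeries.coeff_one]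
  by_cases hk : k = m
  · simp [hk]
  · rw [if_neg hk]
    split_ifs with h1 h2
    · obtain ⟨l, hl⟩ := h1
      rw [hl, Int.mul_ediv_cancel_left _ (size_pos p q).ne'] at h2
      rw [h2] at hl
      omega
    · rfl
    · rfl

theorem coef_vec_self (B : PBasis 𝕜 p q) (k : ℤ) : coef B k (vec B k) = 1 := by
  simp [coef_vec]

theorem coef_vec_of_ne (B : PBasis 𝕜 p q) {m k : ℤ} (h : k ≠ m) : coef B k (vec B m) = 0 := by
  simp [coef_vec, h]

theorem coef_add_mul (B : PBasis 𝕜 p q) (k j : ℤ) (v : Vec 𝕜 p q) :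
    coef B (k + j * (p + q : ℕ)) v =
      (B.repr v (resid p q k)).coeff (k / (p + q : ℕ) + j) := by
  have h : resid p q (k + j * (p + q : ℕ)) = resid p q k := resid_eq_iff.mpr (by simp)
  simp only [coef, LinearMap.coe_mk, AddHom.coe_mk]
  rw [h, Int.add_mul_ediv_right _ _ (size_pos p q).ne']

theorem vec_mem_span (B : PBasis 𝕜 p q) (i j : ℤ) :
    vec B j ∈ Submodule.span (LaurentSeries 𝕜)
      (Set.range fun r : Fin (p + q) => vec B (i + (r : ℕ))) := by
  have h : ((p + q : ℕ) : ℤ) ∣ j - (i + (resid p q (j - i) : ℕ)) := by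
    rw [resid_coe]
    rw [← sub_sub]
    exact Int.dvd_self_sub_emod
  rw [vec_eq_smul_vec B h]
  exact Submodule.smul_mem _ _ (Submodule.subset_span ⟨_, rfl⟩)

/-- The basis formed by `n` consecutive vectors of the periodic sequence. -/
def window (B : PBasis 𝕜 p q) (i : ℤ) : PBasis 𝕜 p q :=
  basisOfTopLeSpanOfCardEqFinrank (fun r : Fin (p + q) => vec B (i + (r : ℕ)))
    (by
      rw [← B.span_eq, Submodule.span_le]
      rintro _ ⟨r, rfl⟩
      rw [← vec_natCast]
      exact vec_mem_span B i _)
    (by rw [finrank_vec, Fintype.card_fin])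

theorem window_apply (B : PBasis 𝕜 p q) (i : ℤ) (r : Fin (p + q)) :
    window B i r = vec B (i + (r : ℕ)) := by
  simp [window]

theorem coef_window_add (B : PBasis 𝕜 p q) (i : ℤ) (v : Vec 𝕜 p q) (r : Fin (p + q)) (k : ℤ) :
    coef B (i + (r : ℕ) + k * (p + q : ℕ)) v = ((window B i).repr v r).coeff k := by
  conv_lhs => rw [← (window B i).sum_repr v]
  rw [map_sum, Finset.sum_eq_single r]
  · rw [window_apply, coef_smul_vec, add_sub_cancel_left, if_pos (dvd_mul_left _ _),
      Int.mul_ediv_cancel _ (size_pos p q).ne']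
  · intro s _ hs
    rw [window_apply, coef_smul_vec, if_neg]
    intro h
    apply hs
    rw [← resid_natCast r, ← resid_natCast s, eq_comm, resid_eq_iff]
    have h' := dvd_sub h (dvd_mul_left ((p + q : ℕ) : ℤ) k)
    rwa [show i + ((r : ℕ) : ℤ) + k * (p + q : ℕ) - (i + ((s : ℕ) : ℤ)) - k * (p + q : ℕ) =
      ((r : ℕ) : ℤ) - ((s : ℕ) : ℤ) by ring] at h'
  · simp

/-! ### The lattices of a periodic basis -/

/-- The vectors whose coefficients below `i` vanish. -/
def latOf (B : PBasis 𝕜 p q) (i : ℤ) : Sub 𝕜 p q where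
  carrier := {v | ∀ k < i, coef B k v = 0}
  add_mem' hv hw k hk := by rw [map_add, hv k hk, hw k hk, add_zero]
  zero_mem' k _ := map_zero _
  smul_mem' a v hv k hk := by
    change ((B.repr (a • v)) (resid p q k)).coeff (k / (p + q : ℕ)) = 0
    rw [smul_vec_eq, map_smul, Finsupp.smul_apply]
    refine coeff_smul_eq_zero a (m := k / (p + q : ℕ) + 1) (fun j hj => ?_) _ (by omega)
    have h := hv (k + (j - k / (p + q : ℕ)) * (p + q : ℕ)) (by nlinarith [size_pos p q])
    rwa [coef_add_mul, add_sub_cancel] at h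

theorem mem_latOf {B : PBasis 𝕜 p q} {i : ℤ} {v : Vec 𝕜 p q} :
    v ∈ latOf B i ↔ ∀ k < i, coef B k v = 0 := Iff.rfl

theorem vec_mem_latOf (B : PBasis 𝕜 p q) {i k : ℤ} (h : i ≤ k) : vec B k ∈ latOf B i :=
  fun j hj => coef_vec_of_ne B (by omega)

theorem latOf_anti (B : PBasis 𝕜 p q) {i j : ℤ} (h : i ≤ j) : latOf B j ≤ latOf B i :=
  fun _ hv k hk => hv k (by omega)

theorem latOf_eq_span (B : PBasis 𝕜 p q) (i : ℤ) :
    latOf B i = Submodule.span (PowerSeries 𝕜) (Set.range (window B i)) := by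
  apply le_antisymm
  · intro v hv
    rw [← (window B i).sum_repr v]
    refine Submodule.sum_mem _ fun r _ => ?_
    obtain ⟨a, ha⟩ := exists_ofPowerSeries ((window B i).repr v r) fun k hk => by
      rw [← coef_window_add]
      have hr : ((r : ℕ) : ℤ) < (p + q : ℕ) := by exact_mod_cast r.2
      exact hv _ (by nlinarith)
    rw [← ha, ← smul_vec_eq]
    exact Submodule.smul_mem _ _ (Submodule.subset_span ⟨r, rfl⟩)
  · rw [Submodule.span_le]
    rintro _ ⟨r, rfl⟩
    rw [window_apply]
    exact vec_mem_latOf B (by omega)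

theorem isLattice_latOf (B : PBasis 𝕜 p q) (i : ℤ) : IsLattice (latOf B i) :=
  ⟨(window B i).reindex finSumFinEquiv.symm, by
    rw [latOf_eq_span, Module.Basis.range_reindex]⟩

theorem latOf_add_size (B : PBasis 𝕜 p q) (i : ℤ) :
    latOf B (i + (p + q : ℕ)) = (PowerSeries.X : PowerSeries 𝕜) • latOf B i := by
  rw [latOf_eq_span, latOf_eq_span, ← Submodule.span_smul]
  congr 1
  ext w
  simp only [Set.mem_range, Set.mem_smul_set, exists_exists_eq_and]
  refine exists_congr fun r => ?_
  rw [window_apply, window_apply, ← vec_add_size]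
  simp only [add_right_comm]

/-- The dimension of `M / N`, when `N` is cut out of `M` by the vanishing of the coefficients at a
finite set of positions, and these coefficients are independent on `M`. -/
theorem relDim_eq_encard (B : PBasis 𝕜 p q) {M N : Sub 𝕜 p q} {T : Set ℤ} (hT : T.Finite)
    (hN : ∀ v ∈ M, v ∈ N ↔ ∀ k ∈ T, coef B k v = 0)
    (hM : ∀ k ∈ T, ∃ v ∈ M, ∀ j ∈ T, coef B j v = if j = k then 1 else 0) :
    relDim M N = T.encard := by
  classical
  have := hT.fintype
  let φ : M →ₗ[𝕜] (T → 𝕜) :=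
    LinearMap.pi fun k => (coef B k.1).comp (M.subtype.restrictScalars 𝕜)
  have hφ : ∀ (v : M) (k : T), φ v k = coef B k v := fun _ _ => rfl
  have hker : LinearMap.ker φ = (N.submoduleOf M).restrictScalars 𝕜 := by
    ext v
    rw [LinearMap.mem_ker, Submodule.restrictScalars_mem, Submodule.submoduleOf,
      Submodule.mem_comap, Submodule.subtype_apply, hN v v.2,
      funext_iff]
    simp [hφ]
  have hsurj : Function.Surjective φ := by
    choose! w hwM hw using hM
    intro f
    refine ⟨∑ k : T, f k • ⟨w k, hwM k k.2⟩, ?_⟩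
    ext j
    rw [map_sum, Finset.sum_apply, Finset.sum_eq_single j]
    · rw [map_smul, Pi.smul_apply, hφ, hw j j.2 j j.2, if_pos rfl, smul_eq_mul, mul_one]
    · intro k _ hkj
      rw [map_smul, Pi.smul_apply, hφ, hw k k.2 j j.2, if_neg, smul_zero]
      exact fun h => hkj (Subtype.ext h.symm)
    · simp
  have e : (M ⧸ N.submoduleOf M) ≃ₗ[𝕜] (T → 𝕜) :=
    (Submodule.Quotient.restrictScalarsEquiv 𝕜 (N.submoduleOf M)).symm ≪≫ₗ
      Submodule.quotEquivOfEq _ _ hker.symm ≪≫ₗ φ.quotKerEquivOfSurjective hsurj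
  rw [relDim, e.rank_eq, rank_fun', map_natCast, Set.encard_eq_coe_toFinset_card,
    Set.toFinset_card]

/-- The affine flag of a periodic basis. -/
def flagOf (B : PBasis 𝕜 p q) : AffineFlag 𝕜 p q where
  lat := latOf B
  isLattice := isLattice_latOf B
  succ_le i := latOf_anti B (by omega)
  periodic := latOf_add_size B
  relDim_succ i := by
    rw [relDim_eq_encard B (T := {i}) (Set.finite_singleton i), Set.encard_singleton]
    · intro v hv
      simp only [Set.mem_singleton_iff, forall_eq, mem_latOf]
      refine ⟨fun h => h i (by omega), fun h k hk => ?_⟩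
      rcases (show k < i ∨ k = i by omega) with hk | rfl
      exacts [hv k hk, h]
    · rintro _ rfl
      exact ⟨vec B _, vec_mem_latOf B le_rfl, fun j _ => coef_vec B _ _⟩

end

/-! ### Leading vectors of an affine flag -/

namespace AffineFlag

variable (Λ : AffineFlag 𝕜 p q)

theorem lat_anti {i j : ℤ} (h : i ≤ j) : Λ.lat j ≤ Λ.lat i := by
  obtain ⟨m, rfl⟩ := Int.le.dest h
  clear h
  induction m with
  | zero => simp
  | succ m ih =>
    refine le_trans ?_ ih
    have := Λ.succ_le (i + m)
    rwa [show i + ((m + 1 : ℕ) : ℤ) = i + m + 1 by push_cast; ring]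

theorem X_smul_mem_lat {i : ℤ} {v : Vec 𝕜 p q} :
    (PowerSeries.X : PowerSeries 𝕜) • v ∈ Λ.lat (i + (p + q : ℕ)) ↔ v ∈ Λ.lat i := by
  rw [Λ.periodic]
  constructor
  · rintro ⟨u, hu, huv⟩
    change (PowerSeries.X : PowerSeries 𝕜) • u = _ at huv
    rw [X_smul_vec_eq, X_smul_vec_eq] at huv
    rwa [← smul_right_injective _ (tpow_ne_zero (𝕜 := 𝕜) 1) huv]
  · exact fun h => Submodule.smul_mem_pointwise_smul _ _ _ h

theorem tpow_smul_mem_lat {i : ℤ} {v : Vec 𝕜 p q} (k : ℤ) :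
    tpow 𝕜 k • v ∈ Λ.lat (i + k * (p + q : ℕ)) ↔ v ∈ Λ.lat i := by
  induction k using Int.induction_on with
  | zero => simp [tpow_zero]
  | succ k ih =>
    rw [← ih, ← X_smul_mem_lat (i := i + k * (p + q : ℕ)), X_smul_vec_eq, smul_smul, ← tpow_add,
      add_comm 1, add_mul, one_mul, add_assoc]
  | pred k ih =>
    rw [← ih, ← X_smul_mem_lat, X_smul_vec_eq, smul_smul, ← tpow_add, add_sub_cancel, sub_mul,
      one_mul, add_assoc, sub_add_cancel]

/-- A vector of `Λ_i` outside `Λ_{i+1}` spans `Λ_i` modulo `Λ_{i+1}`. -/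
theorem exists_sub_smul_mem {i : ℤ} {v w : Vec 𝕜 p q} (hv : v ∈ Λ.lat i)
    (hv' : v ∉ Λ.lat (i + 1)) (hw : w ∈ Λ.lat i) : ∃ a : 𝕜, w - a • v ∈ Λ.lat (i + 1) := by
  have h := Λ.relDim_succ i
  rw [relDim, Cardinal.toENat_eq_one, rank_eq_one_iff] at h
  obtain ⟨x, -, hx⟩ := h
  set N := (Λ.lat (i + 1)).submoduleOf (Λ.lat i)
  obtain ⟨b, hb⟩ := hx (N.mkQ ⟨v, hv⟩)
  obtain ⟨c, hc⟩ := hx (N.mkQ ⟨w, hw⟩)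
  have hb0 : b ≠ 0 := by
    rintro rfl
    rw [zero_smul, eq_comm, Submodule.mkQ_apply, Submodule.Quotient.mk_eq_zero] at hb
    exact hv' hb
  refine ⟨c * b⁻¹, ?_⟩
  have h0 : N.mkQ (⟨w, hw⟩ - (c * b⁻¹) • ⟨v, hv⟩) = 0 := by
    have hs : N.mkQ ((c * b⁻¹) • ⟨v, hv⟩) = (c * b⁻¹) • N.mkQ ⟨v, hv⟩ := rfl
    rw [map_sub, hs, ← hb, ← hc, smul_smul, inv_mul_cancel_right₀ hb0, sub_self]
  rw [Submodule.mkQ_apply, Submodule.Quotient.mk_eq_zero] at h0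
  exact h0

theorem lat_fg (i : ℤ) : (Λ.lat i).FG := by
  obtain ⟨b, hb⟩ := Λ.isLattice i
  rw [hb]
  exact Submodule.fg_span (Set.finite_range b)

/-- If the vectors `e k`, for `k` in `J`, lead the nonzero quotients of the filtration of an
`F`-subspace `W` by the lattices of the flag, then those in one period generate.  The filtration
reduces this to Nakayama's lemma. -/
theorem inf_le_span {W : Sub 𝕜 p q} (hW : ∀ (f : LaurentSeries 𝕜), ∀ v ∈ W, f • v ∈ W)
    {J : Set ℤ} {e : ℤ → Vec 𝕜 p q} (heJ : ∀ k ∈ J, e k ∈ Λ.lat k ⊓ W ∧ e k ∉ Λ.lat (k + 1))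
    (hJ : ∀ k ∉ J, Λ.lat k ⊓ W ≤ Λ.lat (k + 1)) (i : ℤ) :
    Λ.lat i ⊓ W ≤ Submodule.span (PowerSeries 𝕜)
      (e '' {k | k ∈ J ∧ i ≤ k ∧ k < i + (p + q : ℕ)}) := by
  set S := Submodule.span (PowerSeries 𝕜) (e '' {k | k ∈ J ∧ i ≤ k ∧ k < i + (p + q : ℕ)})
  have step : ∀ m : ℕ, m ≤ p + q → Λ.lat i ⊓ W ≤ S ⊔ (Λ.lat (i + m) ⊓ W) := by
    intro m hm
    induction m with
    | zero => simp
    | succ m ih =>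
      refine (ih (by omega)).trans (sup_le le_sup_left ?_)
      intro w hw
      push_cast
      rw [← add_assoc]
      by_cases hk : i + m ∈ J
      · obtain ⟨⟨he1, he2⟩, he3⟩ := heJ _ hk
        obtain ⟨a, ha⟩ := Λ.exists_sub_smul_mem he1 he3 hw.1
        rw [← add_sub_cancel (a • e (i + m)) w]
        exact Submodule.add_mem_sup
          (const_smul_mem _ (Submodule.subset_span ⟨_, ⟨hk, by omega, by omega⟩, rfl⟩))
          ⟨ha, W.sub_mem hw.2 (const_smul_mem _ he2)⟩
      · exact Submodule.mem_sup_right ⟨hJ _ hk hw, hw.2⟩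
  have hX : Λ.lat (i + (p + q : ℕ)) ⊓ W ≤
      (Ideal.span {PowerSeries.X} : Ideal (PowerSeries 𝕜)) • (Λ.lat i ⊓ W) := by
    rintro w ⟨hw, hw'⟩
    have h1 : w = (PowerSeries.X : PowerSeries 𝕜) • tpow 𝕜 (-1) • w := by
      rw [X_smul_vec_eq, smul_smul, ← tpow_add, add_neg_cancel, tpow_zero, one_smul]
    rw [h1] at hw ⊢
    replace hw := Λ.X_smul_mem_lat.mp hw
    exact Submodule.smul_mem_smul (Ideal.mem_span_singleton_self _) ⟨hw, hW _ _ hw'⟩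
  have hnoeth := isNoetherian_of_fg_of_noetherian _ (Λ.lat_fg i)
  refine Submodule.le_of_le_smul_of_le_jacobson_bot (I := Ideal.span {PowerSeries.X})
    (isNoetherian_submodule.mp hnoeth _ inf_le_left) ?_
    ((step (p + q) le_rfl).trans (sup_le_sup_left hX _))
  rw [IsLocalRing.jacobson_eq_maximalIdeal ⊥ bot_ne_top, PowerSeries.maximalIdeal_eq_span_X]

end AffineFlag

theorem apply_add_mul_of_periodic {e : ℤ → Vec 𝕜 p q}
    (hper : ∀ i, e (i + (p + q : ℕ)) = (PowerSeries.X : PowerSeries 𝕜) • e i) (i k : ℤ) :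
    e (i + k * (p + q : ℕ)) = tpow 𝕜 k • e i := by
  induction k using Int.induction_on with
  | zero => simp [tpow_zero]
  | succ k ih =>
    rw [add_mul, one_mul, ← add_assoc, hper, ih, X_smul_vec_eq, smul_smul, ← tpow_add, add_comm 1]
  | pred k ih =>
    have h := hper (i + (-k - 1) * (p + q : ℕ))
    rw [show i + (-k - 1) * ((p + q : ℕ) : ℤ) + (p + q : ℕ) = i + -k * (p + q : ℕ) by ring, ih,
      X_smul_vec_eq] at h
    rw [show (-k - 1 : ℤ) = -1 + -k by ring, tpow_add, mul_smul, h, smul_smul, ← tpow_add,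
      neg_add_cancel, tpow_zero, one_smul, show (-k - 1 : ℤ) = -1 + -k by ring]

section

variable [NeZero (p + q)]

theorem exists_mem_latOf (B : PBasis 𝕜 p q) (v : Vec 𝕜 p q) : ∃ m : ℤ, v ∈ latOf B m := by
  obtain ⟨b, hb⟩ := (Set.finite_range fun r => (B.repr v r).order).bddBelow
  refine ⟨b * (p + q : ℕ), fun k hk => ?_⟩
  apply HahnSeries.coeff_eq_zero_of_lt_order
  refine lt_of_lt_of_le ?_ (hb ⟨resid p q k, rfl⟩)
  exact Int.ediv_lt_of_lt_mul (size_pos p q) hk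

theorem IsLattice.exists_eq_latOf {M : Sub 𝕜 p q} (h : IsLattice M) :
    ∃ B : PBasis 𝕜 p q, M = latOf B 0 := by
  obtain ⟨b, rfl⟩ := h
  refine ⟨b.reindex finSumFinEquiv, ?_⟩
  rw [latOf_eq_span]
  congr 1
  rw [← Module.Basis.range_reindex b finSumFinEquiv]
  congr 1
  ext r : 1
  rw [window_apply, zero_add, vec_natCast]

theorem exists_vec_eq {e : ℤ → Vec 𝕜 p q}
    (hper : ∀ i, e (i + (p + q : ℕ)) = (PowerSeries.X : PowerSeries 𝕜) • e i)
    (hspan : ∀ v, v ∈ Submodule.span (LaurentSeries 𝕜)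
      (Set.range fun r : Fin (p + q) => e (r : ℕ))) :
    ∃ B : PBasis 𝕜 p q, ∀ i, vec B i = e i := by
  let B : PBasis 𝕜 p q := basisOfTopLeSpanOfCardEqFinrank (fun r : Fin (p + q) => e (r : ℕ))
    (fun v _ => hspan v) (by rw [finrank_vec, Fintype.card_fin])
  have hB : ∀ r, B r = e (r : ℕ) := fun r => by simp [B]
  refine ⟨B, fun i => ?_⟩
  rw [vec, hB, ← apply_add_mul_of_periodic hper, resid_coe]
  congr 1
  rw [mul_comm]
  exact Int.emod_add_mul_ediv i _

namespace AffineFlag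

variable (Λ : AffineFlag 𝕜 p q)

theorem exists_tpow_smul_mem (i : ℤ) (v : Vec 𝕜 p q) : ∃ k : ℤ, tpow 𝕜 k • v ∈ Λ.lat i := by
  obtain ⟨B, hB⟩ := (Λ.isLattice i).exists_eq_latOf
  obtain ⟨m, hm⟩ := exists_mem_latOf B v
  refine ⟨|m|, ?_⟩
  rw [hB]
  refine latOf_anti B (j := m + |m| * (p + q : ℕ)) ?_ ((flagOf B).tpow_smul_mem_lat |m| |>.mpr hm)
  nlinarith [neg_abs_le m, abs_nonneg m, size_pos p q]

theorem mem_span_of_leading {W : Sub 𝕜 p q} (hW : ∀ (f : LaurentSeries 𝕜), ∀ v ∈ W, f • v ∈ W)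
    {J : Set ℤ} {e : ℤ → Vec 𝕜 p q} (heJ : ∀ k ∈ J, e k ∈ Λ.lat k ⊓ W ∧ e k ∉ Λ.lat (k + 1))
    (hJ : ∀ k ∉ J, Λ.lat k ⊓ W ≤ Λ.lat (k + 1)) (i : ℤ) {v : Vec 𝕜 p q} (hv : v ∈ W) :
    v ∈ Submodule.span (LaurentSeries 𝕜) (e '' {k | k ∈ J ∧ i ≤ k ∧ k < i + (p + q : ℕ)}) := by
  obtain ⟨k, hk⟩ := Λ.exists_tpow_smul_mem i v
  have h := Submodule.span_le_restrictScalars (PowerSeries 𝕜) (LaurentSeries 𝕜) _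
    (Λ.inf_le_span hW heJ hJ i ⟨hk, hW _ _ hv⟩)
  have h' := Submodule.smul_mem _ (tpow 𝕜 (-k)) h
  rwa [smul_smul, ← tpow_add, neg_add_cancel, tpow_zero, one_smul] at h'

/-- A periodic sequence of leading vectors of a flag comes from a basis, and the basis determines
the flag. -/
theorem exists_basis_of_leading {e : ℤ → Vec 𝕜 p q} (he : ∀ i, e i ∈ Λ.lat i)
    (he' : ∀ i, e i ∉ Λ.lat (i + 1))
    (hper : ∀ i, e (i + (p + q : ℕ)) = (PowerSeries.X : PowerSeries 𝕜) • e i) :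
    ∃ B : PBasis 𝕜 p q, Λ = flagOf B ∧ ∀ i, vec B i = e i := by
  have hwin : ∀ i : ℤ, e '' {k | k ∈ Set.univ ∧ i ≤ k ∧ k < i + (p + q : ℕ)} =
      Set.range fun r : Fin (p + q) => e (i + (r : ℕ)) := by
    intro i
    ext v
    constructor
    · rintro ⟨k, ⟨-, h1, h2⟩, rfl⟩
      refine ⟨⟨(k - i).toNat, by omega⟩, ?_⟩
      simp only
      congr 1
      omega
    · rintro ⟨r, rfl⟩
      exact ⟨_, ⟨trivial, by omega, by have := r.2; omega⟩, rfl⟩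
  have hJ : ∀ k ∉ (Set.univ : Set ℤ), Λ.lat k ⊓ ⊤ ≤ Λ.lat (k + 1) := fun k hk => absurd trivial hk
  have heJ : ∀ k ∈ (Set.univ : Set ℤ), e k ∈ Λ.lat k ⊓ ⊤ ∧ e k ∉ Λ.lat (k + 1) :=
    fun k _ => ⟨⟨he k, trivial⟩, he' k⟩
  obtain ⟨B, hvec⟩ := exists_vec_eq hper fun v => by
    have h := Λ.mem_span_of_leading (W := ⊤) (fun _ _ _ => trivial) heJ hJ 0 (v := v) trivial
    rw [hwin] at h
    simpa only [zero_add] using h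
  refine ⟨B, ?_, hvec⟩
  ext1
  funext i
  change _ = latOf B i
  apply le_antisymm
  · rw [latOf_eq_span]
    have h := Λ.inf_le_span (W := ⊤) (fun _ _ _ => trivial) heJ hJ i
    rw [inf_top_eq, hwin] at h
    simpa only [window_apply, hvec, Set.range] using h
  · rw [latOf_eq_span, Submodule.span_le]
    rintro _ ⟨r, rfl⟩
    rw [window_apply, hvec]
    exact Λ.lat_anti (by omega) (he _)

end AffineFlag

end

/-! ### Periods -/

theorem add_mul_inj {n a b x y : ℤ} (ha : 0 ≤ a) (han : a < n) (hb : 0 ≤ b) (hbn : b < n)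
    (h : a + n * x = b + n * y) : a = b ∧ x = y := by
  have hxy : x = y := by
    rcases lt_trichotomy x y with h' | h' | h'
    · nlinarith
    · exact h'
    · nlinarith
  subst hxy
  exact ⟨by linarith, rfl⟩

theorem eq_of_window {i j t : ℤ} (hi : 1 ≤ i ∧ i ≤ (p + q : ℕ)) (hj : 1 ≤ j ∧ j ≤ (p + q : ℕ))
    (h : i = j + t * (p + q : ℕ)) : i = j := by
  have := (add_mul_inj (n := (p + q : ℕ)) (a := i - 1) (b := j - 1) (x := 0) (y := t)
    (by omega) (by omega) (by omega) (by omega) (by linarith)).1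
  omega

/-- Every position is a translate of one in the window `1, …, n`. -/
theorem exists_window (hn : 0 < p + q) (i : ℤ) :
    ∃ i₀ k : ℤ, (1 ≤ i₀ ∧ i₀ ≤ (p + q : ℕ)) ∧ i = i₀ + k * (p + q : ℕ) := by
  have hpos : (0 : ℤ) < (p + q : ℕ) := by exact_mod_cast hn
  have h1 := Int.emod_nonneg (i - 1) hpos.ne'
  have h2 := Int.emod_lt_of_pos (i - 1) hpos
  have h3 := Int.emod_add_mul_ediv (i - 1) (p + q : ℕ)
  exact ⟨(i - 1) % (p + q : ℕ) + 1, (i - 1) / (p + q : ℕ), ⟨by omega, by omega⟩, by linarith⟩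

open scoped Classical in
/-- One period of the positions with a given property. -/
def period (p q : ℕ) (P : ℤ → Prop) : Finset ℤ := (Finset.Icc 1 ((p + q : ℕ) : ℤ)).filter P

theorem mem_period {P : ℤ → Prop} {i : ℤ} :
    i ∈ period p q P ↔ (1 ≤ i ∧ i ≤ (p + q : ℕ)) ∧ P i := by
  simp [period]

/-! ### Mates in an affine clan -/

open scoped Classical in
/-- The other position that carries the same integer as `i`; it is `i` itself if `c i` is a sign. -/
def mate (c : ℤ → ClanSymbol) (i : ℤ) : ℤ :=
  if ∃ j, j ≠ i ∧ Matched c i j then Classical.epsilon fun j => j ≠ i ∧ Matched c i j else i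

/-- The openers of pairs that start before `i` and end at `j` or later. -/
def straddle (c : ℤ → ClanSymbol) (i j : ℤ) : Set ℤ := {x | x < i ∧ j ≤ mate c x}

theorem mate_spec {c : ℤ → ClanSymbol} {i : ℤ} (h : mate c i ≠ i) : Matched c i (mate c i) := by
  unfold mate at h ⊢
  split_ifs with h'
  · exact (Classical.epsilon_spec h').2
  · rw [if_neg h'] at h
    exact absurd rfl h

theorem Matched.symm {c : ℤ → ClanSymbol} {i j : ℤ} (h : Matched c i j) : Matched c j i :=
  let ⟨a, h1, h2⟩ := h
  ⟨a, h2, h1⟩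

theorem apply_mate (c : ℤ → ClanSymbol) (i : ℤ) : c (mate c i) = c i := by
  by_cases h : mate c i = i
  · rw [h]
  · obtain ⟨a, h1, h2⟩ := mate_spec h
    rw [h1, h2]

theorem mate_congr {c d : ℤ → ClanSymbol} (h : ∀ i j, i ≠ j → (Matched c i j ↔ Matched d i j)) :
    mate c = mate d := by
  funext i
  have hset : ∀ j, (j ≠ i ∧ Matched c i j) ↔ (j ≠ i ∧ Matched d i j) :=
    fun j => and_congr_right fun hj => h i j hj.symm
  simp only [mate, hset]
  congr 1
  simp only [hset]

theorem ClanEquiv.mate_eq {c d : ℤ → ClanSymbol} (h : ClanEquiv c d) : mate c = mate d :=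
  mate_congr h.2

namespace IsAffineClan

variable {c : ℤ → ClanSymbol}

theorem eq_or_eq_of_num (hc : IsAffineClan p q c) {i j k a : ℤ} (hij : i ≠ j)
    (hi : c i = .num a) (hj : c j = .num a) (hk : c k = .num a) : k = i ∨ k = j := by
  obtain ⟨x, y, -, hxy⟩ := Set.ncard_eq_two.mp (hc.twice a ⟨i, hi⟩)
  have mem : ∀ l, c l = .num a → l = x ∨ l = y := fun l hl => by
    have : l ∈ {i | c i = .num a} := hl
    rwa [hxy] at this
  rcases mem i hi with h1 | h1 <;> rcases mem j hj with h2 | h2 <;> rcases mem k hk with h3 | h3 <;>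
    omega

theorem mate_ne_of_num (hc : IsAffineClan p q c) {i a : ℤ} (hi : c i = .num a) : mate c i ≠ i := by
  obtain ⟨x, y, hne, hxy⟩ := Set.ncard_eq_two.mp (hc.twice a ⟨i, hi⟩)
  have mem : ∀ l, c l = .num a ↔ l = x ∨ l = y := fun l => by
    change l ∈ {i | c i = .num a} ↔ _
    rw [hxy]
    rfl
  have h : ∃ j, j ≠ i ∧ Matched c i j := by
    rcases (mem i).mp hi with rfl | rfl
    · exact ⟨y, hne.symm, a, hi, (mem y).mpr (Or.inr rfl)⟩
    · exact ⟨x, hne, a, hi, (mem x).mpr (Or.inl rfl)⟩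
  rw [mate, if_pos h]
  exact (Classical.epsilon_spec h).1

theorem mate_ne_iff (hc : IsAffineClan p q c) {i : ℤ} : mate c i ≠ i ↔ ∃ a, c i = .num a :=
  ⟨fun h => let ⟨a, ha, _⟩ := mate_spec h; ⟨a, ha⟩, fun ⟨_, ha⟩ => hc.mate_ne_of_num ha⟩

theorem mate_eq_of_sign (hc : IsAffineClan p q c) {i : ℤ} (h : c i = .plus ∨ c i = .minus) :
    mate c i = i := by
  by_contra h'
  obtain ⟨a, ha⟩ := hc.mate_ne_iff.mp h'
  simp [ha] at h

theorem sign_of_mate_eq (hc : IsAffineClan p q c) {i : ℤ} (h : mate c i = i) :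
    c i = .plus ∨ c i = .minus := by
  rcases hi : c i with _ | _ | a
  · exact Or.inl rfl
  · exact Or.inr rfl
  · exact absurd h (hc.mate_ne_of_num hi)

theorem eq_mate_of_matched (hc : IsAffineClan p q c) {i j : ℤ} (hij : j ≠ i) (h : Matched c i j) :
    j = mate c i := by
  obtain ⟨a, hi, hj⟩ := h
  have hm := hc.mate_ne_of_num hi
  rcases hc.eq_or_eq_of_num hm.symm hi ((apply_mate c i).trans hi) hj with h | h
  exacts [absurd h hij, h]

theorem matched_iff (hc : IsAffineClan p q c) {i j : ℤ} :
    Matched c i j ↔ mate c i ≠ i ∧ (j = i ∨ j = mate c i) := by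
  constructor
  · intro h
    refine ⟨hc.mate_ne_of_num h.choose_spec.1, ?_⟩
    by_cases hij : j = i
    exacts [Or.inl hij, Or.inr (hc.eq_mate_of_matched hij h)]
  · rintro ⟨h, rfl | rfl⟩
    · obtain ⟨a, ha⟩ := hc.mate_ne_iff.mp h
      exact ⟨a, ha, ha⟩
    · exact mate_spec h

theorem mate_mate (hc : IsAffineClan p q c) (i : ℤ) : mate c (mate c i) = i := by
  by_cases h : mate c i = i
  · rw [h, h]
  · exact (hc.eq_mate_of_matched (Ne.symm h) (mate_spec h).symm).symm

theorem mate_injective (hc : IsAffineClan p q c) : Function.Injective (mate c) :=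
  Function.LeftInverse.injective hc.mate_mate

theorem mate_add_mul (hc : IsAffineClan p q c) (i k : ℤ) :
    mate c (i + k * (p + q : ℕ)) = mate c i + k * (p + q : ℕ) := by
  by_cases h : mate c i = i
  · rw [h, hc.mate_eq_of_sign]
    rw [hc.periodic]
    rcases hc.sign_of_mate_eq h with h | h <;> simp [h, ClanSymbol.shift]
  · obtain ⟨a, h1, h2⟩ := mate_spec h
    refine (hc.eq_mate_of_matched (by simpa using h) ⟨a + k * (p + q : ℕ), ?_, ?_⟩).symm <;>
    simp only [hc.periodic, h1, h2, ClanSymbol.shift]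

theorem mate_add_size (hc : IsAffineClan p q c) (i : ℤ) :
    mate c (i + (p + q : ℕ)) = mate c i + (p + q : ℕ) := by
  simpa using hc.mate_add_mul i 1

theorem not_dvd_mate_sub (hc : IsAffineClan p q c) {i : ℤ} (h : mate c i ≠ i) :
    ¬ ((p + q : ℕ) : ℤ) ∣ mate c i - i := by
  rintro ⟨k, hk⟩
  have h1 := hc.periodic i k
  rw [show i + k * ((p + q : ℕ) : ℤ) = mate c i by rw [mul_comm, ← hk]; ring, apply_mate c] at h1
  obtain ⟨a, ha⟩ := hc.mate_ne_iff.mp h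
  rw [ha, ClanSymbol.shift, ClanSymbol.num.injEq] at h1
  rw [mul_comm] at hk
  omega

theorem kind_cases (hc : IsAffineClan p q c) (i : ℤ) :
    c i = .plus ∧ mate c i = i ∨ c i = .minus ∧ mate c i = i ∨ i < mate c i ∨ mate c i < i := by
  rcases lt_trichotomy i (mate c i) with h | h | h
  · exact Or.inr (Or.inr (Or.inl h))
  · rcases hc.sign_of_mate_eq h.symm with h' | h'
    exacts [Or.inl ⟨h', h.symm⟩, Or.inr (Or.inl ⟨h', h.symm⟩)]
  · exact Or.inr (Or.inr (Or.inr h))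

theorem exists_mate_bound (hc : IsAffineClan p q c) (hn : 0 < p + q) :
    ∃ C : ℤ, ∀ i, |mate c i - i| ≤ C := by
  have hpos : (0 : ℤ) < (p + q : ℕ) := by exact_mod_cast hn
  obtain ⟨C, hC⟩ := ((Set.finite_Ico (0 : ℤ) (p + q : ℕ)).image
    fun i => |mate c i - i|).bddAbove
  refine ⟨C, fun i => ?_⟩
  have h := hC ⟨i % (p + q : ℕ), ⟨Int.emod_nonneg i hpos.ne', Int.emod_lt_of_pos i hpos⟩, rfl⟩
  have h1 := hc.mate_add_mul (i % (p + q : ℕ)) (i / (p + q : ℕ))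
  rw [mul_comm, Int.emod_add_mul_ediv] at h1
  have h2 := Int.emod_add_mul_ediv i (p + q : ℕ)
  have h3 : mate c i - i = mate c (i % (p + q : ℕ)) - i % (p + q : ℕ) := by linarith
  rw [h3]
  exact h

theorem straddle_finite (hc : IsAffineClan p q c) (hn : 0 < p + q) (i j : ℤ) :
    (straddle c i j).Finite := by
  obtain ⟨C, hC⟩ := hc.exists_mate_bound hn
  refine (Set.finite_Ico (j - C) i).subset fun x hx => ⟨?_, hx.1⟩
  have := le_of_abs_le (hC x)
  have := hx.2
  linarith

/-- Counting labels that straddle `i` and `j` amounts to counting openers. -/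
theorem encard_labels (hc : IsAffineClan p q c) {i j : ℤ} (hij : i ≤ j) :
    {a : ℤ | ∃ x y : ℤ, x < i ∧ j ≤ y ∧ c x = .num a ∧ c y = .num a}.encard =
      (straddle c i j).encard := by
  symm
  let f : ℤ → ℤ := fun x => match c x with
    | .num a => a
    | _ => 0
  have hf : ∀ {x a}, c x = .num a → f x = a := fun h => by simp [f, h]
  have hnum : ∀ x ∈ straddle c i j, ∃ a, c x = .num a := fun x hx =>
    hc.mate_ne_iff.mp (by have := hx.1; have := hx.2; omega)
  have hinj : Set.InjOn f (straddle c i j) := by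
    intro x hx y hy hxy
    obtain ⟨a, ha⟩ := hnum x hx
    obtain ⟨b, hb⟩ := hnum y hy
    rw [hf ha, hf hb] at hxy
    subst hxy
    by_contra hne
    have h := hc.eq_mate_of_matched hne ⟨a, hb, ha⟩
    have h1 := hx.1
    have h2 := hy.2
    omega
  rw [← hinj.encard_image]
  congr 1
  ext a
  constructor
  · rintro ⟨x, hx, rfl⟩
    obtain ⟨a, ha⟩ := hnum x hx
    rw [hf ha]
    exact ⟨x, mate c x, hx.1, hx.2, ha, (apply_mate c x).trans ha⟩
  · rintro ⟨x, y, hx, hy, hxa, hya⟩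
    refine ⟨x, ⟨hx, ?_⟩, hf hxa⟩
    rwa [← hc.eq_mate_of_matched (by omega) ⟨a, hxa, hya⟩]

theorem encard_straddle_add_mul (hc : IsAffineClan p q c) (i j k : ℤ) :
    (straddle c (i + k * (p + q : ℕ)) (j + k * (p + q : ℕ))).encard = (straddle c i j).encard := by
  rw [← (add_left_injective (k * ((p + q : ℕ) : ℤ))).encard_image (straddle c i j)]
  congr 1
  ext x
  constructor
  · rintro ⟨h1, h2⟩
    refine ⟨x + (-k) * (p + q : ℕ), ⟨by linarith, ?_⟩, by simp⟩
    rw [hc.mate_add_mul]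
    linarith
  · rintro ⟨y, ⟨h1, h2⟩, rfl⟩
    refine ⟨by simpa using h1, ?_⟩
    simp only [hc.mate_add_mul]
    linarith

/-- The counts of straddling pairs tell whether the pair opened at `i` reaches `j`. -/
theorem le_mate_iff (hc : IsAffineClan p q c) (hn : 0 < p + q) (i j : ℤ) :
    j ≤ mate c i ↔ (straddle c (i + 1) j).encard ≠ (straddle c i j).encard := by
  by_cases h : j ≤ mate c i
  · have hs : straddle c (i + 1) j = insert i (straddle c i j) := by
      ext x
      simp only [straddle, Set.mem_ofPred_eq, Set.mem_insert_iff]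
      constructor
      · rintro ⟨h1, h2⟩
        by_cases hx : x = i
        exacts [Or.inl hx, Or.inr ⟨by omega, h2⟩]
      · rintro (rfl | ⟨h1, h2⟩)
        exacts [⟨by omega, h⟩, ⟨by omega, h2⟩]
    rw [hs, Set.encard_insert_of_notMem (fun h => lt_irrefl _ h.1)]
    refine iff_of_true h fun h' => ?_
    rw [← (hc.straddle_finite hn i j).cast_ncard_eq] at h'
    norm_cast at h'
    omega
  · refine iff_of_false h fun h' => h' ?_
    congr 1
    ext x
    simp only [straddle, Set.mem_ofPred_eq]
    constructor
    · rintro ⟨h1, h2⟩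
      refine ⟨?_, h2⟩
      by_contra hx
      obtain rfl : x = i := by omega
      exact h h2
    · rintro ⟨h1, h2⟩
      exact ⟨by omega, h2⟩

end IsAffineClan

theorem clanEquiv_of_mate {c d : ℤ → ClanSymbol} (hc : IsAffineClan p q c)
    (hd : IsAffineClan p q d) (hm : mate c = mate d) (hs : ∀ i, mate c i = i → c i = d i) :
    ClanEquiv c d := by
  refine ⟨fun i => ?_, fun i j _ => by rw [hc.matched_iff, hd.matched_iff, hm]⟩
  by_cases h : mate c i = i
  · rw [hs i h]
    exact ⟨Iff.rfl, Iff.rfl⟩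
  · obtain ⟨a, ha⟩ := hc.mate_ne_iff.mp h
    rw [hm] at h
    obtain ⟨b, hb⟩ := hd.mate_ne_iff.mp h
    simp [ha, hb]

theorem mate_eq_of_straddle {c d : ℤ → ClanSymbol} (hc : IsAffineClan p q c)
    (hd : IsAffineClan p q d) (hn : 0 < p + q)
    (h : ∀ i j, i ≤ j → (straddle c i j).encard = (straddle d i j).encard) : mate c = mate d := by
  have hle : ∀ i j, i < j → (j ≤ mate c i ↔ j ≤ mate d i) := fun i j hij => by
    rw [hc.le_mate_iff hn, hd.le_mate_iff hn, h _ _ (by omega), h _ _ (by omega)]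
  have hop : ∀ i, i < mate c i → mate d i = mate c i := fun i hi =>
    le_antisymm (by
      by_contra h'
      have := (hle i (mate c i + 1) (by omega)).mpr (by omega)
      omega) ((hle i _ hi).mp le_rfl)
  have hop' : ∀ i, i < mate d i → mate c i = mate d i := fun i hi =>
    (hop i (lt_of_lt_of_le hi ((hle i _ hi).mpr le_rfl))).symm
  funext i
  rcases lt_trichotomy i (mate c i) with hi | hi | hi
  · exact (hop i hi).symm
  · rcases lt_trichotomy i (mate d i) with hi' | hi' | hi'
    · exact hop' i hi'
    · rw [← hi, ← hi']
    · have := hop' (mate d i) (by rwa [hd.mate_mate])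
      rw [hd.mate_mate] at this
      have h2 := hc.mate_mate (mate d i)
      rw [this] at h2
      exact h2
  · have := hop (mate c i) (by rwa [hc.mate_mate])
    rw [hc.mate_mate] at this
    have h2 := hd.mate_mate (mate c i)
    rw [this] at h2
    exact h2.symm

/-- The invariants of a flag determine a clan up to equivalence. -/
theorem MatchesInvariants.clanEquiv {𝕜 : Type*} [Field 𝕜] {Λ : AffineFlag 𝕜 p q} (hn : 0 < p + q)
    {c d : ℤ → ClanSymbol} (hc : IsAffineClan p q c) (hd : IsAffineClan p q d)
    (hcΛ : MatchesInvariants Λ c) (hdΛ : MatchesInvariants Λ d) : ClanEquiv c d := by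
  have hcount : ∀ i j, i ≤ j → (straddle c i j).encard = (straddle d i j).encard := by
    intro i j hij
    obtain ⟨i₀, k, ⟨h1, h2⟩, rfl⟩ := exists_window hn i
    obtain ⟨j₀, rfl⟩ : ∃ j₀, j = j₀ + k * (p + q : ℕ) := ⟨j - k * (p + q : ℕ), by ring⟩
    rw [hc.encard_straddle_add_mul, hd.encard_straddle_add_mul]
    rcases (show i₀ = j₀ ∨ i₀ < j₀ by rw [← le_iff_eq_or_lt]; linarith) with rfl | hlt
    · rw [← hc.encard_labels le_rfl, ← hd.encard_labels le_rfl, ← hcΛ.nat _ h1 h2,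
        ← hdΛ.nat _ h1 h2]
    · have h := (hcΛ.pair _ _ h1 h2 hlt).symm.trans (hdΛ.pair _ _ h1 h2 hlt)
      rw [hc.encard_labels hlt.le, hd.encard_labels hlt.le] at h
      exact ENat.add_right_injective_of_ne_top (ENat.natCast_ne_top _) h
  have hm := mate_eq_of_straddle hc hd hn hcount
  refine clanEquiv_of_mate hc hd hm fun i hi => ?_
  obtain ⟨i₀, k, ⟨h1, h2⟩, rfl⟩ := exists_window hn i
  have hi' := hi
  rw [hm] at hi'
  rw [hc.mate_add_mul, add_left_inj] at hi
  rw [hd.mate_add_mul, add_left_inj] at hi'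
  rw [hc.periodic, hd.periodic]
  congr 1
  rcases hc.sign_of_mate_eq hi with hci | hci <;> rcases hd.sign_of_mate_eq hi' with hdi | hdi
  · rw [hci, hdi]
  · have h3 := (hcΛ.plus _ h1 h2 hci).1
    rw [(hdΛ.minus _ h1 h2 hdi).1] at h3
    exact absurd h3 (by simp)
  · have h3 := (hcΛ.minus _ h1 h2 hci).1
    rw [(hdΛ.plus _ h1 h2 hdi).1] at h3
    exact absurd h3 (by simp)
  · rw [hci, hdi]

/-! ### The projection onto `V₊` -/

/-- The projection `π₊` as an `F`-linear map. -/
def projLin (𝕜 : Type*) [Field 𝕜] (p q : ℕ) : Vec 𝕜 p q →ₗ[LaurentSeries 𝕜] Vec 𝕜 p q where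
  toFun := projPlus 𝕜 p q
  map_add' := map_add _
  map_smul' f v := by
    ext (r | s) : 1 <;> simp [projPlus]

theorem projLin_apply (v : Vec 𝕜 p q) : projLin 𝕜 p q v = projPlus 𝕜 p q v := rfl

theorem projPlus_smul (f : LaurentSeries 𝕜) (v : Vec 𝕜 p q) :
    projPlus 𝕜 p q (f • v) = f • projPlus 𝕜 p q v := (projLin 𝕜 p q).map_smul f v

theorem mem_Vplus_iff {v : Vec 𝕜 p q} : v ∈ Vplus 𝕜 p q ↔ projPlus 𝕜 p q v = v := by
  constructor
  · intro h
    ext (r | s) : 1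
    exacts [rfl, (h s).symm]
  · intro h s
    rw [← h]
    rfl

theorem mem_Vminus_iff {v : Vec 𝕜 p q} : v ∈ Vminus 𝕜 p q ↔ projPlus 𝕜 p q v = 0 := by
  constructor
  · intro h
    ext (r | s) : 1
    exacts [h r, rfl]
  · intro h r
    exact congrFun h (Sum.inl r)

theorem projPlus_idem (v : Vec 𝕜 p q) :
    projPlus 𝕜 p q (projPlus 𝕜 p q v) = projPlus 𝕜 p q v := by
  ext (r | s) : 1 <;> rfl

theorem smul_mem_Vplus (f : LaurentSeries 𝕜) (v : Vec 𝕜 p q) (hv : v ∈ Vplus 𝕜 p q) :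
    f • v ∈ Vplus 𝕜 p q := by
  rw [mem_Vplus_iff] at hv ⊢
  rw [projPlus_smul, hv]

theorem smul_mem_Vminus (f : LaurentSeries 𝕜) (v : Vec 𝕜 p q) (hv : v ∈ Vminus 𝕜 p q) :
    f • v ∈ Vminus 𝕜 p q := by
  rw [mem_Vminus_iff] at hv ⊢
  rw [projPlus_smul, hv, smul_zero]

/-! ### Bases in normal form -/

section

variable [NeZero (p + q)]

/-- A periodic basis is in normal form for the clan `c` if its vector at a sign lies in `V₊` or
`V₋` according to the sign, and, for a pair `i < mate c i`, the vector at `i` lies in `V₊` and is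
the projection to `V₊` of the vector at `mate c i`. -/
structure IsNormal (c : ℤ → ClanSymbol) (B : PBasis 𝕜 p q) : Prop where
  plus : ∀ i, c i = .plus → projPlus 𝕜 p q (vec B i) = vec B i
  minus : ∀ i, c i = .minus → projPlus 𝕜 p q (vec B i) = 0
  opener : ∀ i, i < mate c i → projPlus 𝕜 p q (vec B i) = vec B i
  closer : ∀ i, i < mate c i → projPlus 𝕜 p q (vec B (mate c i)) = vec B i

theorem mem_latOf_succ_iff (B : PBasis 𝕜 p q) {i : ℤ} {v : Vec 𝕜 p q} (hv : v ∈ latOf B i) :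
    v ∈ latOf B (i + 1) ↔ coef B i v = 0 := by
  refine ⟨fun h => h i (by omega), fun h k hk => ?_⟩
  rcases (show k < i ∨ k = i by omega) with hk | rfl
  exacts [hv k hk, h]

theorem sub_coef_smul_mem (B : PBasis 𝕜 p q) {i : ℤ} {v : Vec 𝕜 p q} (hv : v ∈ latOf B i) :
    v - coef B i v • vec B i ∈ latOf B (i + 1) := by
  intro k hk
  rw [map_sub, map_smul, coef_vec]
  rcases (show k < i ∨ k = i by omega) with hk | rfl
  · rw [hv k hk, if_neg hk.ne, smul_zero, sub_zero]
  · simp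

theorem relDim_step_eq_one (B : PBasis 𝕜 p q) {W : Sub 𝕜 p q} {i : ℤ} {w : Vec 𝕜 p q}
    (hw : w ∈ latOf B i ⊓ W) (h1 : coef B i w = 1) :
    relDim (latOf B i ⊓ W) (latOf B (i + 1) ⊓ W) = 1 := by
  rw [relDim_eq_encard B (Set.finite_singleton i), Set.encard_singleton]
  · rintro v ⟨hv, hv'⟩
    simp only [Set.mem_singleton_iff, forall_eq, ← mem_latOf_succ_iff B hv]
    exact ⟨fun h => h.1, fun h => ⟨h, hv'⟩⟩
  · rintro _ rfl
    refine ⟨w, hw, ?_⟩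
    rintro _ rfl
    rw [h1, if_pos rfl]

theorem relDim_step_eq_zero (B : PBasis 𝕜 p q) {W : Sub 𝕜 p q} {i : ℤ}
    (h : ∀ w ∈ latOf B i ⊓ W, coef B i w = 0) :
    relDim (latOf B i ⊓ W) (latOf B (i + 1) ⊓ W) = 0 := by
  rw [relDim_eq_encard B (T := ∅) Set.finite_empty, Set.encard_empty]
  · rintro v hv
    refine ⟨by simp, fun _ => ⟨(mem_latOf_succ_iff B hv.1).mpr (h v hv), hv.2⟩⟩
  · simp

end

namespace IsNormal

variable [NeZero (p + q)] {c : ℤ → ClanSymbol} {B : PBasis 𝕜 p q}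

open scoped Classical in
/-- In normal form `π₊` keeps the coefficients at the openers and at the signs `+`, kills the
others, and adds to the coefficient at an opener that of its mate. -/
theorem coef_projPlus (hc : IsAffineClan p q c) (hB : IsNormal c B) (k : ℤ) (v : Vec 𝕜 p q) :
    coef B k (projPlus 𝕜 p q v) = (if k < mate c k ∨ c k = .plus then coef B k v else 0) +
      if k < mate c k then coef B (mate c k) v else 0 := by
  have hpos := size_pos p q
  have hplus : ∀ i t : ℤ, c (i + t * (p + q : ℕ)) = .plus ↔ c i = .plus := fun i t => by
    rw [hc.periodic]
    rcases c i with _ | _ | a <;> simp [ClanSymbol.shift]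
  -- By linearity it is enough to look at multiples of the vectors of the basis.
  have main : ∀ (f : LaurentSeries 𝕜) (m : ℤ), coef B k (projPlus 𝕜 p q (f • vec B m)) =
      (if k < mate c k ∨ c k = .plus then coef B k (f • vec B m) else 0) +
        if k < mate c k then coef B (mate c k) (f • vec B m) else 0 := by
    intro f m
    have hk : ∀ a : ℤ, ((p + q : ℕ) : ℤ) ∣ k - a → ∃ t : ℤ, k = a + t * (p + q : ℕ) := by
      rintro a ⟨t, ht⟩
      exact ⟨t, by linarith⟩
    -- The two terms on the right vanish unless `m` is congruent to `k`, respectively `mate c k`.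
    have hmate : ((p + q : ℕ) : ℤ) ∣ mate c k - m ↔ ((p + q : ℕ) : ℤ) ∣ k - mate c m := by
      constructor
      · rintro ⟨t, ht⟩
        have h1 : mate c k = m + t * (p + q : ℕ) := by linarith
        have h2 := congrArg (mate c) h1
        rw [hc.mate_mate, hc.mate_add_mul] at h2
        exact ⟨t, by linarith⟩
      · rintro ⟨t, ht⟩
        have h1 : k = mate c m + t * (p + q : ℕ) := by linarith
        have h2 := congrArg (mate c) h1
        rw [hc.mate_add_mul, hc.mate_mate] at h2
        exact ⟨t, by linarith⟩
    rw [projPlus_smul]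
    have hfix : m < mate c m ∨ c m = .plus → projPlus 𝕜 p q (vec B m) = vec B m :=
      fun h => h.elim (hB.opener m) (hB.plus m)
    by_cases hm : m < mate c m ∨ c m = .plus
    · rw [hfix hm]
      have h2 : (if k < mate c k then coef B (mate c k) (f • vec B m) else 0) = 0 := by
        split_ifs with h
        · rw [coef_smul_vec, if_neg]
          rw [hmate]
          intro h'
          obtain ⟨t, ht⟩ := hk _ h'
          rw [ht, hc.mate_add_mul, hc.mate_mate] at h
          rcases hm with hm | hm
          · omega
          · rw [hc.mate_eq_of_sign (Or.inl hm)] at h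
            omega
        · rfl
      rw [h2, add_zero]
      split_ifs with h
      · rfl
      · rw [coef_smul_vec, if_neg]
        intro h'
        obtain ⟨t, rfl⟩ := hk _ h'
        rw [hplus, hc.mate_add_mul, add_lt_add_iff_right] at h
        exact h hm
    · have h1 : (if k < mate c k ∨ c k = .plus then coef B k (f • vec B m) else 0) = 0 := by
        split_ifs with h
        · rw [coef_smul_vec, if_neg]
          intro h'
          obtain ⟨t, rfl⟩ := hk _ h'
          rw [hplus, hc.mate_add_mul, add_lt_add_iff_right] at h
          exact hm h
        · rfl
      rw [h1, zero_add]
      rcases hc.kind_cases m with h | h | h | h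
      · exact absurd (Or.inr h.1) hm
      · rw [hB.minus m h.1, smul_zero, map_zero]
        split_ifs with h3
        · rw [coef_smul_vec, if_neg]
          rw [hmate, h.2]
          intro h'
          obtain ⟨t, rfl⟩ := hk _ h'
          rw [hc.mate_add_mul, h.2] at h3
          exact lt_irrefl _ h3
        · rfl
      · exact absurd (Or.inl h) hm
      · have h4 := hB.closer (mate c m) (by rwa [hc.mate_mate])
        rw [hc.mate_mate] at h4
        rw [h4, coef_smul_vec, coef_smul_vec]
        by_cases h5 : ((p + q : ℕ) : ℤ) ∣ k - mate c m
        · rw [if_pos h5, if_pos (hmate.mpr h5)]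
          obtain ⟨t, rfl⟩ := hk _ h5
          rw [hc.mate_add_mul, hc.mate_mate, if_pos (by linarith)]
          congr 2
          ring
        · rw [if_neg h5, if_neg (fun h6 => h5 (hmate.mp h6)), ite_self]
  rw [← B.sum_repr v]
  have hite : ∀ (P : Prop) [Decidable P] (g : Fin (p + q) → 𝕜),
      (if P then ∑ r, g r else 0) = ∑ r, if P then g r else 0 := by
    intro P _ g
    split_ifs <;> simp
  simp only [map_sum]
  rw [hite, hite, ← Finset.sum_add_distrib]
  refine Finset.sum_congr rfl fun r _ => ?_
  rw [← vec_natCast]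
  exact main _ _

theorem coef_projPlus_opener (hc : IsAffineClan p q c) (hB : IsNormal c B) {k : ℤ}
    (hk : k < mate c k) (v : Vec 𝕜 p q) :
    coef B k (projPlus 𝕜 p q v) = coef B k v + coef B (mate c k) v := by
  rw [hB.coef_projPlus hc, if_pos (Or.inl hk), if_pos hk]

theorem coef_projPlus_plus (hc : IsAffineClan p q c) (hB : IsNormal c B) {k : ℤ}
    (hk : c k = .plus) (v : Vec 𝕜 p q) :
    coef B k (projPlus 𝕜 p q v) = coef B k v := by
  rw [hB.coef_projPlus hc, if_pos (Or.inr hk),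
    if_neg (by rw [hc.mate_eq_of_sign (Or.inl hk)]; exact lt_irrefl _), add_zero]

theorem coef_projPlus_minus (hc : IsAffineClan p q c) (hB : IsNormal c B) {k : ℤ}
    (hk : c k = .minus) (v : Vec 𝕜 p q) :
    coef B k (projPlus 𝕜 p q v) = 0 := by
  have h := hc.mate_eq_of_sign (Or.inr hk)
  rw [hB.coef_projPlus hc, if_neg (by simp [h, hk]), if_neg (by simp [h]), add_zero]

theorem coef_projPlus_closer (hc : IsAffineClan p q c) (hB : IsNormal c B) {k : ℤ}
    (hk : mate c k < k) (v : Vec 𝕜 p q) :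
    coef B k (projPlus 𝕜 p q v) = 0 := by
  have h : c k ≠ .plus := fun h => hk.ne (hc.mate_eq_of_sign (Or.inl h))
  rw [hB.coef_projPlus hc, if_neg (by simp [h, hk.le]), if_neg (by omega), add_zero]

/-! ### The invariants of a flag in normal form -/

theorem dimPlus_eq_one (hB : IsNormal c B) {i : ℤ} (h : i < mate c i ∨ c i = .plus) :
    dimPlus (flagOf B) i = 1 :=
  relDim_step_eq_one B
    ⟨vec_mem_latOf B le_rfl, mem_Vplus_iff.mpr (h.elim (hB.opener i) (hB.plus i))⟩
    (coef_vec_self B i)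

theorem dimPlus_eq_zero (hc : IsAffineClan p q c) (hB : IsNormal c B) {i : ℤ}
    (h : mate c i < i ∨ c i = .minus) : dimPlus (flagOf B) i = 0 := by
  refine relDim_step_eq_zero B fun w hw => ?_
  rw [← mem_Vplus_iff.mp hw.2]
  exact h.elim (hB.coef_projPlus_closer hc · w) (hB.coef_projPlus_minus hc · w)

theorem dimMinus_eq_one (hB : IsNormal c B) {i : ℤ} (h : i < mate c i ∨ c i = .minus) :
    dimMinus (flagOf B) i = 1 := by
  rcases h with h | h
  · refine relDim_step_eq_one B (w := vec B i - vec B (mate c i)) ⟨Submodule.sub_mem _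
      (vec_mem_latOf B le_rfl) (vec_mem_latOf B h.le), mem_Vminus_iff.mpr ?_⟩ ?_
    · rw [map_sub, hB.opener i h, hB.closer i h, sub_self]
    · rw [map_sub, coef_vec_self, coef_vec_of_ne B h.ne, sub_zero]
  · exact relDim_step_eq_one B ⟨vec_mem_latOf B le_rfl, mem_Vminus_iff.mpr (hB.minus i h)⟩
      (coef_vec_self B i)

theorem dimMinus_eq_zero (hc : IsAffineClan p q c) (hB : IsNormal c B) {i : ℤ}
    (h : mate c i < i ∨ c i = .plus) : dimMinus (flagOf B) i = 0 := by
  refine relDim_step_eq_zero B fun w hw => ?_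
  have h0 := mem_Vminus_iff.mp hw.2
  rcases h with h | h
  · have h1 := hB.coef_projPlus_opener hc (k := mate c i) (by rwa [hc.mate_mate]) w
    rw [h0, map_zero, hw.1 _ h, hc.mate_mate, zero_add] at h1
    exact h1.symm
  · rw [← hB.coef_projPlus_plus hc h, h0, map_zero]

theorem dimNat_eq (hc : IsAffineClan p q c) (hB : IsNormal c B) (i : ℤ) :
    dimNat (flagOf B) i = (straddle c i i).encard := by
  rw [← hc.mate_injective.injOn.encard_image]
  refine relDim_eq_encard B
    ((hc.straddle_finite (Nat.pos_of_ne_zero (NeZero.ne _)) i i).image _) ?_ ?_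
  · intro v hv
    -- The sum of the two intersections consists of the `v` whose projection stays in the lattice.
    have h1 : v ∈ ((flagOf B).lat i ⊓ Vplus 𝕜 p q) ⊔ ((flagOf B).lat i ⊓ Vminus 𝕜 p q) ↔
        projPlus 𝕜 p q v ∈ latOf B i := by
      rw [Submodule.mem_sup]
      constructor
      · rintro ⟨x, hx, y, hy, rfl⟩
        rw [map_add, mem_Vplus_iff.mp hx.2, mem_Vminus_iff.mp hy.2, add_zero]
        exact hx.1
      · intro h
        refine ⟨_, ⟨h, mem_Vplus_iff.mpr (projPlus_idem v)⟩, v - projPlus 𝕜 p q v,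
          ⟨Submodule.sub_mem _ hv h, mem_Vminus_iff.mpr ?_⟩, add_sub_cancel _ _⟩
        rw [map_sub, projPlus_idem, sub_self]
    rw [h1]
    constructor
    · rintro h _ ⟨x, ⟨hx, hx'⟩, rfl⟩
      have h2 := hB.coef_projPlus_opener hc (k := x) (by omega) v
      rwa [h x hx, hv x hx, zero_add, eq_comm] at h2
    · intro h k hk
      rcases hc.kind_cases k with h2 | h2 | h2 | h2
      · rw [hB.coef_projPlus_plus hc h2.1, hv k hk]
      · rw [hB.coef_projPlus_minus hc h2.1]
      · rw [hB.coef_projPlus_opener hc h2, hv k hk, zero_add]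
        by_cases h3 : mate c k < i
        · exact hv _ h3
        · exact h _ ⟨k, ⟨hk, not_lt.mp h3⟩, rfl⟩
      · rw [hB.coef_projPlus_closer hc h2]
  · rintro _ ⟨x, hx, rfl⟩
    exact ⟨vec B (mate c x), vec_mem_latOf B hx.2, fun j _ => coef_vec B _ _⟩

theorem coef_eq_zero_of_mem (hc : IsAffineClan p q c) (hB : IsNormal c B) {i j k : ℤ}
    (hij : i ≤ j) {v : Vec 𝕜 p q} (hv : v ∈ (latOf B j).map (projPlus 𝕜 p q) ⊔ latOf B i)
    (hk : k < i) (hk' : mate c k < j) : coef B k v = 0 := by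
  obtain ⟨_, ⟨u, hu, rfl⟩, w, hw, rfl⟩ := Submodule.mem_sup.mp hv
  classical
  rw [map_add, hw k hk, add_zero, hB.coef_projPlus hc, hu k (by omega), hu _ hk', ite_self,
    ite_self, add_zero]

theorem vec_mem_map (hB : IsNormal c B) {i j : ℤ} (hi : i < mate c i) (hj : j ≤ mate c i) :
    vec B i ∈ (latOf B j).map (projPlus 𝕜 p q) :=
  ⟨vec B (mate c i), vec_mem_latOf B hj, hB.closer i hi⟩

theorem dimPair_eq (hc : IsAffineClan p q c) (hB : IsNormal c B) {i j : ℤ} (hij : i < j)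
    (hi : i ≤ (p + q : ℕ)) : dimPair (flagOf B) i j =
      ((((p + q : ℕ) : ℤ) + 1 - i).toNat : ℕ∞) + (straddle c i j).encard := by
  have hfin := hc.straddle_finite (Nat.pos_of_ne_zero (NeZero.ne (p + q))) i j
  have hdisj : Disjoint (Set.Ico i ((p + q : ℕ) + 1)) (straddle c i j) :=
    Set.disjoint_left.mpr fun x hx hx' => by
      have := hx.1
      have := hx'.1
      omega
  have hcard : (Set.Ico i (((p + q : ℕ) : ℤ) + 1)).encard =
      ((((p + q : ℕ) : ℤ) + 1 - i).toNat : ℕ∞) := by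
    rw [← Finset.coe_Ico, Set.encard_coe_eq_coe_finsetCard, Int.card_Ico]
  rw [← hcard, ← Set.encard_union_eq hdisj, dimPair, ← (flagOf B).periodic, add_comm (1 : ℤ)]
  refine relDim_eq_encard B ((Set.finite_Ico _ _).union hfin) ?_ ?_
  · intro v hv
    constructor
    · rintro h k (hk | hk)
      · exact h k hk.2
      · exact h k (by have := hk.1; omega)
    · intro h k hk
      by_cases hki : k < i
      · by_cases hkj : mate c k < j
        · exact hB.coef_eq_zero_of_mem hc hij.le hv hki hkj
        · exact h k (Or.inr ⟨hki, not_lt.mp hkj⟩)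
      · exact h k (Or.inl ⟨not_lt.mp hki, hk⟩)
  · rintro k (hk | hk)
    · exact ⟨vec B k, Submodule.mem_sup_right (vec_mem_latOf B hk.1), fun l _ => coef_vec B _ _⟩
    · refine ⟨vec B k, Submodule.mem_sup_left (hB.vec_mem_map ?_ hk.2),
        fun l _ => coef_vec B _ _⟩
      have := hk.1
      have := hk.2
      omega

theorem isPartner_iff (hc : IsAffineClan p q c) (hB : IsNormal c B) {i j : ℤ}
    (hi : i < mate c i) : IsPartner (flagOf B) i j ↔ j = mate c i := by
  constructor
  · rintro ⟨hij, v, -, hv2, hv3, hv4, hv5⟩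
    have hvi : v ∈ latOf B i := (hv3 v).mpr ⟨0, Submodule.zero_mem _, 1, by rw [one_smul, zero_add]⟩
    have hne : coef B i v ≠ 0 := fun h => hv2 ((mem_latOf_succ_iff B hvi).mpr h)
    have h1 : j ≤ mate c i := by
      by_contra h
      exact hne (hB.coef_eq_zero_of_mem hc (by omega) hv4 (by omega) (not_le.mp h))
    by_contra h2
    apply hv5
    rw [← add_sub_cancel (coef B i v • vec B i) v]
    refine Submodule.add_mem_sup ?_ (sub_coef_smul_mem B hvi)
    exact const_smul_mem _ (hB.vec_mem_map hi (by omega))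
  · rintro rfl
    refine ⟨hi, vec B i, hB.vec_mem_map hi (by omega), fun h => ?_, fun w => ⟨fun hw => ?_, ?_⟩,
      Submodule.mem_sup_left (hB.vec_mem_map hi le_rfl), fun h => ?_⟩
    · exact one_ne_zero ((coef_vec_self B i).symm.trans (h i (by omega)))
    · exact ⟨_, sub_coef_smul_mem B hw, coef B i w, (sub_add_cancel _ _).symm⟩
    · rintro ⟨u, hu, a, rfl⟩
      exact Submodule.add_mem _ (latOf_anti B (by omega) hu)
        (const_smul_mem _ (vec_mem_latOf B le_rfl))
    · exact one_ne_zero ((coef_vec_self B i).symm.trans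
        (hB.coef_eq_zero_of_mem hc (by omega) h (by omega) (by omega)))

theorem partner_eq (hc : IsAffineClan p q c) (hB : IsNormal c B) {i : ℤ} (hi : i < mate c i) :
    partner (flagOf B) i = mate c i :=
  (hB.isPartner_iff hc hi).mp (Classical.epsilon_spec ⟨_, (hB.isPartner_iff hc hi).mpr rfl⟩)

theorem matchesInvariants (hc : IsAffineClan p q c) (hB : IsNormal c B) :
    MatchesInvariants (flagOf B) c where
  nat i _ _ := by rw [hB.dimNat_eq hc, hc.encard_labels le_rfl]
  plus i _ _ h := ⟨hB.dimPlus_eq_one (Or.inr h), hB.dimMinus_eq_zero hc (Or.inr h)⟩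
  minus i _ _ h := ⟨hB.dimPlus_eq_zero hc (Or.inr h), hB.dimMinus_eq_one (Or.inr h)⟩
  pair i j _ h2 hij := by rw [hB.dimPair_eq hc hij h2, hc.encard_labels hij.le]

end IsNormal

/-! ### The procedure -/

/-- The step of the procedure at which the class of `k` modulo `n` is visited, counted from `0`. -/
def slot (p q : ℕ) (k : ℤ) : ℕ := ((k - 1) % (p + q : ℕ)).toNat

/-- The class of `k` is the first class of its pair that the procedure visits. -/
def IsLead (p q : ℕ) (c : ℤ → ClanSymbol) (k : ℤ) : Prop :=
  mate c k ≠ k ∧ slot p q k ≤ slot p q (mate c k)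

open scoped Classical in
/-- The element of the pair of `k` whose class is visited first. -/
def leader (p q : ℕ) (c : ℤ → ClanSymbol) (k : ℤ) : ℤ :=
  if slot p q k ≤ slot p q (mate c k) then k else mate c k

open scoped Classical in
/-- The number of pairs (up to translation) that the procedure has met before visiting the slot
`m`. -/
def pairCount (p q : ℕ) (c : ℤ → ClanSymbol) (m : ℕ) : ℕ :=
  Nat.count (fun k : ℕ => IsLead p q c (k + 1)) m

/-- The integer that the procedure puts at the position `k`: the pairs are numbered in the order
of their first visits, and the number is shifted along with the leader of the pair. -/
def label (p q : ℕ) (c : ℤ → ClanSymbol) (k : ℤ) : ℤ :=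
  pairCount p q c (slot p q (leader p q c k)) + 1 +
    (p + q : ℕ) * ((leader p q c k - 1) / (p + q : ℕ))

/-- The result of the procedure for a flag whose clan is `c`. -/
def relabel (p q : ℕ) (c : ℤ → ClanSymbol) (k : ℤ) : ClanSymbol :=
  match c k with
  | .num _ => .num (label p q c k)
  | x => x

theorem slot_succ {m : ℕ} (hm : m < p + q) : slot p q (m + 1) = m := by
  rw [slot, add_sub_cancel_right, Int.emod_eq_of_lt (by omega) (by exact_mod_cast hm),
    Int.toNat_natCast]

theorem pairCount_le (c : ℤ → ClanSymbol) (m : ℕ) : pairCount p q c m ≤ m := by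
  classical
  exact Nat.count_le _

theorem pairCount_lt {c : ℤ → ClanSymbol} {k m : ℕ} (hk : IsLead p q c (k + 1)) (hkm : k < m) :
    pairCount p q c k < pairCount p q c m := by
  classical
  exact Nat.count_strict_mono (p := fun k : ℕ => IsLead p q c (k + 1)) hk hkm

theorem pairCount_injective {c : ℤ → ClanSymbol} {k m : ℕ} (hk : IsLead p q c (k + 1))
    (hm : IsLead p q c (m + 1)) (h : pairCount p q c k = pairCount p q c m) : k = m := by
  classical
  exact Nat.count_injective (p := fun k : ℕ => IsLead p q c (k + 1)) hk hm h

theorem exists_pairCount_add_one_eq {c : ℤ → ClanSymbol} {m a : ℕ} (ha : 0 < a)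
    (h : a ≤ pairCount p q c m) :
    ∃ k < m, IsLead p q c (k + 1) ∧ pairCount p q c k + 1 = a := by
  classical
  induction m with
  | zero =>
    have := pairCount_le (p := p) (q := q) c 0
    omega
  | succ m ih =>
    by_cases h' : a ≤ pairCount p q c m
    · obtain ⟨k, hk, hk'⟩ := ih h'
      exact ⟨k, by omega, hk'⟩
    · have hs : pairCount p q c (m + 1) =
          pairCount p q c m + if IsLead p q c (m + 1) then 1 else 0 := Nat.count_succ _ _
      rw [hs] at h
      split_ifs at h with hP
      · exact ⟨m, by omega, hP, by omega⟩
      · omega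

theorem relabel_plus_iff {c : ℤ → ClanSymbol} {k : ℤ} :
    relabel p q c k = .plus ↔ c k = .plus := by
  unfold relabel
  rcases c k with _ | _ | a <;> simp

theorem relabel_minus_iff {c : ℤ → ClanSymbol} {k : ℤ} :
    relabel p q c k = .minus ↔ c k = .minus := by
  unfold relabel
  rcases c k with _ | _ | a <;> simp

namespace IsAffineClan

variable {c : ℤ → ClanSymbol}

theorem relabel_of_mate_ne (hc : IsAffineClan p q c) {k : ℤ} (hk : mate c k ≠ k) :
    relabel p q c k = .num (label p q c k) := by
  obtain ⟨a, ha⟩ := hc.mate_ne_iff.mp hk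
  simp [relabel, ha]

theorem relabel_eq_num_iff (hc : IsAffineClan p q c) {k a : ℤ} :
    relabel p q c k = .num a ↔ mate c k ≠ k ∧ label p q c k = a := by
  constructor
  · intro h
    have hk : mate c k ≠ k := by
      intro hk
      rcases hc.sign_of_mate_eq hk with h' | h'
      · rw [relabel_plus_iff.mpr h'] at h
        cases h
      · rw [relabel_minus_iff.mpr h'] at h
        cases h
    rw [hc.relabel_of_mate_ne hk, ClanSymbol.num.injEq] at h
    exact ⟨hk, h⟩
  · rintro ⟨hk, rfl⟩
    exact hc.relabel_of_mate_ne hk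

theorem leader_eq_or (c : ℤ → ClanSymbol) (k : ℤ) :
    leader p q c k = k ∨ leader p q c k = mate c k := by
  unfold leader
  split_ifs <;> simp

theorem isLead_leader (hc : IsAffineClan p q c) {k : ℤ} (hk : mate c k ≠ k) :
    IsLead p q c (leader p q c k) := by
  unfold leader
  split_ifs with h
  · exact ⟨hk, h⟩
  · refine ⟨?_, ?_⟩
    · rw [hc.mate_mate]
      exact hk.symm
    · rw [hc.mate_mate]
      omega

end IsAffineClan

/-- The positions that are determined after `m` steps: those visited, and the closers of the
openers visited. -/
def Determined (p q : ℕ) (c : ℤ → ClanSymbol) (m : ℕ) (k : ℤ) : Prop :=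
  slot p q k < m ∨ mate c k < k ∧ slot p q (mate c k) < m

theorem Determined.of_slot_lt {c : ℤ → ClanSymbol} {m : ℕ} {k : ℤ} (h : slot p q k < m) :
    Determined p q c m k := Or.inl h

open scoped Classical in
/-- The partially determined sequence after `m` steps. -/
def partialRelabel (p q : ℕ) (c : ℤ → ClanSymbol) (m : ℕ) : ClanState := fun k =>
  if Determined p q c m k then some (relabel p q c k) else none

theorem partialRelabel_of_determined {c : ℤ → ClanSymbol} {m : ℕ} {k : ℤ}
    (h : Determined p q c m k) : partialRelabel p q c m k = some (relabel p q c k) := if_pos h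

theorem partialRelabel_of_not_determined {c : ℤ → ClanSymbol} {m : ℕ} {k : ℤ}
    (h : ¬ Determined p q c m k) : partialRelabel p q c m k = none := if_neg h

theorem partialRelabel_extend {c : ℤ → ClanSymbol} {m m' : ℕ} {k : ℤ} {P : Prop} [Decidable P]
    (h : Determined p q c m' k ↔ Determined p q c m k ∨ P) :
    (if P then some (relabel p q c k) else partialRelabel p q c m k) =
      partialRelabel p q c m' k := by
  unfold partialRelabel
  split_ifs <;> first | rfl | (exfalso; tauto)

theorem determined_succ_iff {c : ℤ → ClanSymbol} {m : ℕ} {k : ℤ} :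
    Determined p q c (m + 1) k ↔ Determined p q c m k ∨ slot p q k = m ∨
      mate c k < k ∧ slot p q (mate c k) = m := by
  unfold Determined
  rw [Nat.lt_succ_iff_lt_or_eq, Nat.lt_succ_iff_lt_or_eq]
  tauto

section

variable [NeZero (p + q)]

theorem slot_coe (k : ℤ) : (slot p q k : ℤ) = (k - 1) % (p + q : ℕ) :=
  Int.toNat_of_nonneg (Int.emod_nonneg _ (size_pos p q).ne')

theorem slot_lt (k : ℤ) : slot p q k < p + q := by
  have h := Int.emod_lt_of_pos (k - 1) (size_pos p q)
  rw [← slot_coe] at h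
  exact_mod_cast h

theorem slot_add (k : ℤ) : (slot p q k : ℤ) + 1 + (p + q : ℕ) * ((k - 1) / (p + q : ℕ)) = k := by
  rw [slot_coe]
  have := Int.emod_add_mul_ediv (k - 1) (p + q : ℕ)
  linarith

theorem slot_eq_iff {k l : ℤ} : slot p q k = slot p q l ↔ ((p + q : ℕ) : ℤ) ∣ k - l := by
  rw [show k - l = (k - 1) - (l - 1) by ring,
    ← Int.emod_eq_emod_iff_emod_sub_eq_zero.trans Int.dvd_iff_emod_eq_zero.symm, ← slot_coe,
    ← slot_coe]
  exact Nat.cast_inj.symm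

theorem slot_add_mul (k t : ℤ) : slot p q (k + t * (p + q : ℕ)) = slot p q k :=
  slot_eq_iff.mpr (by simp)

namespace IsAffineClan

variable {c : ℤ → ClanSymbol}

theorem slot_mate_ne (hc : IsAffineClan p q c) {k : ℤ} (hk : mate c k ≠ k) :
    slot p q (mate c k) ≠ slot p q k :=
  fun h => hc.not_dvd_mate_sub hk (slot_eq_iff.mp h)

theorem leader_mate (hc : IsAffineClan p q c) (k : ℤ) :
    leader p q c (mate c k) = leader p q c k := by
  unfold leader
  rw [hc.mate_mate]
  by_cases hk : mate c k = k
  · simp [hk]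
  · have := hc.slot_mate_ne hk
    split_ifs <;> first | rfl | omega

theorem label_mate (hc : IsAffineClan p q c) (k : ℤ) :
    label p q c (mate c k) = label p q c k := by
  unfold label
  rw [hc.leader_mate]

theorem leader_add_mul (hc : IsAffineClan p q c) (k t : ℤ) :
    leader p q c (k + t * (p + q : ℕ)) = leader p q c k + t * (p + q : ℕ) := by
  unfold leader
  rw [hc.mate_add_mul, slot_add_mul, slot_add_mul]
  split_ifs <;> rfl

theorem label_add_mul (hc : IsAffineClan p q c) (k t : ℤ) :
    label p q c (k + t * (p + q : ℕ)) = label p q c k + t * (p + q : ℕ) := by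
  unfold label
  rw [hc.leader_add_mul, slot_add_mul, add_sub_right_comm,
    Int.add_mul_ediv_right _ _ (size_pos p q).ne']
  ring

theorem relabel_add_mul (hc : IsAffineClan p q c) (k t : ℤ) :
    relabel p q c (k + t * (p + q : ℕ)) = (relabel p q c k).shift (t * (p + q : ℕ)) := by
  unfold relabel
  rw [hc.periodic, hc.label_add_mul]
  rcases c k with _ | _ | a <;> rfl

theorem isLead_add_mul (hc : IsAffineClan p q c) (k t : ℤ) :
    IsLead p q c (k + t * (p + q : ℕ)) ↔ IsLead p q c k := by
  unfold IsLead
  rw [hc.mate_add_mul, slot_add_mul, slot_add_mul, Ne, add_left_inj]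

theorem isLead_slot (hc : IsAffineClan p q c) {k : ℤ} (hk : IsLead p q c k) :
    IsLead p q c (slot p q k + 1) := by
  rw [← slot_add (p := p) (q := q) k, mul_comm, hc.isLead_add_mul] at hk
  exact hk

theorem pairCount_slot_lt (c : ℤ → ClanSymbol) (k : ℤ) :
    (pairCount p q c (slot p q k) : ℤ) < (p + q : ℕ) := by
  exact_mod_cast (pairCount_le c _).trans_lt (slot_lt k)

/-- Only the two elements of a pair get the same integer. -/
theorem eq_or_eq_mate_of_label (hc : IsAffineClan p q c) {k l : ℤ} (hk : mate c k ≠ k)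
    (hl : mate c l ≠ l) (h : label p q c k = label p q c l) : l = k ∨ l = mate c k := by
  have hlead : leader p q c k = leader p q c l := by
    have hk' := hc.isLead_slot (hc.isLead_leader hk)
    have hl' := hc.isLead_slot (hc.isLead_leader hl)
    have h1 := pairCount_slot_lt (p := p) (q := q) c (leader p q c k)
    have h2 := pairCount_slot_lt (p := p) (q := q) c (leader p q c l)
    unfold label at h
    -- The numbers of the pairs are less than `n`, so the label determines number and shift.
    obtain ⟨h3, h4⟩ := add_mul_inj (by omega) h1 (by omega) h2
      (x := (leader p q c k - 1) / (p + q : ℕ)) (y := (leader p q c l - 1) / (p + q : ℕ))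
      (by linarith)
    rw [← slot_add (p := p) (q := q) (leader p q c k),
      ← slot_add (p := p) (q := q) (leader p q c l),
      pairCount_injective hk' hl' (by exact_mod_cast h3), h4]
  rcases leader_eq_or (p := p) (q := q) c k with h1 | h1 <;>
    rcases leader_eq_or (p := p) (q := q) c l with h2 | h2 <;> rw [h1, h2] at hlead
  · exact Or.inl hlead.symm
  · exact Or.inr (by rw [hlead, hc.mate_mate])
  · exact Or.inr hlead.symm
  · exact Or.inl (hc.mate_injective hlead).symm

theorem matched_relabel_iff (hc : IsAffineClan p q c) {k l : ℤ} :
    Matched (relabel p q c) k l ↔ Matched c k l := by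
  rw [hc.matched_iff]
  constructor
  · rintro ⟨a, h1, h2⟩
    rw [hc.relabel_eq_num_iff] at h1 h2
    exact ⟨h1.1, hc.eq_or_eq_mate_of_label h1.1 h2.1 (h1.2.trans h2.2.symm)⟩
  · rintro ⟨hk, rfl | rfl⟩
    · exact ⟨_, hc.relabel_of_mate_ne hk, hc.relabel_of_mate_ne hk⟩
    · refine ⟨_, hc.relabel_of_mate_ne hk, hc.relabel_eq_num_iff.mpr ⟨?_, hc.label_mate k⟩⟩
      rw [hc.mate_mate]
      exact hk.symm

theorem mate_relabel (hc : IsAffineClan p q c) : mate (relabel p q c) = mate c :=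
  mate_congr fun _ _ _ => hc.matched_relabel_iff

theorem relabel (hc : IsAffineClan p q c) : IsAffineClan p q (relabel p q c) where
  periodic i k := hc.relabel_add_mul i k
  signs := by
    simp only [relabel_plus_iff, relabel_minus_iff]
    exact hc.signs
  twice := by
    rintro a ⟨i, hi⟩
    obtain ⟨hne, rfl⟩ := hc.relabel_eq_num_iff.mp hi
    rw [Set.ncard_eq_two]
    refine ⟨i, mate c i, hne.symm, ?_⟩
    ext k
    simp only [Set.mem_ofPred_eq, Set.mem_insert_iff, Set.mem_singleton_iff,
      hc.relabel_eq_num_iff]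
    constructor
    · rintro ⟨h1, h2⟩
      exact hc.eq_or_eq_mate_of_label hne h1 h2.symm
    · rintro (rfl | rfl)
      · exact ⟨hne, rfl⟩
      · exact ⟨by rw [hc.mate_mate]; exact hne.symm, hc.label_mate i⟩

end IsAffineClan

/-- The integers in `[1, n]` that the procedure has used at the visited positions are the numbers
of the pairs met so far. -/
theorem usedLabels_eq {c : ℤ → ClanSymbol} (hc : IsAffineClan p q c) {m : ℕ} (hm : m < p + q) :
    usedLabels (p + q) (partialRelabel p q c m) (m + 1) = Set.Icc 1 (pairCount p q c m : ℤ) := by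
  have hsk : ∀ {k : ℕ}, k < m →
      partialRelabel p q c m (k + 1) = some (relabel p q c (k + 1)) := fun {k} hk =>
    partialRelabel_of_determined (.of_slot_lt (by rwa [slot_succ (by omega)]))
  ext a
  constructor
  · rintro ⟨h1, h2, k, hk1, hk2, hk3⟩
    obtain ⟨k, rfl⟩ : ∃ k' : ℕ, k = k' + 1 := ⟨(k - 1).toNat, by omega⟩
    have hkm : k < m := by omega
    rw [hsk hkm, Option.some.injEq, hc.relabel_eq_num_iff] at hk3
    obtain ⟨hne, hlab⟩ := hk3
    have hl := hc.isLead_slot (hc.isLead_leader hne)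
    have hlk : slot p q (leader p q c (k + 1)) ≤ k := by
      have := slot_succ (p := p) (q := q) (m := k) (by omega)
      unfold leader
      split_ifs with h <;> omega
    unfold label at hlab
    -- A label in `[1, n]` has not been shifted.
    obtain ⟨h3, -⟩ := add_mul_inj (b := a - 1) (y := 0) (by omega)
      (IsAffineClan.pairCount_slot_lt (p := p) (q := q) c (leader p q c (k + 1))) (by omega)
      (by omega) (x := (leader p q c (k + 1) - 1) / (p + q : ℕ)) (by linarith)
    have hlt := pairCount_lt hl (lt_of_le_of_lt hlk hkm)
    exact ⟨h1, by omega⟩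
  · rintro ⟨h1, h2⟩
    have hle := pairCount_le (p := p) (q := q) c m
    obtain ⟨k, hk, hPk, hka⟩ := exists_pairCount_add_one_eq (p := p) (q := q) (c := c) (m := m)
      (a := a.toNat) (by omega) (by omega)
    refine ⟨h1, by omega, k + 1, by omega, by omega, ?_⟩
    rw [hsk hk, Option.some.injEq, hc.relabel_eq_num_iff]
    refine ⟨hPk.1, ?_⟩
    have hlead : leader p q c (k + 1) = k + 1 := if_pos hPk.2
    unfold label
    rw [hlead, slot_succ (by omega), add_sub_cancel_right,
      Int.ediv_eq_zero_of_lt (by omega) (by omega), mul_zero, add_zero]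
    omega

/-- The visit that meets a pair first gives it the fresh integer; this is where the choice of that
integer as one more than the maximum matches `label`. -/
theorem freshLabel_eq {c : ℤ → ClanSymbol} (hc : IsAffineClan p q c) {m : ℕ} (hm : m < p + q)
    {k : ℤ} (hk : leader p q c k = m + 1) :
    freshLabel (p + q) (partialRelabel p q c m) (m + 1) = label p q c k := by
  have hlab : label p q c k = 1 + (pairCount p q c m : ℤ) := by
    unfold label
    rw [hk, slot_succ hm, add_sub_cancel_right,
      Int.ediv_eq_zero_of_lt (by omega) (by exact_mod_cast hm), mul_zero, add_zero, add_comm]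
  rw [hlab, freshLabel, usedLabels_eq hc hm]
  split_ifs with h
  · rw [Set.Icc_eq_empty_iff] at h
    omega
  · rw [Set.Icc_eq_empty_iff, not_not] at h
    rw [csSup_Icc h]

theorem assign_relabel {c : ℤ → ClanSymbol} (hc : IsAffineClan p q c) (s : ClanState) {i k : ℤ} :
    assign (p + q) s i (relabel p q c i) k =
      if slot p q k = slot p q i then some (relabel p q c k) else s k := by
  classical
  unfold assign
  by_cases h : slot p q k = slot p q i
  · have h' := slot_eq_iff.mp h
    obtain ⟨t, ht⟩ := h'
    rw [if_pos h, if_pos (slot_eq_iff.mp h), ht, mul_comm, ← hc.relabel_add_mul, mul_comm, ← ht,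
      add_sub_cancel]
  · rw [if_neg h, if_neg fun h' => h (slot_eq_iff.mpr h')]

/-- Whether a position is a closer, and the class of its mate, only depend on its class
modulo `n`. -/
theorem IsAffineClan.lt_mate_congr {c : ℤ → ClanSymbol} (hc : IsAffineClan p q c) {a b : ℤ}
    (hab : slot p q a = slot p q b) : (mate c a < a ↔ mate c b < b) ∧
      slot p q (mate c a) = slot p q (mate c b) := by
  obtain ⟨t, ht⟩ := slot_eq_iff.mp hab
  obtain rfl : a = b + t * (p + q : ℕ) := by linarith
  rw [hc.mate_add_mul, slot_add_mul]
  exact ⟨add_lt_add_iff_right _, rfl⟩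

/-- The step at a position that is not an opener only affects the class of this position. -/
theorem determined_succ_iff_of_not_opener {c : ℤ → ClanSymbol} (hc : IsAffineClan p q c) {m : ℕ}
    (hm : m < p + q) (h : ¬ (m + 1 : ℤ) < mate c (m + 1)) (k : ℤ) :
    Determined p q c (m + 1) k ↔ Determined p q c m k ∨ slot p q k = slot p q (m + 1) := by
  rw [determined_succ_iff, slot_succ hm]
  refine or_congr_right (or_iff_left ?_)
  rintro ⟨h1, h2⟩
  obtain ⟨t, ht⟩ := slot_eq_iff.mp (h2.trans (slot_succ hm).symm)
  have h4 : mate c k = m + 1 + t * (p + q : ℕ) := by linarith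
  have h5 := congrArg (mate c) h4
  rw [hc.mate_mate, hc.mate_add_mul] at h5
  omega

/-- The step at an opener affects its class and that of its mate. -/
theorem determined_succ_iff_of_opener {c : ℤ → ClanSymbol} (hc : IsAffineClan p q c) {m : ℕ}
    (hm : m < p + q) (h : (m + 1 : ℤ) < mate c (m + 1)) (k : ℤ) :
    Determined p q c (m + 1) k ↔ (Determined p q c m k ∨ slot p q k = slot p q (mate c (m + 1))) ∨
      slot p q k = slot p q (m + 1) := by
  have hi := slot_succ (p := p) (q := q) hm
  rw [determined_succ_iff, hi, or_assoc, or_comm (a := slot p q k = m)]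
  refine or_congr_right (or_congr_left ?_)
  constructor
  · rintro ⟨-, h'⟩
    have h2 := (hc.lt_mate_congr (h'.trans hi.symm)).2
    rwa [hc.mate_mate] at h2
  · intro h'
    have h2 := hc.lt_mate_congr h'
    rw [hc.mate_mate] at h2
    exact ⟨h2.1.mpr h, h2.2.trans hi⟩

theorem assign_partialRelabel_of_not_opener {c : ℤ → ClanSymbol} (hc : IsAffineClan p q c) {m : ℕ}
    (hm : m < p + q) (h : ¬ (m + 1 : ℤ) < mate c (m + 1)) {x : ClanSymbol}
    (hx : relabel p q c (m + 1) = x) :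
    assign (p + q) (partialRelabel p q c m) (m + 1) x = partialRelabel p q c (m + 1) := by
  subst hx
  funext k
  rw [assign_relabel hc]
  exact partialRelabel_extend (determined_succ_iff_of_not_opener hc hm h k)

/-- One step of the procedure for a flag in normal form. -/
theorem clanStep_partialRelabel {c : ℤ → ClanSymbol} (hc : IsAffineClan p q c) {B : PBasis 𝕜 p q}
    (hB : IsNormal c B) {m : ℕ} (hm : m < p + q) :
    clanStep (flagOf B) (partialRelabel p q c m) (m + 1) = partialRelabel p q c (m + 1) := by
  have hi := slot_succ (p := p) (q := q) hm
  have hnot : Determined p q c m (m + 1) ↔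
      mate c (m + 1) < m + 1 ∧ slot p q (mate c (m + 1)) < m := by
    unfold Determined
    rw [hi]
    exact or_iff_right (lt_irrefl m)
  by_cases hdi : Determined p q c m (m + 1)
  · have hcl := hnot.mp hdi
    simp only [clanStep, partialRelabel_of_determined hdi]
    funext k
    have hiff : Determined p q c (m + 1) k ↔ Determined p q c m k ∨ False := by
      rw [determined_succ_iff_of_not_opener hc hm (by omega), or_false, or_iff_left_iff_imp]
      intro h
      have h2 := hc.lt_mate_congr h
      refine Or.inr ⟨h2.1.mpr hcl.1, ?_⟩
      rw [h2.2]
      exact hcl.2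
    rw [← partialRelabel_extend hiff, if_neg not_false]
  · simp only [clanStep, partialRelabel_of_not_determined hdi]
    rcases hc.kind_cases (m + 1) with h | h | h | h
    · rw [hB.dimPlus_eq_one (Or.inr h.1), hB.dimMinus_eq_zero hc (Or.inr h.1), if_pos (by simp)]
      exact assign_partialRelabel_of_not_opener hc hm (by omega) (relabel_plus_iff.mpr h.1)
    · rw [hB.dimPlus_eq_zero hc (Or.inr h.1), hB.dimMinus_eq_one (Or.inr h.1),
        if_neg (by simp), if_pos (by simp)]
      exact assign_partialRelabel_of_not_opener hc hm (by omega) (relabel_minus_iff.mpr h.1)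
    · have hne := hc.slot_mate_ne h.ne'
      have hne' : mate c (mate c (m + 1)) ≠ mate c (m + 1) := by rw [hc.mate_mate]; exact h.ne
      have heq : relabel p q c (mate c (m + 1)) = relabel p q c (m + 1) := by
        rw [hc.relabel_of_mate_ne h.ne', hc.relabel_of_mate_ne hne', hc.label_mate]
      rw [hB.dimPlus_eq_one (Or.inl h), hB.dimMinus_eq_one (Or.inl h), if_neg (by simp),
        if_neg (by simp), if_neg (by simp), if_pos (by simp), hB.partner_eq hc h]
      by_cases hdj : Determined p q c m (mate c (m + 1))
      · have hj : slot p q (mate c (m + 1)) < m := by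
          rcases hdj with h' | h'
          · exact h'
          · rw [hc.mate_mate, hi] at h'
            omega
        simp only [partialRelabel_of_determined hdj]
        rw [heq]
        funext k
        rw [assign_relabel hc]
        refine partialRelabel_extend ?_
        rw [determined_succ_iff_of_opener hc hm h, or_iff_left_of_imp
          (a := Determined p q c m k) fun h' => .of_slot_lt (h'.trans_lt hj)]
      · have hj : ¬ slot p q (mate c (m + 1)) < m := fun h' => hdj (Or.inl h')
        have hlead : leader p q c (m + 1) = m + 1 := if_pos (by omega)
        simp only [partialRelabel_of_not_determined hdj]
        rw [freshLabel_eq hc hm hlead, ← hc.relabel_of_mate_ne h.ne']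
        funext k
        rw [assign_relabel hc, ← heq, assign_relabel hc]
        have hiff := determined_succ_iff_of_opener hc hm h k
        unfold partialRelabel
        split_ifs <;> first | rfl | (exfalso; tauto)
    · have hne := hc.slot_mate_ne h.ne
      have hj : ¬ slot p q (mate c (m + 1)) < m := fun h' => hdi (hnot.mpr ⟨h, h'⟩)
      have hlead : leader p q c (m + 1) = m + 1 := if_pos (by omega)
      rw [hB.dimPlus_eq_zero hc (Or.inl h), hB.dimMinus_eq_zero hc (Or.inl h),
        if_neg (by simp), if_neg (by simp), if_pos (by simp), freshLabel_eq hc hm hlead]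
      exact assign_partialRelabel_of_not_opener hc hm (by omega) (hc.relabel_of_mate_ne h.ne)

theorem clanState_eq {c : ℤ → ClanSymbol} (hc : IsAffineClan p q c) {B : PBasis 𝕜 p q}
    (hB : IsNormal c B) {m : ℕ} (hm : m ≤ p + q) :
    clanState (flagOf B) m = partialRelabel p q c m := by
  induction m with
  | zero =>
    funext k
    exact (partialRelabel_of_not_determined (by simp [Determined])).symm
  | succ m ih =>
    change clanStep (flagOf B) (clanState (flagOf B) m) (m + 1) = _
    rw [ih (by omega), clanStep_partialRelabel hc hB (by omega)]

theorem isClanSequenceOf_relabel {c : ℤ → ClanSymbol} (hc : IsAffineClan p q c)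
    {B : PBasis 𝕜 p q} (hB : IsNormal c B) : IsClanSequenceOf (flagOf B) (relabel p q c) := by
  intro k
  rw [clanState_eq hc hB le_rfl]
  exact partialRelabel_of_determined (.of_slot_lt (slot_lt k))

theorem IsNormal.relabel {c : ℤ → ClanSymbol} (hc : IsAffineClan p q c) {B : PBasis 𝕜 p q}
    (hB : IsNormal c B) : IsNormal (relabel p q c) B where
  plus i h := hB.plus i (relabel_plus_iff.mp h)
  minus i h := hB.minus i (relabel_minus_iff.mp h)
  opener := by
    rw [hc.mate_relabel]
    exact hB.opener
  closer := by
    rw [hc.mate_relabel]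
    exact hB.closer

end

/-! ### Existence of normal forms -/

namespace AffineFlag

variable (Λ : AffineFlag 𝕜 p q)

/-- The filtration of `W` by the lattices of the flag jumps at `i`. -/
def Jump (W : Sub 𝕜 p q) (i : ℤ) : Prop := ∃ v ∈ Λ.lat i ⊓ W, v ∉ Λ.lat (i + 1)

/-- Some vectors of `V₊` and `V₋` that lead `Λ_i` agree modulo `Λ_j`. -/
def Agree (i j : ℤ) : Prop :=
  ∃ v ∈ Λ.lat i ⊓ Vplus 𝕜 p q, ∃ w ∈ Vminus 𝕜 p q, v ∉ Λ.lat (i + 1) ∧ v - w ∈ Λ.lat j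

theorem tpow_smul_mem_lat_succ {i : ℤ} {v : Vec 𝕜 p q} (k : ℤ) :
    tpow 𝕜 k • v ∈ Λ.lat (i + k * (p + q : ℕ) + 1) ↔ v ∈ Λ.lat (i + 1) := by
  rw [add_right_comm, tpow_smul_mem_lat]

theorem Jump.add_mul {Λ : AffineFlag 𝕜 p q} {W : Sub 𝕜 p q}
    (hW : ∀ (f : LaurentSeries 𝕜), ∀ v ∈ W, f • v ∈ W) {i : ℤ} (h : Λ.Jump W i) (k : ℤ) :
    Λ.Jump W (i + k * (p + q : ℕ)) := by
  obtain ⟨v, ⟨hv, hv'⟩, hv''⟩ := h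
  exact ⟨tpow 𝕜 k • v, ⟨(Λ.tpow_smul_mem_lat k).mpr hv, hW _ _ hv'⟩,
    fun h => hv'' ((Λ.tpow_smul_mem_lat_succ k).mp h)⟩

theorem jump_add_mul_iff {W : Sub 𝕜 p q}
    (hW : ∀ (f : LaurentSeries 𝕜), ∀ v ∈ W, f • v ∈ W) {i : ℤ} (k : ℤ) :
    Λ.Jump W (i + k * (p + q : ℕ)) ↔ Λ.Jump W i := by
  refine ⟨fun h => ?_, fun h => h.add_mul hW k⟩
  have := h.add_mul hW (-k)
  rwa [show i + k * ((p + q : ℕ) : ℤ) + -k * (p + q : ℕ) = i by ring] at this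

theorem Agree.add_mul {Λ : AffineFlag 𝕜 p q} {i j : ℤ} (h : Λ.Agree i j) (k : ℤ) :
    Λ.Agree (i + k * (p + q : ℕ)) (j + k * (p + q : ℕ)) := by
  obtain ⟨v, ⟨hv, hv'⟩, w, hw, hv'', hvw⟩ := h
  refine ⟨tpow 𝕜 k • v, ⟨(Λ.tpow_smul_mem_lat k).mpr hv, smul_mem_Vplus _ _ hv'⟩, tpow 𝕜 k • w,
    smul_mem_Vminus _ _ hw, fun h => hv'' ((Λ.tpow_smul_mem_lat_succ k).mp h), ?_⟩
  rw [← smul_sub]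
  exact (Λ.tpow_smul_mem_lat k).mpr hvw

theorem agree_add_mul_iff {i j : ℤ} (k : ℤ) :
    Λ.Agree (i + k * (p + q : ℕ)) (j + k * (p + q : ℕ)) ↔ Λ.Agree i j := by
  refine ⟨fun h => ?_, fun h => h.add_mul k⟩
  have := h.add_mul (-k)
  rwa [show i + k * ((p + q : ℕ) : ℤ) + -k * (p + q : ℕ) = i by ring,
    show j + k * ((p + q : ℕ) : ℤ) + -k * (p + q : ℕ) = j by ring] at this

theorem Agree.mono {Λ : AffineFlag 𝕜 p q} {i j j' : ℤ} (h : Λ.Agree i j) (hj : j' ≤ j) :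
    Λ.Agree i j' := by
  obtain ⟨v, hv, w, hw, hv', hvw⟩ := h
  exact ⟨v, hv, w, hw, hv', Λ.lat_anti hj hvw⟩

theorem agree_succ {i : ℤ} (h1 : Λ.Jump (Vplus 𝕜 p q) i) (h2 : Λ.Jump (Vminus 𝕜 p q) i) :
    Λ.Agree i (i + 1) := by
  obtain ⟨v, hv, hv'⟩ := h1
  obtain ⟨w, hw, hw'⟩ := h2
  obtain ⟨a, ha⟩ := Λ.exists_sub_smul_mem hw.1 hw' hv.1
  refine ⟨v, hv, a • w, ?_, hv', ha⟩
  rw [const_smul_vec_eq]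
  exact smul_mem_Vminus _ _ hw.2

/-- Both `V₊` and `V₋` jump at `i`. -/
def Opens (i : ℤ) : Prop := Λ.Jump (Vplus 𝕜 p q) i ∧ Λ.Jump (Vminus 𝕜 p q) i

/-- Neither `V₊` nor `V₋` jumps at `i`. -/
def Closes (i : ℤ) : Prop := ¬ Λ.Jump (Vplus 𝕜 p q) i ∧ ¬ Λ.Jump (Vminus 𝕜 p q) i

theorem opens_add_mul_iff {i : ℤ} (k : ℤ) : Λ.Opens (i + k * (p + q : ℕ)) ↔ Λ.Opens i :=
  and_congr (Λ.jump_add_mul_iff smul_mem_Vplus k) (Λ.jump_add_mul_iff smul_mem_Vminus k)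

theorem closes_add_mul_iff {i : ℤ} (k : ℤ) : Λ.Closes (i + k * (p + q : ℕ)) ↔ Λ.Closes i :=
  and_congr (Λ.jump_add_mul_iff smul_mem_Vplus k).not
    (Λ.jump_add_mul_iff smul_mem_Vminus k).not

theorem not_opens_of_closes {i : ℤ} (h : Λ.Closes i) : ¬ Λ.Opens i := fun h' => h.1 h'.1

/-- The largest `j` such that leading vectors of `V₊` and `V₋` at `i` agree modulo `Λ_j`. -/
def reach (i : ℤ) : ℤ :=
  Classical.epsilon fun j => Λ.Agree i j ∧ ∀ j', Λ.Agree i j' → j' ≤ j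

section

variable [NeZero (p + q)]

theorem exists_tpow_smul_mem_of_fg {M : Sub 𝕜 p q} (hM : M.FG) (i : ℤ) :
    ∃ k : ℤ, ∀ v ∈ M, tpow 𝕜 k • v ∈ Λ.lat i := by
  have hmono : ∀ (v : Vec 𝕜 p q) (k l : ℤ), k ≤ l → tpow 𝕜 k • v ∈ Λ.lat i →
      tpow 𝕜 l • v ∈ Λ.lat i := by
    intro v k l hkl h
    obtain ⟨m, rfl⟩ := Int.le.dest hkl
    clear hkl
    induction m with
    | zero => simpa using h
    | succ m ih =>
      rw [Nat.cast_succ, ← add_assoc, add_comm, tpow_add, mul_smul, ← X_smul_vec_eq]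
      exact Submodule.smul_mem _ _ ih
  obtain ⟨S, rfl⟩ := hM
  choose k hk using Λ.exists_tpow_smul_mem i
  obtain ⟨C, hC⟩ := (S.image k).bddAbove
  refine ⟨C, fun v hv => ?_⟩
  induction hv using Submodule.span_induction with
  | mem v hv =>
    exact hmono v _ _ (hC (Finset.mem_coe.mpr (Finset.mem_image_of_mem k hv))) (hk v)
  | zero => simp
  | add v w _ _ hv hw =>
    rw [smul_add]
    exact Submodule.add_mem _ hv hw
  | smul a v _ hv =>
    rw [smul_vec_eq, smul_comm, ← smul_vec_eq]
    exact Submodule.smul_mem _ _ hv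

/-- Vectors of `V₊` and `V₋` cannot agree too far: `π₊` recovers the first from the difference, and
`π₊` maps small lattices to small lattices. -/
theorem exists_not_agree (i : ℤ) : ∃ N : ℤ, ∀ j, Λ.Agree i j → j ≤ N := by
  obtain ⟨k, hk⟩ := Λ.exists_tpow_smul_mem_of_fg ((Λ.lat_fg i).map (projPlus 𝕜 p q)) (i + 1)
  refine ⟨i + k * (p + q : ℕ), fun j hj => ?_⟩
  by_contra hlt
  obtain ⟨v, hv, w, hw, hv', hvw⟩ := hj.mono (not_le.mp hlt).le
  apply hv'
  have h1 : projPlus 𝕜 p q (v - w) = v := by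
    rw [map_sub, mem_Vplus_iff.mp hv.2, mem_Vminus_iff.mp hw, sub_zero]
  have h2 : v - w = tpow 𝕜 k • tpow 𝕜 (-k) • (v - w) := by
    rw [smul_smul, ← tpow_add, add_neg_cancel, tpow_zero, one_smul]
  rw [← h1, h2, projPlus_smul]
  rw [h2, tpow_smul_mem_lat] at hvw
  exact hk _ ⟨_, hvw, rfl⟩

theorem exists_reach {i : ℤ} (h : Λ.Opens i) :
    ∃ j, Λ.Agree i j ∧ ∀ j', Λ.Agree i j' → j' ≤ j :=
  Int.exists_greatest_of_bdd (Λ.exists_not_agree i) ⟨_, Λ.agree_succ h.1 h.2⟩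

theorem agree_reach {i : ℤ} (h : Λ.Opens i) : Λ.Agree i (Λ.reach i) :=
  (Classical.epsilon_spec (Λ.exists_reach h)).1

theorem le_reach {i j : ℤ} (h : Λ.Opens i) (hj : Λ.Agree i j) : j ≤ Λ.reach i :=
  (Classical.epsilon_spec (Λ.exists_reach h)).2 j hj

theorem lt_reach {i : ℤ} (h : Λ.Opens i) : i < Λ.reach i :=
  Λ.le_reach h (Λ.agree_succ h.1 h.2)

theorem not_agree_reach_succ {i : ℤ} (h : Λ.Opens i) : ¬ Λ.Agree i (Λ.reach i + 1) := fun h' => by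
  have := Λ.le_reach h h'
  omega

theorem reach_add_mul {i : ℤ} (h : Λ.Opens i) (k : ℤ) :
    Λ.reach (i + k * (p + q : ℕ)) = Λ.reach i + k * (p + q : ℕ) := by
  have h' := (Λ.opens_add_mul_iff k).mpr h
  refine le_antisymm ?_ (Λ.le_reach h' ((Λ.agree_reach h).add_mul k))
  have h1 := Λ.agree_reach h'
  rw [← sub_add_cancel (Λ.reach (i + k * (p + q : ℕ))) (k * (p + q : ℕ)),
    agree_add_mul_iff] at h1
  have := Λ.le_reach h h1
  linarith

/-- A jump at `reach i` would allow a correction of the leading vectors that makes them agree even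
further. -/
theorem closes_reach {i : ℤ} (h : Λ.Opens i) : Λ.Closes (Λ.reach i) := by
  obtain ⟨v, hv, w, hw, hv', hvw⟩ := Λ.agree_reach h
  have hlt := Λ.lt_reach h
  constructor
  · rintro ⟨u, hu, hu'⟩
    obtain ⟨a, ha⟩ := Λ.exists_sub_smul_mem hu.1 hu' hvw
    have hau : a • u ∈ Λ.lat (i + 1) := const_smul_mem a (Λ.lat_anti (by omega) hu.1)
    refine Λ.not_agree_reach_succ h ⟨v - a • u, ⟨Submodule.sub_mem _ hv.1
      (Λ.succ_le i hau), Submodule.sub_mem _ hv.2 (const_smul_mem a hu.2)⟩, w, hw, fun h' => ?_, ?_⟩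
    · exact hv' ((Submodule.sub_mem_iff_left _ hau).mp h')
    · rwa [sub_right_comm]
  · rintro ⟨u, hu, hu'⟩
    obtain ⟨a, ha⟩ := Λ.exists_sub_smul_mem hu.1 hu' hvw
    refine Λ.not_agree_reach_succ h ⟨v, hv, w + a • u,
      Submodule.add_mem _ hw (const_smul_mem a hu.2), hv', ?_⟩
    rwa [← sub_sub]

theorem reach_injOn {i i' : ℤ} (h : Λ.Opens i) (h' : Λ.Opens i') (heq : Λ.reach i = Λ.reach i') :
    i = i' := by
  have key : ∀ {i i' : ℤ}, Λ.Opens i → Λ.Opens i' → Λ.reach i = Λ.reach i' → ¬ i < i' := by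
    intro i i' h h' heq hlt
    obtain ⟨v, hv, w, hw, hv', hvw⟩ := Λ.agree_reach h
    obtain ⟨x, hx, y, hy, hx', hxy⟩ := Λ.agree_reach h'
    have hxy' : x - y ∉ Λ.lat (Λ.reach i' + 1) := fun h1 =>
      Λ.not_agree_reach_succ h' ⟨x, hx, y, hy, hx', h1⟩
    rw [heq] at hvw
    obtain ⟨a, ha⟩ := Λ.exists_sub_smul_mem hxy hxy' hvw
    have hax : a • x ∈ Λ.lat (i + 1) := const_smul_mem a (Λ.lat_anti (by omega) hx.1)
    refine Λ.not_agree_reach_succ h ⟨v - a • x, ⟨Submodule.sub_mem _ hv.1 (Λ.succ_le i hax),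
      Submodule.sub_mem _ hv.2 (const_smul_mem a hx.2)⟩, w - a • y,
      Submodule.sub_mem _ hw (const_smul_mem a hy), fun h1 => ?_, ?_⟩
    · exact hv' ((Submodule.sub_mem_iff_left _ hax).mp h1)
    · rw [heq]
      rw [smul_sub] at ha
      convert ha using 1
      abel
  rcases lt_trichotomy i i' with h1 | h1 | h1
  exacts [absurd h1 (key h h' heq), h1, absurd h1 (key h' h heq.symm)]

/-- The dimension of an `F`-subspace bounds the number of jumps in a period from below. -/
theorem card_le_card_jump {ι : Type*} [Fintype ι] {W : Sub 𝕜 p q}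
    (hW : ∀ (f : LaurentSeries 𝕜), ∀ v ∈ W, f • v ∈ W)
    (ρ : Vec 𝕜 p q →ₗ[LaurentSeries 𝕜] (ι → LaurentSeries 𝕜)) (hρ : ∀ x, ∃ v ∈ W, ρ v = x) :
    Fintype.card ι ≤ (period p q (Λ.Jump W)).card := by
  classical
  choose! e he he' using fun i (hi : Λ.Jump W i) => hi
  have hspan : ∀ v ∈ W, v ∈ Submodule.span (LaurentSeries 𝕜)
      (e '' {k | k ∈ {k | Λ.Jump W k} ∧ 1 ≤ k ∧ k < 1 + (p + q : ℕ)}) := fun v hv =>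
    Λ.mem_span_of_leading hW (fun k hk => ⟨he k hk, he' k hk⟩)
      (fun k hk w hw => by
        by_contra h
        exact hk ⟨w, hw, h⟩) 1 hv
  have htop : Submodule.span (LaurentSeries 𝕜)
      (((period p q (Λ.Jump W)).image (ρ ∘ e) : Finset _) : Set (ι → LaurentSeries 𝕜)) = ⊤ := by
    rw [eq_top_iff]
    rintro x -
    obtain ⟨v, hv, rfl⟩ := hρ x
    have h1 := Submodule.mem_map_of_mem (f := ρ) (hspan v hv)
    rw [Submodule.map_span] at h1
    refine Submodule.span_mono ?_ h1
    rintro _ ⟨_, ⟨k, ⟨hk1, hk2, hk3⟩, rfl⟩, rfl⟩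
    rw [Finset.mem_coe, Finset.mem_image]
    exact ⟨k, mem_period.mpr ⟨⟨hk2, by omega⟩, hk1⟩, rfl⟩
  have h1 := finrank_span_finset_le_card (R := LaurentSeries 𝕜)
    ((period p q (Λ.Jump W)).image (ρ ∘ e))
  rw [Set.finrank, htop, finrank_top, Module.finrank_fintype_fun_eq_card] at h1
  exact h1.trans Finset.card_image_le

theorem le_card_jump_plus : p ≤ (period p q (Λ.Jump (Vplus 𝕜 p q))).card := by
  have := Λ.card_le_card_jump smul_mem_Vplus
    (LinearMap.funLeft (LaurentSeries 𝕜) (LaurentSeries 𝕜) Sum.inl)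
    fun x => ⟨Sum.elim x 0, fun _ => rfl, rfl⟩
  rwa [Fintype.card_fin] at this

theorem le_card_jump_minus : q ≤ (period p q (Λ.Jump (Vminus 𝕜 p q))).card := by
  have := Λ.card_le_card_jump smul_mem_Vminus
    (LinearMap.funLeft (LaurentSeries 𝕜) (LaurentSeries 𝕜) Sum.inr)
    fun x => ⟨Sum.elim 0 x, fun _ => rfl, rfl⟩
  rwa [Fintype.card_fin] at this

end

/-- The opener whose pair closes at `j`. -/
def opener (j : ℤ) : ℤ := Classical.epsilon fun i => Λ.Opens i ∧ Λ.reach i = j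

open scoped Classical in
/-- The clan of a flag, with every pair labelled by its opener. -/
def openerClan (i : ℤ) : ClanSymbol :=
  if Λ.Opens i then .num i else if Λ.Closes i then .num (Λ.opener i)
  else if Λ.Jump (Vplus 𝕜 p q) i then .plus else .minus

theorem openerClan_plus_iff {i : ℤ} : Λ.openerClan i = .plus ↔
    Λ.Jump (Vplus 𝕜 p q) i ∧ ¬ Λ.Jump (Vminus 𝕜 p q) i := by
  unfold openerClan Opens Closes
  split_ifs <;> simp <;> tauto

theorem openerClan_minus_iff {i : ℤ} : Λ.openerClan i = .minus ↔
    Λ.Jump (Vminus 𝕜 p q) i ∧ ¬ Λ.Jump (Vplus 𝕜 p q) i := by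
  unfold openerClan Opens Closes
  split_ifs <;> simp <;> tauto

theorem card_closes_add :
    (period p q Λ.Closes).card + ((period p q (Λ.Jump (Vplus 𝕜 p q))).card +
      (period p q (Λ.Jump (Vminus 𝕜 p q))).card) = (period p q Λ.Opens).card + (p + q) := by
  classical
  have h1 : period p q Λ.Opens =
      period p q (Λ.Jump (Vplus 𝕜 p q)) ∩ period p q (Λ.Jump (Vminus 𝕜 p q)) := by
    ext i
    simp only [mem_period, Finset.mem_inter, Opens]
    tauto
  have h2 : period p q Λ.Closes = Finset.Icc 1 ((p + q : ℕ) : ℤ) \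
      (period p q (Λ.Jump (Vplus 𝕜 p q)) ∪ period p q (Λ.Jump (Vminus 𝕜 p q))) := by
    ext i
    simp only [mem_period, Finset.mem_sdiff, Finset.mem_union, Finset.mem_Icc, Closes]
    tauto
  have h3 : period p q (Λ.Jump (Vplus 𝕜 p q)) ∪ period p q (Λ.Jump (Vminus 𝕜 p q)) ⊆
      Finset.Icc 1 ((p + q : ℕ) : ℤ) :=
    Finset.union_subset (Finset.filter_subset _ _) (Finset.filter_subset _ _)
  have h4 := Finset.card_union_add_card_inter (period p q (Λ.Jump (Vplus 𝕜 p q)))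
    (period p q (Λ.Jump (Vminus 𝕜 p q)))
  have h5 := Finset.card_sdiff_add_card_eq_card h3
  rw [← h1] at h4
  rw [← h2, Int.card_Icc] at h5
  omega

variable [NeZero (p + q)]

/-- The translate of `reach i` in the window `1, …, n`. -/
def reachSlot (i : ℤ) : ℤ := slot p q (Λ.reach i) + 1

theorem reachSlot_mapsTo :
    ∀ i ∈ period p q Λ.Opens, Λ.reachSlot i ∈ period p q Λ.Closes := by
  intro i hi
  have h := Λ.closes_reach (mem_period.mp hi).2
  have h1 := slot_lt (p := p) (q := q) (Λ.reach i)
  rw [← slot_add (p := p) (q := q) (Λ.reach i), mul_comm, closes_add_mul_iff] at h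
  exact mem_period.mpr ⟨by unfold reachSlot; omega, h⟩

theorem reachSlot_injOn : Set.InjOn Λ.reachSlot (period p q Λ.Opens : Set ℤ) := by
  intro i hi i' hi' h
  obtain ⟨hi1, hi2⟩ := mem_period.mp hi
  obtain ⟨hi1', hi2'⟩ := mem_period.mp hi'
  have h1 : slot p q (Λ.reach i) = slot p q (Λ.reach i') := by
    unfold reachSlot at h
    omega
  obtain ⟨t, ht⟩ := slot_eq_iff.mp h1
  have h2 : Λ.reach i = Λ.reach (i' + t * (p + q : ℕ)) := by
    rw [Λ.reach_add_mul hi2']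
    linarith
  have h3 := Λ.reach_injOn hi2 ((Λ.opens_add_mul_iff t).mpr hi2') h2
  exact eq_of_window hi1 hi1' h3

/-- Comparing the number of jumps with the dimensions of `V₊`, `V₋` and `V` shows that there are
as many openers as closers in a period, and that the lower bounds for the number of jumps are
sharp. -/
theorem card_jump :
    (period p q (Λ.Jump (Vplus 𝕜 p q))).card = p ∧
      (period p q (Λ.Jump (Vminus 𝕜 p q))).card = q ∧
      (period p q Λ.Closes).card = (period p q Λ.Opens).card := by
  have h1 := Finset.card_le_card_of_injOn _ Λ.reachSlot_mapsTo Λ.reachSlot_injOn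
  have h2 := Λ.le_card_jump_plus
  have h3 := Λ.le_card_jump_minus
  have h4 := Λ.card_closes_add
  omega

theorem exists_reach_eq {j : ℤ} (hj : Λ.Closes j) : ∃ i, Λ.Opens i ∧ Λ.reach i = j := by
  obtain ⟨j₀, k, hj₀, rfl⟩ := exists_window (Nat.pos_of_ne_zero (NeZero.ne (p + q))) j
  rw [closes_add_mul_iff] at hj
  obtain ⟨i, hi, hij⟩ := Finset.surjOn_of_injOn_of_card_le _ Λ.reachSlot_mapsTo Λ.reachSlot_injOn
    Λ.card_jump.2.2.le (Finset.mem_coe.mpr (mem_period.mpr ⟨hj₀, hj⟩))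
  have hi' := (mem_period.mp hi).2
  have h := slot_add (p := p) (q := q) (Λ.reach i)
  refine ⟨i + (k - (Λ.reach i - 1) / (p + q : ℕ)) * (p + q : ℕ),
    (Λ.opens_add_mul_iff _).mpr hi', ?_⟩
  rw [Λ.reach_add_mul hi']
  unfold reachSlot at hij
  linarith

theorem opens_opener {j : ℤ} (hj : Λ.Closes j) : Λ.Opens (Λ.opener j) :=
  (Classical.epsilon_spec (Λ.exists_reach_eq hj)).1

theorem reach_opener {j : ℤ} (hj : Λ.Closes j) : Λ.reach (Λ.opener j) = j :=
  (Classical.epsilon_spec (Λ.exists_reach_eq hj)).2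

theorem opener_reach {i : ℤ} (hi : Λ.Opens i) : Λ.opener (Λ.reach i) = i :=
  Λ.reach_injOn (Λ.opens_opener (Λ.closes_reach hi)) hi (Λ.reach_opener (Λ.closes_reach hi))

theorem opener_add_mul {j : ℤ} (hj : Λ.Closes j) (k : ℤ) :
    Λ.opener (j + k * (p + q : ℕ)) = Λ.opener j + k * (p + q : ℕ) := by
  have h := Λ.opens_opener hj
  rw [← Λ.opener_reach ((Λ.opens_add_mul_iff k).mpr h), Λ.reach_add_mul h, Λ.reach_opener hj]

theorem openerClan_num_iff {i a : ℤ} :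
    Λ.openerClan i = .num a ↔ Λ.Opens a ∧ (i = a ∨ i = Λ.reach a) := by
  unfold openerClan
  split_ifs with h1 h2 h3
  · rw [ClanSymbol.num.injEq]
    constructor
    · rintro rfl
      exact ⟨h1, Or.inl rfl⟩
    · rintro ⟨h, rfl | rfl⟩
      · rfl
      · exact absurd h1 (Λ.not_opens_of_closes (Λ.closes_reach h))
  · rw [ClanSymbol.num.injEq]
    constructor
    · rintro rfl
      exact ⟨Λ.opens_opener h2, Or.inr (Λ.reach_opener h2).symm⟩
    · rintro ⟨h, rfl | rfl⟩
      · exact absurd h h1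
      · exact Λ.opener_reach h
  all_goals
    refine iff_of_false (by simp) ?_
    rintro ⟨h, rfl | rfl⟩
    · exact h1 h
    · exact h2 (Λ.closes_reach h)

theorem isAffineClan_openerClan : IsAffineClan p q Λ.openerClan where
  periodic i k := by
    unfold openerClan
    rw [opens_add_mul_iff, closes_add_mul_iff, jump_add_mul_iff _ smul_mem_Vplus]
    split_ifs with h1 h2
    · rfl
    · rw [Λ.opener_add_mul h2]
      rfl
    · rfl
    · rfl
  signs := by
    classical
    have h1 : {i : ℤ | 1 ≤ i ∧ i ≤ (p + q : ℕ) ∧ Λ.openerClan i = .plus} =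
        ((period p q (Λ.Jump (Vplus 𝕜 p q)) \ period p q (Λ.Jump (Vminus 𝕜 p q)) : Finset ℤ) :
          Set ℤ) := by
      ext i
      simp only [Set.mem_ofPred_eq, Finset.mem_coe, Finset.mem_sdiff, mem_period,
        openerClan_plus_iff]
      tauto
    have h2 : {i : ℤ | 1 ≤ i ∧ i ≤ (p + q : ℕ) ∧ Λ.openerClan i = .minus} =
        ((period p q (Λ.Jump (Vminus 𝕜 p q)) \ period p q (Λ.Jump (Vplus 𝕜 p q)) : Finset ℤ) :
          Set ℤ) := by
      ext i
      simp only [Set.mem_ofPred_eq, Finset.mem_coe, Finset.mem_sdiff, mem_period,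
        openerClan_minus_iff]
      tauto
    rw [h1, h2, Set.ncard_coe_finset, Set.ncard_coe_finset]
    have h3 := Finset.card_sdiff_add_card_inter (period p q (Λ.Jump (Vplus 𝕜 p q)))
      (period p q (Λ.Jump (Vminus 𝕜 p q)))
    have h4 := Finset.card_sdiff_add_card_inter (period p q (Λ.Jump (Vminus 𝕜 p q)))
      (period p q (Λ.Jump (Vplus 𝕜 p q)))
    rw [Finset.inter_comm] at h4
    have h5 := Λ.card_jump
    omega
  twice := by
    rintro a ⟨i, hi⟩
    have ha := (Λ.openerClan_num_iff.mp hi).1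
    rw [Set.ncard_eq_two]
    refine ⟨a, Λ.reach a, (Λ.lt_reach ha).ne, ?_⟩
    ext k
    simp only [Set.mem_ofPred_eq, openerClan_num_iff, Set.mem_insert_iff, Set.mem_singleton_iff]
    exact and_iff_right ha

theorem mate_openerClan {i : ℤ} (h : Λ.Opens i) : mate Λ.openerClan i = Λ.reach i :=
  (Λ.isAffineClan_openerClan.eq_mate_of_matched (Λ.lt_reach h).ne'
    ⟨i, Λ.openerClan_num_iff.mpr ⟨h, Or.inl rfl⟩, Λ.openerClan_num_iff.mpr ⟨h, Or.inr rfl⟩⟩).symm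

theorem opens_of_lt_mate {i : ℤ} (h : i < mate Λ.openerClan i) : Λ.Opens i := by
  obtain ⟨a, ha⟩ := Λ.isAffineClan_openerClan.mate_ne_iff.mp h.ne'
  obtain ⟨ha', rfl | rfl⟩ := Λ.openerClan_num_iff.mp ha
  · exact ha'
  · rw [← Λ.mate_openerClan ha', Λ.isAffineClan_openerClan.mate_mate, Λ.mate_openerClan ha'] at h
    exact absurd (Λ.lt_reach ha') h.not_gt

/-- The vectors `x.1` and `x.2` lead `Λ_i` within `V₊` and `V₋`, where there are such vectors, and
they agree as far as possible if both exist. -/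
def IsLeadingPair (i : ℤ) (x : Vec 𝕜 p q × Vec 𝕜 p q) : Prop :=
  (Λ.Jump (Vplus 𝕜 p q) i → x.1 ∈ Λ.lat i ⊓ Vplus 𝕜 p q ∧ x.1 ∉ Λ.lat (i + 1)) ∧
  (Λ.Jump (Vminus 𝕜 p q) i → x.2 ∈ Λ.lat i ⊓ Vminus 𝕜 p q ∧ x.2 ∉ Λ.lat (i + 1)) ∧
  (Λ.Opens i → x.1 - x.2 ∈ Λ.lat (Λ.reach i))

theorem exists_isLeadingPair (i : ℤ) : ∃ x, Λ.IsLeadingPair i x := by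
  by_cases h : Λ.Opens i
  · obtain ⟨v, hv, w, hw, hv', hvw⟩ := Λ.agree_reach h
    have h1 := Λ.lat_anti (Λ.lt_reach h) hvw
    have hw1 : w ∈ Λ.lat i := (Submodule.sub_mem_iff_right _ hv.1).mp (Λ.succ_le i h1)
    exact ⟨(v, w), fun _ => ⟨hv, hv'⟩,
      fun _ => ⟨⟨hw1, hw⟩, fun h2 => hv' ((Submodule.sub_mem_iff_left _ h2).mp h1)⟩, fun _ => hvw⟩
  · by_cases h1 : Λ.Jump (Vplus 𝕜 p q) i
    · obtain ⟨v, hv, hv'⟩ := h1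
      exact ⟨(v, 0), fun _ => ⟨hv, hv'⟩,
        fun h2 => absurd ⟨⟨v, hv, hv'⟩, h2⟩ h, fun h2 => absurd h2 h⟩
    · by_cases h2 : Λ.Jump (Vminus 𝕜 p q) i
      · obtain ⟨v, hv, hv'⟩ := h2
        exact ⟨(0, v), fun h3 => absurd h3 h1, fun _ => ⟨hv, hv'⟩, fun h3 => absurd h3 h⟩
      · exact ⟨0, fun h3 => absurd h3 h1, fun h3 => absurd h3 h2, fun h3 => absurd h3 h⟩

theorem IsLeadingPair.tpow_smul {Λ : AffineFlag 𝕜 p q} {i : ℤ} {x : Vec 𝕜 p q × Vec 𝕜 p q}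
    (h : Λ.IsLeadingPair i x) (k : ℤ) :
    Λ.IsLeadingPair (i + k * (p + q : ℕ)) (tpow 𝕜 k • x) := by
  obtain ⟨h1, h2, h3⟩ := h
  refine ⟨fun hj => ?_, fun hj => ?_, fun hj => ?_⟩
  · obtain ⟨⟨h4, h5⟩, h6⟩ := h1 ((Λ.jump_add_mul_iff smul_mem_Vplus k).mp hj)
    exact ⟨⟨(Λ.tpow_smul_mem_lat k).mpr h4, smul_mem_Vplus _ _ h5⟩,
      fun h => h6 ((Λ.tpow_smul_mem_lat_succ k).mp h)⟩
  · obtain ⟨⟨h4, h5⟩, h6⟩ := h2 ((Λ.jump_add_mul_iff smul_mem_Vminus k).mp hj)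
    exact ⟨⟨(Λ.tpow_smul_mem_lat k).mpr h4, smul_mem_Vminus _ _ h5⟩,
      fun h => h6 ((Λ.tpow_smul_mem_lat_succ k).mp h)⟩
  · rw [opens_add_mul_iff] at hj
    rw [Λ.reach_add_mul hj, Prod.smul_fst, Prod.smul_snd, ← smul_sub]
    exact (Λ.tpow_smul_mem_lat k).mpr (h3 hj)

theorem exists_periodic_isLeadingPair : ∃ f : ℤ → Vec 𝕜 p q × Vec 𝕜 p q,
    (∀ i, Λ.IsLeadingPair i (f i)) ∧ ∀ i, f (i + (p + q : ℕ)) = tpow 𝕜 1 • f i := by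
  choose f hf using Λ.exists_isLeadingPair
  refine ⟨fun i => tpow 𝕜 ((i - 1) / (p + q : ℕ)) • f (slot p q i + 1), fun i => ?_, fun i => ?_⟩
  · have h := (hf (slot p q i + 1)).tpow_smul ((i - 1) / (p + q : ℕ))
    rwa [mul_comm _ ((p + q : ℕ) : ℤ), slot_add] at h
  · have h := slot_add_mul (p := p) (q := q) i 1
    rw [one_mul] at h
    simp only
    rw [smul_smul, ← tpow_add, h, add_sub_right_comm, Int.add_ediv_of_dvd_right (dvd_refl _),
      Int.ediv_self (size_pos p q).ne', add_comm]

/-- Every affine flag has a basis in normal form. -/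
theorem exists_isNormal : ∃ B : PBasis 𝕜 p q, Λ = flagOf B ∧ IsNormal Λ.openerClan B := by
  classical
  obtain ⟨f, hf, hper⟩ := Λ.exists_periodic_isLeadingPair
  let e : ℤ → Vec 𝕜 p q := fun i => if Λ.Jump (Vplus 𝕜 p q) i then (f i).1
    else if Λ.Jump (Vminus 𝕜 p q) i then (f i).2
    else (f (Λ.opener i)).1 - (f (Λ.opener i)).2
  have hplus : ∀ i, Λ.Jump (Vplus 𝕜 p q) i → e i = (f i).1 := fun i h => if_pos h
  have hminus : ∀ i, ¬ Λ.Jump (Vplus 𝕜 p q) i → Λ.Jump (Vminus 𝕜 p q) i → e i = (f i).2 :=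
    fun i h h' => (if_neg h).trans (if_pos h')
  have hcloses : ∀ i, Λ.Closes i → e i = (f (Λ.opener i)).1 - (f (Λ.opener i)).2 :=
    fun i h => (if_neg h.1).trans (if_neg h.2)
  have hlead : ∀ i, e i ∈ Λ.lat i ∧ e i ∉ Λ.lat (i + 1) := by
    intro i
    by_cases h1 : Λ.Jump (Vplus 𝕜 p q) i
    · rw [hplus i h1]
      have := (hf i).1 h1
      exact ⟨this.1.1, this.2⟩
    · by_cases h2 : Λ.Jump (Vminus 𝕜 p q) i
      · rw [hminus i h1 h2]
        have := (hf i).2.1 h2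
        exact ⟨this.1.1, this.2⟩
      · have h3 := Λ.opens_opener ⟨h1, h2⟩
        have h4 := Λ.reach_opener ⟨h1, h2⟩
        obtain ⟨h5, h6, h7⟩ := hf (Λ.opener i)
        rw [hcloses i ⟨h1, h2⟩]
        refine ⟨by simpa only [h4] using h7 h3, fun h8 => ?_⟩
        refine Λ.not_agree_reach_succ h3 ⟨_, (h5 h3.1).1, _, (h6 h3.2).1.2, (h5 h3.1).2, ?_⟩
        rwa [h4]
  have heper : ∀ i, e (i + (p + q : ℕ)) = (PowerSeries.X : PowerSeries 𝕜) • e i := by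
    intro i
    have h1 := Λ.jump_add_mul_iff (i := i) smul_mem_Vplus 1
    have h2 := Λ.jump_add_mul_iff (i := i) smul_mem_Vminus 1
    rw [one_mul] at h1 h2
    rw [X_smul_vec_eq]
    by_cases h3 : Λ.Jump (Vplus 𝕜 p q) i
    · rw [hplus _ (h1.mpr h3), hplus _ h3, hper, Prod.smul_fst]
    · by_cases h4 : Λ.Jump (Vminus 𝕜 p q) i
      · rw [hminus _ (h1.not.mpr h3) (h2.mpr h4), hminus _ h3 h4, hper, Prod.smul_snd]
      · have h5 := Λ.opener_add_mul ⟨h3, h4⟩ 1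
        rw [one_mul] at h5
        rw [hcloses _ ⟨h1.not.mpr h3, h2.not.mpr h4⟩, hcloses _ ⟨h3, h4⟩, h5, hper, smul_sub,
          Prod.smul_fst, Prod.smul_snd]
  obtain ⟨B, hB, hBe⟩ :=
    Λ.exists_basis_of_leading (fun i => (hlead i).1) (fun i => (hlead i).2) heper
  have hfix : ∀ i, Λ.Jump (Vplus 𝕜 p q) i → projPlus 𝕜 p q (vec B i) = vec B i := fun i h => by
    rw [hBe, hplus i h]
    exact mem_Vplus_iff.mp ((hf i).1 h).1.2
  refine ⟨B, hB, fun i hi => hfix i (Λ.openerClan_plus_iff.mp hi).1, fun i hi => ?_,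
    fun i hi => hfix i (Λ.opens_of_lt_mate hi).1, fun i hi => ?_⟩
  · obtain ⟨h1, h2⟩ := Λ.openerClan_minus_iff.mp hi
    rw [hBe, hminus i h2 h1]
    exact mem_Vminus_iff.mp ((hf i).2.1 h1).1.2
  · have h := Λ.opens_of_lt_mate hi
    have h' := Λ.closes_reach h
    rw [Λ.mate_openerClan h, hBe, hBe, hcloses _ h', Λ.opener_reach h, map_sub, hplus i h.1,
      mem_Vplus_iff.mp ((hf i).1 h.1).1.2, mem_Vminus_iff.mp ((hf i).2.1 h.2).1.2, sub_zero]

end AffineFlag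

/-! ### Realization of clans -/

section

variable [NeZero (p + q)]

namespace IsAffineClan

variable {c : ℤ → ClanSymbol}

theorem slot_mate_injOn (hc : IsAffineClan p q c) :
    Set.InjOn (fun i => (slot p q (mate c i) : ℤ) + 1) {i : ℤ | 1 ≤ i ∧ i ≤ (p + q : ℕ)} := by
  intro i hi j hj h
  have h1 : slot p q (mate c i) = slot p q (mate c j) := by
    simp only at h
    omega
  obtain ⟨t, ht⟩ := slot_eq_iff.mp h1
  have h2 : mate c i = mate c (j + t * (p + q : ℕ)) := by
    rw [hc.mate_add_mul]
    linarith
  exact eq_of_window hi hj (hc.mate_injective h2)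

theorem card_openers_eq (hc : IsAffineClan p q c) :
    (period p q fun i => i < mate c i).card = (period p q fun i => mate c i < i).card := by
  have hcongr : ∀ i, (mate c i < mate c (mate c i) ↔
      (slot p q (mate c i) : ℤ) + 1 < mate c (slot p q (mate c i) + 1)) ∧
      (mate c (mate c i) < mate c i ↔
      mate c (slot p q (mate c i) + 1) < (slot p q (mate c i) : ℤ) + 1) := by
    intro i
    have h := slot_add (p := p) (q := q) (mate c i)
    have h1 := hc.mate_add_mul (slot p q (mate c i) + 1) ((mate c i - 1) / (p + q : ℕ))
    rw [mul_comm, h] at h1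
    constructor <;> constructor <;> intro h2 <;> omega
  have hmem : ∀ i : ℤ, 1 ≤ (slot p q (mate c i) : ℤ) + 1 ∧
      (slot p q (mate c i) : ℤ) + 1 ≤ (p + q : ℕ) := fun i => by
    have := slot_lt (p := p) (q := q) (mate c i)
    omega
  refine le_antisymm
    (Finset.card_le_card_of_injOn (fun i => (slot p q (mate c i) : ℤ) + 1) ?_ ?_)
    (Finset.card_le_card_of_injOn (fun i => (slot p q (mate c i) : ℤ) + 1) ?_ ?_)
  · intro i hi
    refine mem_period.mpr ⟨hmem i, (hcongr i).2.mp ?_⟩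
    rw [hc.mate_mate]
    exact (mem_period.mp hi).2
  · exact hc.slot_mate_injOn.mono fun i hi => (mem_period.mp hi).1
  · intro i hi
    refine mem_period.mpr ⟨hmem i, (hcongr i).1.mp ?_⟩
    rw [hc.mate_mate]
    exact (mem_period.mp hi).2
  · exact hc.slot_mate_injOn.mono fun i hi => (mem_period.mp hi).1

/-- A period of a clan contains `p` positions that are pluses or openers, and `q` positions that
are minuses or openers. -/
theorem card_plus_or_opener (hc : IsAffineClan p q c) :
    (period p q fun i => c i = .plus ∨ i < mate c i).card = p ∧
      (period p q fun i => c i = .minus ∨ i < mate c i).card = q := by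
  classical
  have hs := hc.signs
  have hset : ∀ x, {i : ℤ | 1 ≤ i ∧ i ≤ (p + q : ℕ) ∧ c i = x}.ncard =
      (period p q fun i => c i = x).card := by
    intro x
    rw [← Set.ncard_coe_finset]
    congr 1
    ext i
    simp only [Set.mem_ofPred_eq, Finset.mem_coe, mem_period]
    tauto
  rw [hset, hset] at hs
  have hor : ∀ x, (∀ i, c i = x → ¬ i < mate c i) →
      (period p q fun i => c i = x ∨ i < mate c i).card =
        (period p q fun i => c i = x).card + (period p q fun i => i < mate c i).card := by
    intro x hx
    rw [← Finset.card_union_of_disjoint]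
    · congr 1
      ext i
      simp only [mem_period, Finset.mem_union]
      tauto
    · exact Finset.disjoint_left.mpr fun i hi hi' =>
        hx i (mem_period.mp hi).2 (mem_period.mp hi').2
  have h1 := hor .plus fun i hi => by
    rw [hc.mate_eq_of_sign (Or.inl hi)]
    exact lt_irrefl i
  have h2 := hor .minus fun i hi => by
    rw [hc.mate_eq_of_sign (Or.inr hi)]
    exact lt_irrefl i
  have h3 := hc.card_openers_eq
  have h4 : (period p q fun i => c i = .plus ∨ i < mate c i).card +
      ((period p q fun i => c i = .minus).card + (period p q fun i => mate c i < i).card) =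
      p + q := by
    have h5 : (period p q fun i => c i = .minus ∨ mate c i < i).card =
        (period p q fun i => c i = .minus).card + (period p q fun i => mate c i < i).card := by
      rw [← Finset.card_union_of_disjoint]
      · congr 1
        ext i
        simp only [mem_period, Finset.mem_union]
        tauto
      · refine Finset.disjoint_left.mpr fun i hi hi' => ?_
        have h6 := (mem_period.mp hi').2
        rw [hc.mate_eq_of_sign (Or.inr (mem_period.mp hi).2)] at h6
        exact lt_irrefl i h6
    have h7 : (Finset.Icc 1 ((p + q : ℕ) : ℤ)).card = p + q := by
      rw [Int.card_Icc]
      omega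
    rw [← h5, ← h7, ← Finset.card_union_of_disjoint]
    · congr 1
      ext i
      simp only [mem_period, Finset.mem_union, Finset.mem_Icc]
      have := hc.kind_cases i
      tauto
    · refine Finset.disjoint_left.mpr fun i hi hi' => ?_
      have h8 := (mem_period.mp hi).2
      have h9 := (mem_period.mp hi').2
      rcases hc.kind_cases i with h | h | h | h
      · rw [h.1, h.2] at h9
        simp at h9
      · rw [h.1, h.2] at h8
        simp at h8
      · rcases h9 with h9 | h9
        · rw [hc.mate_eq_of_sign (Or.inr h9)] at h
          exact lt_irrefl i h
        · omega
      · rcases h8 with h8 | h8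
        · rw [hc.mate_eq_of_sign (Or.inl h8)] at h
          exact lt_irrefl i h
        · omega
  omega

end IsAffineClan

/-- Given vectors are spread periodically over the positions with a given property. -/
theorem exists_periodic_vectors {W : Sub 𝕜 p q}
    (hW : ∀ (f : LaurentSeries 𝕜), ∀ v ∈ W, f • v ∈ W) {P : ℤ → Prop} {m : ℕ}
    (hP : (period p q P).card = m) (b : Fin m → Vec 𝕜 p q) (hb : ∀ r, b r ∈ W) :
    ∃ u : ℤ → Vec 𝕜 p q, (∀ i, u i ∈ W) ∧ (∀ r, ∃ i, P i ∧ u i = b r) ∧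
      ∀ i, u (i + (p + q : ℕ)) = (PowerSeries.X : PowerSeries 𝕜) • u i := by
  classical
  let φ := Finset.equivFinOfCardEq hP
  let u₀ : ℤ → Vec 𝕜 p q := fun i => if h : i ∈ period p q P then b (φ ⟨i, h⟩) else 0
  have hu₀ : ∀ i, u₀ i ∈ W := fun i => by
    simp only [u₀]
    split_ifs
    exacts [hb _, W.zero_mem]
  refine ⟨fun i => tpow 𝕜 ((i - 1) / (p + q : ℕ)) • u₀ (slot p q i + 1),
    fun i => hW _ _ (hu₀ _), fun r => ?_, fun i => ?_⟩
  · obtain ⟨hi, hi'⟩ := mem_period.mp (φ.symm r).2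
    have h0 : (((φ.symm r : ℤ) - 1) / (p + q : ℕ)) = 0 :=
      Int.ediv_eq_zero_of_lt (by omega) (by omega)
    have h1 := slot_add (p := p) (q := q) (φ.symm r : ℤ)
    rw [h0, mul_zero, add_zero] at h1
    refine ⟨(φ.symm r : ℤ), hi', ?_⟩
    simp only
    rw [h0, h1, tpow_zero, one_smul]
    simp [u₀]
  · have h := slot_add_mul (p := p) (q := q) i 1
    rw [one_mul] at h
    simp only
    rw [X_smul_vec_eq, smul_smul, ← tpow_add, h, add_sub_right_comm,
      Int.add_ediv_of_dvd_right (dvd_refl _), Int.ediv_self (size_pos p q).ne', add_comm]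

/-- Every affine clan has a basis in normal form. -/
theorem IsAffineClan.exists_isNormal (𝕜 : Type*) [Field 𝕜] {c : ℤ → ClanSymbol}
    (hc : IsAffineClan p q c) : ∃ B : PBasis 𝕜 p q, IsNormal c B := by
  classical
  obtain ⟨x, hxW, hx, hxper⟩ := exists_periodic_vectors (𝕜 := 𝕜) smul_mem_Vplus
    hc.card_plus_or_opener.1 (fun r => Pi.single (Sum.inl r) 1) (fun r s => by simp)
  obtain ⟨y, hyW, hy, hyper⟩ := exists_periodic_vectors (𝕜 := 𝕜) smul_mem_Vminus
    hc.card_plus_or_opener.2 (fun r => Pi.single (Sum.inr r) 1) (fun r s => by simp)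
  replace hxW := fun i => mem_Vplus_iff.mp (hxW i)
  replace hyW := fun i => mem_Vminus_iff.mp (hyW i)
  let e : ℤ → Vec 𝕜 p q := fun i => if mate c i < i then x (mate c i) + y (mate c i)
    else if c i = .minus then y i else x i
  have hcl : ∀ i, mate c i < i → e i = x (mate c i) + y (mate c i) := fun i h => if_pos h
  have hpl : ∀ i, c i = .plus → e i = x i := fun i h => by
    simp [e, hc.mate_eq_of_sign (Or.inl h), h]
  have hmi : ∀ i, c i = .minus → e i = y i := fun i h => by
    simp [e, hc.mate_eq_of_sign (Or.inr h), h]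
  have hop : ∀ i, i < mate c i → e i = x i := fun i h => by
    have : c i ≠ .minus := fun h' => h.ne' (hc.mate_eq_of_sign (Or.inr h'))
    simp [e, h.le, this]
  have hop' : ∀ i, i < mate c i → e (mate c i) = x i + y i := fun i h => by
    have := hcl (mate c i) (by rwa [hc.mate_mate])
    rwa [hc.mate_mate] at this
  have heper : ∀ i, e (i + (p + q : ℕ)) = (PowerSeries.X : PowerSeries 𝕜) • e i := by
    intro i
    have h1 := hc.periodic i 1
    rw [one_mul] at h1
    rcases hc.kind_cases i with h | h | h | h
    · rw [hpl i h.1, hpl _ (by rw [h1, h.1]; rfl), hxper]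
    · rw [hmi i h.1, hmi _ (by rw [h1, h.1]; rfl), hyper]
    · rw [hop i h, hop _ (by rw [hc.mate_add_size]; omega), hxper]
    · rw [hcl i h, hcl _ (by rw [hc.mate_add_size]; omega), hc.mate_add_size, hxper, hyper,
        smul_add]
  have hmem : ∀ i, e i ∈ Submodule.span (LaurentSeries 𝕜)
      (Set.range fun r : Fin (p + q) => e (r : ℕ)) := by
    intro i
    have h := apply_add_mul_of_periodic heper (resid p q i : ℕ) (i / (p + q : ℕ))
    rw [resid_coe, mul_comm, Int.emod_add_mul_ediv, ← resid_coe] at h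
    rw [h]
    exact Submodule.smul_mem _ _ (Submodule.subset_span ⟨_, rfl⟩)
  obtain ⟨B, hB⟩ := exists_vec_eq heper fun v => by
    have hbasis : ∀ s : Fin p ⊕ Fin q, (Pi.single s 1 : Vec 𝕜 p q) ∈
        Submodule.span (LaurentSeries 𝕜) (Set.range fun r : Fin (p + q) => e (r : ℕ)) := by
      rintro (r | r)
      · obtain ⟨i, hi, hir⟩ := hx r
        rw [← hir, ← hi.elim (hpl i) (hop i)]
        exact hmem i
      · obtain ⟨i, hi, hir⟩ := hy r
        rw [← hir]
        rcases hi with hi | hi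
        · rw [← hmi i hi]
          exact hmem i
        · rw [← add_sub_cancel_left (x i) (y i), ← hop' i hi, ← hop i hi]
          exact Submodule.sub_mem _ (hmem _) (hmem i)
    rw [← (Pi.basisFun (LaurentSeries 𝕜) (Fin p ⊕ Fin q)).sum_repr v]
    refine Submodule.sum_mem _ fun s _ => Submodule.smul_mem _ _ ?_
    rw [Pi.basisFun_apply]
    exact hbasis s
  refine ⟨B, fun i hi => ?_, fun i hi => ?_, fun i hi => ?_, fun i hi => ?_⟩
  · rw [hB, hpl i hi, hxW]
  · rw [hB, hmi i hi, hyW]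
  · rw [hB, hop i hi, hxW]
  · rw [hB, hB, hop' i hi, hop i hi, map_add, hxW, hyW, add_zero]

/-! ### The action of `K` -/

theorem IsNormal.of_clanEquiv {c d : ℤ → ClanSymbol} {B : PBasis 𝕜 p q} (hB : IsNormal c B)
    (h : ClanEquiv c d) : IsNormal d B where
  plus i hi := hB.plus i ((h.1 i).1.mpr hi)
  minus i hi := hB.minus i ((h.1 i).2.mpr hi)
  opener := by
    rw [← h.mate_eq]
    exact hB.opener
  closer := by
    rw [← h.mate_eq]
    exact hB.closer

end

theorem projPlus_glEquiv {k : LoopGL 𝕜 p q} (hk : k ∈ blockGL 𝕜 p q) (v : Vec 𝕜 p q) :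
    projPlus 𝕜 p q (glEquiv k v) = glEquiv k (projPlus 𝕜 p q v) := by
  obtain ⟨a, d, h⟩ := hk
  rw [glEquiv_apply, glEquiv_apply, h, Matrix.fromBlocks_mulVec, Matrix.fromBlocks_mulVec]
  ext (r | s) : 1
  · simp only [projPlus, LinearMap.coe_mk, AddHom.coe_mk, Sum.elim_inl, Matrix.zero_mulVec,
      add_zero]
    rfl
  · have h0 : (Sum.elim (fun r => v (Sum.inl r)) (fun _ => 0) ∘ Sum.inr :
        Fin q → LaurentSeries 𝕜) = 0 := rfl
    simp only [projPlus, LinearMap.coe_mk, AddHom.coe_mk, Sum.elim_inr, Matrix.zero_mulVec,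
      zero_add, h0, Matrix.mulVec_zero, Pi.zero_apply]

theorem glEquiv_mem_smulSub {k : LoopGL 𝕜 p q} {M : Sub 𝕜 p q} {v : Vec 𝕜 p q} :
    glEquiv k v ∈ smulSub k M ↔ v ∈ M := by
  constructor
  · rintro ⟨u, hu, huv⟩
    rwa [← (glEquiv k).injective huv]
  · exact fun h => ⟨v, h, rfl⟩

theorem ext_smulSub {k : LoopGL 𝕜 p q} {M N : Sub 𝕜 p q}
    (h : ∀ v, v ∈ M ↔ glEquiv k v ∈ N) : smulSub k M = N := by
  ext w
  obtain ⟨v, rfl⟩ := (glEquiv k).surjective w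
  rw [glEquiv_mem_smulSub, h]

theorem smulSub_inf_Vplus {k : LoopGL 𝕜 p q} (hk : k ∈ blockGL 𝕜 p q) (M : Sub 𝕜 p q) :
    smulSub k (M ⊓ Vplus 𝕜 p q) = smulSub k M ⊓ Vplus 𝕜 p q :=
  ext_smulSub fun v => by
    rw [Submodule.mem_inf, Submodule.mem_inf, glEquiv_mem_smulSub, mem_Vplus_iff, mem_Vplus_iff,
      projPlus_glEquiv hk, (glEquiv k).injective.eq_iff]

theorem smulSub_inf_Vminus {k : LoopGL 𝕜 p q} (hk : k ∈ blockGL 𝕜 p q) (M : Sub 𝕜 p q) :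
    smulSub k (M ⊓ Vminus 𝕜 p q) = smulSub k M ⊓ Vminus 𝕜 p q :=
  ext_smulSub fun v => by
    rw [Submodule.mem_inf, Submodule.mem_inf, glEquiv_mem_smulSub, mem_Vminus_iff, mem_Vminus_iff,
      projPlus_glEquiv hk, LinearEquiv.map_eq_zero_iff]

theorem smulSub_map_projPlus {k : LoopGL 𝕜 p q} (hk : k ∈ blockGL 𝕜 p q) (M : Sub 𝕜 p q) :
    smulSub k (M.map (projPlus 𝕜 p q)) = (smulSub k M).map (projPlus 𝕜 p q) := by
  apply le_antisymm
  · rintro _ ⟨_, ⟨v, hv, rfl⟩, rfl⟩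
    exact ⟨glEquiv k v, glEquiv_mem_smulSub.mpr hv, projPlus_glEquiv hk v⟩
  · rintro _ ⟨_, ⟨v, hv, rfl⟩, rfl⟩
    exact ⟨projPlus 𝕜 p q v, ⟨v, hv, rfl⟩, (projPlus_glEquiv hk v).symm⟩

theorem smulSub_sup (k : LoopGL 𝕜 p q) (M N : Sub 𝕜 p q) :
    smulSub k (M ⊔ N) = smulSub k M ⊔ smulSub k N := Submodule.map_sup _ _ _

theorem smulSub_X_smul (k : LoopGL 𝕜 p q) (M : Sub 𝕜 p q) :
    smulSub k ((PowerSeries.X : PowerSeries 𝕜) • M) = (PowerSeries.X : PowerSeries 𝕜) •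
      smulSub k M := Submodule.map_pointwise_smul _ _ _

theorem dimPlus_smul {k : LoopGL 𝕜 p q} (hk : k ∈ blockGL 𝕜 p q) (Λ : AffineFlag 𝕜 p q) (i : ℤ) :
    dimPlus (k • Λ) i = dimPlus Λ i := by
  rw [dimPlus, smul_lat, smul_lat, ← smulSub_inf_Vplus hk, ← smulSub_inf_Vplus hk,
    relDim_smulSub, dimPlus]

theorem dimMinus_smul {k : LoopGL 𝕜 p q} (hk : k ∈ blockGL 𝕜 p q) (Λ : AffineFlag 𝕜 p q) (i : ℤ) :
    dimMinus (k • Λ) i = dimMinus Λ i := by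
  rw [dimMinus, smul_lat, smul_lat, ← smulSub_inf_Vminus hk, ← smulSub_inf_Vminus hk,
    relDim_smulSub, dimMinus]

theorem dimNat_smul {k : LoopGL 𝕜 p q} (hk : k ∈ blockGL 𝕜 p q) (Λ : AffineFlag 𝕜 p q) (i : ℤ) :
    dimNat (k • Λ) i = dimNat Λ i := by
  rw [dimNat, smul_lat, ← smulSub_inf_Vplus hk, ← smulSub_inf_Vminus hk, ← smulSub_sup,
    relDim_smulSub, dimNat]

theorem dimPair_smul {k : LoopGL 𝕜 p q} (hk : k ∈ blockGL 𝕜 p q) (Λ : AffineFlag 𝕜 p q)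
    (i j : ℤ) : dimPair (k • Λ) i j = dimPair Λ i j := by
  rw [dimPair, smul_lat, smul_lat, smul_lat, ← smulSub_map_projPlus hk, ← smulSub_sup,
    ← smulSub_X_smul, relDim_smulSub, dimPair]

theorem matchesInvariants_smul {k : LoopGL 𝕜 p q} (hk : k ∈ blockGL 𝕜 p q)
    {Λ : AffineFlag 𝕜 p q} {c : ℤ → ClanSymbol} (h : MatchesInvariants Λ c) :
    MatchesInvariants (k • Λ) c where
  nat i h1 h2 := by rw [dimNat_smul hk, h.nat i h1 h2]
  plus i h1 h2 h3 := by rw [dimPlus_smul hk, dimMinus_smul hk]; exact h.plus i h1 h2 h3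
  minus i h1 h2 h3 := by rw [dimPlus_smul hk, dimMinus_smul hk]; exact h.minus i h1 h2 h3
  pair i j h1 h2 h3 := by rw [dimPair_smul hk, h.pair i j h1 h2 h3]

/-- An `F`-linear automorphism that commutes with `π₊` is given by a block diagonal matrix. -/
theorem exists_mem_blockGL (g : Vec 𝕜 p q ≃ₗ[LaurentSeries 𝕜] Vec 𝕜 p q)
    (hg : ∀ v, projPlus 𝕜 p q (g v) = g (projPlus 𝕜 p q v)) :
    ∃ k ∈ blockGL 𝕜 p q, ∀ v, glEquiv k v = g v := by
  have hblock : ∀ f : Vec 𝕜 p q →ₗ[LaurentSeries 𝕜] Vec 𝕜 p q,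
      (∀ v, projPlus 𝕜 p q (f v) = f (projPlus 𝕜 p q v)) →
      LinearMap.toMatrix' f = Matrix.fromBlocks (LinearMap.toMatrix' f).toBlocks₁₁ 0 0
        (LinearMap.toMatrix' f).toBlocks₂₂ := by
    intro f hf
    ext (r | r) (s | s) : 1
    · rfl
    · have h1 : (Pi.single (Sum.inr s) 1 : Vec 𝕜 p q) ∈ Vminus 𝕜 p q := fun r => by simp
      have h2 := hf (Pi.single (Sum.inr s) 1)
      rw [mem_Vminus_iff.mp h1, map_zero] at h2
      rw [LinearMap.toMatrix'_apply, Matrix.fromBlocks_apply₁₂, Matrix.zero_apply]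
      exact mem_Vminus_iff.mpr h2 r
    · have h1 : (Pi.single (Sum.inl s) 1 : Vec 𝕜 p q) ∈ Vplus 𝕜 p q := fun r => by simp
      have h2 := hf (Pi.single (Sum.inl s) 1)
      rw [mem_Vplus_iff.mp h1] at h2
      rw [LinearMap.toMatrix'_apply, Matrix.fromBlocks_apply₂₁, Matrix.zero_apply]
      exact mem_Vplus_iff.mpr h2 r
    · rfl
  have hg' : ∀ v, projPlus 𝕜 p q (g.symm v) = g.symm (projPlus 𝕜 p q v) := fun v => by
    rw [← g.injective.eq_iff, ← hg, g.apply_symm_apply, g.apply_symm_apply]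
  have h1 := hblock g.toLinearMap hg
  have h2 := hblock g.symm.toLinearMap hg'
  have h12 : LinearMap.toMatrix' g.toLinearMap * LinearMap.toMatrix' g.symm.toLinearMap = 1 := by
    rw [← LinearMap.toMatrix'_comp, LinearEquiv.comp_symm, LinearMap.toMatrix'_id]
  have h21 : LinearMap.toMatrix' g.symm.toLinearMap * LinearMap.toMatrix' g.toLinearMap = 1 := by
    rw [← LinearMap.toMatrix'_comp, LinearEquiv.symm_comp, LinearMap.toMatrix'_id]
  have h3 := h12
  have h4 := h21
  rw [h1, h2, Matrix.fromBlocks_multiply, ← Matrix.fromBlocks_one, Matrix.fromBlocks_inj] at h3 h4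
  simp only [Matrix.zero_mul, Matrix.mul_zero, add_zero, zero_add] at h3 h4
  exact ⟨⟨_, _, h12, h21⟩, ⟨⟨_, _, h3.1, h4.1⟩, ⟨_, _, h3.2.2.2, h4.2.2.2⟩, h1⟩,
    fun v => LinearMap.toMatrix'_mulVec g.toLinearMap v⟩

section

variable [NeZero (p + q)]

/-- Flags with bases in normal form for the same clan are conjugate under `K`, because the change
of basis commutes with `π₊`. -/
theorem IsNormal.exists_smul_eq {c : ℤ → ClanSymbol} (hc : IsAffineClan p q c)
    {B B' : PBasis 𝕜 p q} (hB : IsNormal c B) (hB' : IsNormal c B') :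
    ∃ k ∈ blockGL 𝕜 p q, k • flagOf B = flagOf B' := by
  let g := B.equiv B' (Equiv.refl _)
  have hgB : ∀ r, g (B r) = B' r := fun r => B.equiv_apply r B' _
  have hvec : ∀ i, g (vec B i) = vec B' i := fun i => by
    rw [vec, map_smul, hgB, vec]
  have hcomm : (projLin 𝕜 p q).comp g.toLinearMap = g.toLinearMap.comp (projLin 𝕜 p q) := by
    refine B.ext fun r => ?_
    simp only [LinearMap.comp_apply, LinearEquiv.coe_coe, projLin_apply]
    rw [← vec_natCast, hvec]
    rcases hc.kind_cases (r : ℕ) with h | h | h | h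
    · rw [hB.plus _ h.1, hB'.plus _ h.1, hvec]
    · rw [hB.minus _ h.1, hB'.minus _ h.1, map_zero]
    · rw [hB.opener _ h, hB'.opener _ h, hvec]
    · have h1 := hB.closer (mate c (r : ℕ)) (by rwa [hc.mate_mate])
      have h2 := hB'.closer (mate c (r : ℕ)) (by rwa [hc.mate_mate])
      rw [hc.mate_mate] at h1 h2
      rw [h1, h2, hvec]
  obtain ⟨k, hk, hkg⟩ := exists_mem_blockGL g fun v => LinearMap.congr_fun hcomm v
  have hrepr : ∀ v, B'.repr (g v) = B.repr v := fun v => by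
    have : B'.repr.toLinearMap.comp g.toLinearMap = B.repr.toLinearMap :=
      B.ext fun r => by simp [hgB]
    exact LinearMap.congr_fun this v
  refine ⟨k, hk, ?_⟩
  ext1
  funext i
  refine ext_smulSub fun v => ?_
  rw [hkg]
  change (∀ j < i, coef B j v = 0) ↔ ∀ j < i, coef B' j (g v) = 0
  simp only [coef, LinearMap.coe_mk, AddHom.coe_mk, hrepr]

end

end

end AffineClans

open AffineClans in
theorem theorem1p3 (𝕜 : Type*) [Field 𝕜] (h2 : ringChar 𝕜 ≠ 2) (p q : ℕ) (hn : 0 < p + q) :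
    (∀ k ∈ blockGL 𝕜 p q, ∀ (Λ : AffineFlag 𝕜 p q) (i : ℤ),
      dimPlus (k • Λ) i = dimPlus Λ i ∧ dimMinus (k • Λ) i = dimMinus Λ i ∧
      dimNat (k • Λ) i = dimNat Λ i ∧
      ∀ j : ℤ, i < j → i ≤ (p + q : ℕ) + 1 → dimPair (k • Λ) i j = dimPair Λ i j) ∧
    (∀ Λ : AffineFlag 𝕜 p q, ∃ c : ℤ → ClanSymbol,
      IsClanSequenceOf Λ c ∧ IsAffineClan p q c ∧ MatchesInvariants Λ c ∧
      ∀ d : ℤ → ClanSymbol, IsAffineClan p q d → MatchesInvariants Λ d → ClanEquiv d c) ∧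
    ∃ Φ : MulAction.orbitRel.Quotient (blockGL 𝕜 p q) (AffineFlag 𝕜 p q) ≃ AffineClan p q,
      ∀ (Λ : AffineFlag 𝕜 p q) (c : ℤ → ClanSymbol) (hc : IsAffineClan p q c),
        IsClanSequenceOf Λ c →
          Φ (Quotient.mk (MulAction.orbitRel (blockGL 𝕜 p q) (AffineFlag 𝕜 p q)) Λ) =
            AffineClan.mk c hc := by
  have : NeZero (p + q) := ⟨hn.ne'⟩
  have key : ∀ Λ : AffineFlag 𝕜 p q, ∃ c : ℤ → ClanSymbol, IsClanSequenceOf Λ c ∧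
      IsAffineClan p q c ∧ MatchesInvariants Λ c ∧
      ∃ B : PBasis 𝕜 p q, Λ = flagOf B ∧ IsNormal c B := by
    intro Λ
    have hc := Λ.isAffineClan_openerClan
    obtain ⟨B, hΛ, hB⟩ := Λ.exists_isNormal
    have hB' := hB.relabel hc
    refine ⟨relabel p q Λ.openerClan, ?_, hc.relabel, ?_, B, hΛ, hB'⟩
    · conv_lhs => rw [hΛ]
      exact isClanSequenceOf_relabel hc hB
    · have h := hB'.matchesInvariants hc.relabel
      rwa [← hΛ] at h
  refine ⟨fun k hk Λ i => ⟨dimPlus_smul hk Λ i, dimMinus_smul hk Λ i, dimNat_smul hk Λ i,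
    fun j _ _ => dimPair_smul hk Λ i j⟩, fun Λ => ?_, ?_⟩
  · obtain ⟨c, h1, hc, h3, -⟩ := key Λ
    exact ⟨c, h1, hc, h3, fun d hd hdΛ => hdΛ.clanEquiv hn hd hc h3⟩
  · choose cl hseq hcl hinv hnorm using key
    let φ : MulAction.orbitRel.Quotient (blockGL 𝕜 p q) (AffineFlag 𝕜 p q) → AffineClan p q :=
      Quotient.lift (fun Λ => AffineClan.mk (cl Λ) (hcl Λ)) (by
        rintro Λ Λ' ⟨k, rfl⟩
        exact Quotient.sound ((hinv _).clanEquiv hn (hcl _) (hcl _)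
          (matchesInvariants_smul k.2 (hinv Λ'))))
    have hφ : Function.Bijective φ := by
      constructor
      · intro a b
        refine Quotient.inductionOn₂ a b fun Λ Λ' h => Quotient.sound ?_
        have heq : ClanEquiv (cl Λ) (cl Λ') := Quotient.exact h
        obtain ⟨B, hΛ, hB⟩ := hnorm Λ
        obtain ⟨B', hΛ', hB'⟩ := hnorm Λ'
        obtain ⟨k, hk, hkB⟩ := hB'.exists_smul_eq (hcl Λ') (hB.of_clanEquiv heq)
        rw [← hΛ, ← hΛ'] at hkB
        exact ⟨⟨k, hk⟩, hkB⟩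
      · intro a
        refine Quotient.inductionOn a fun ⟨c, hc⟩ => ?_
        obtain ⟨B, hB⟩ := hc.exists_isNormal 𝕜
        exact ⟨Quotient.mk _ (flagOf B), Quotient.sound ((hinv _).clanEquiv hn (hcl _) hc
          (hB.matchesInvariants hc))⟩
    refine ⟨Equiv.ofBijective φ hφ, fun Λ c hc h => ?_⟩
    obtain rfl : cl Λ = c := funext fun i =>
      Option.some_injective _ ((hseq Λ i).symm.trans (h i))
    rfl
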